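/- Let $B^2$ denote the closed Euclidean unit disk of the plane. A \emph{spindle convex disk} is a compact convex set $K\subset\mathbb{R}^2$ with nonempty interior such that for all $p,q\in K$, the intersection of all translates of $B^2$ that contain both $p$ and $q$ (understood to be $\mathbb{R}^2$ if there is no such translate) is contained in $K$. For an integer $n\ge 3$, a \emph{disk-$n$-gon} is the intersection of $n$ (not necessarily distinct) translates of $B^2$; its vertices are those of its points that lie on at least two different ones of the $n$ bounding unit circles, and it is \emph{inscribed} in $K$ if it is contained in $K$ and all its vertices lie on the boundary of $K$. Let \[ \hat a_n(K)=\sup\{\operatorname{area}(Q) : Q \text{ is a disk-}n\text{-gon inscribed in } K\}. \] Then for every $n\ge 4$ and every spindle convex disk $K$, \[ \hat a_{n-1}(K)+\hat a_{n+1}(K)\le 2\,\hat a_n(K). \] -/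

import Mathlib

/-- The Euclidean plane. -/
abbrev Plane : Type := EuclideanSpace ℝ (Fin 2)

/-- The spindle of `p` and `q`: the intersection of all closed unit disks that contain both points.
It is the whole plane if there is no such disk (an empty intersection). -/
def spindle (p q : Plane) : Set Plane :=
  ⋂ x ∈ {x : Plane | p ∈ Metric.closedBall x 1 ∧ q ∈ Metric.closedBall x 1}, Metric.closedBall x 1

/-- A spindle convex disk: a compact convex set with nonempty interior in the plane that contains
the spindle of any two of its points. -/
structure IsSpindleConvexDisk (K : Set Plane) : Prop where
  isCompact : IsCompact K
  convex : Convex ℝ K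
  nonempty_interior : (interior K).Nonempty
  spindle_subset : ∀ p ∈ K, ∀ q ∈ K, spindle p q ⊆ K

/-- The disk-`n`-gon with centers `c`: the intersection of the `n` closed unit disks centered at the
points `c i`. The centers need not be distinct, and some of the disks may be redundant. -/
def diskPolygon {n : ℕ} (c : Fin n → Plane) : Set Plane :=
  ⋂ i, Metric.closedBall (c i) 1

/-- The vertices of a disk-`n`-gon: those of its points that lie on two different ones of the
bounding unit circles. -/
def diskPolygonVertices {n : ℕ} (c : Fin n → Plane) : Set Plane :=
  {x | x ∈ diskPolygon c ∧ ∃ i j, c i ≠ c j ∧ dist x (c i) = 1 ∧ dist x (c j) = 1}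

/-- A disk-`n`-gon is inscribed in `K` if it is contained in `K` and all its vertices lie on the
boundary of `K`. -/
def IsInscribedDiskPolygon {n : ℕ} (c : Fin n → Plane) (K : Set Plane) : Prop :=
  diskPolygon c ⊆ K ∧ diskPolygonVertices c ⊆ frontier K

/-- The set of the areas of the disk-`n`-gons inscribed in `K`. -/
def inscribedAreas (n : ℕ) (K : Set Plane) : Set ℝ :=
  {a | ∃ c : Fin n → Plane, IsInscribedDiskPolygon c K ∧
    a = (MeasureTheory.volume (diskPolygon c)).toReal}

/-- The supremum of the areas of the disk-`n`-gons inscribed in `K`. -/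
noncomputable def maxInscribedArea (n : ℕ) (K : Set Plane) : ℝ :=
  sSup (inscribedAreas n K)

/-- The supremum is taken over a set that is bounded above. -/
theorem bddAbove_inscribedAreas (n : ℕ) {K : Set Plane} (hK : IsCompact K) :
    BddAbove (inscribedAreas n K) := by
  refine ⟨(MeasureTheory.volume K).toReal, ?_⟩
  rintro a ⟨c, hc, rfl⟩
  exact ENNReal.toReal_mono hK.measure_lt_top.ne (MeasureTheory.measure_mono hc.1)

/-- The supremum is taken over a nonempty set: a boundary point of `K` is an inscribed
disk-`n`-gon, being the intersection of two touching unit disks. -/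
theorem inscribedAreas_nonempty {n : ℕ} (hn : 2 ≤ n) {K : Set Plane}
    (hK : IsSpindleConvexDisk K) : (inscribedAreas n K).Nonempty := by
  have hne : (frontier K).Nonempty := by
    rw [nonempty_frontier_iff]
    refine ⟨hK.nonempty_interior.mono interior_subset, fun h => ?_⟩
    exact noncompact_univ Plane (h ▸ hK.isCompact)
  obtain ⟨x, hx⟩ := hne
  obtain ⟨u, hu⟩ := exists_norm_eq Plane zero_le_one
  let c : Fin n → Plane := fun i => if i.val = 0 then x + u else x - u
  have hsub : diskPolygon c ⊆ {x} := by
    intro y hy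
    have hy' := Set.mem_iInter.1 hy
    have h0 : ‖(y - x) - u‖ ≤ 1 := by
      simpa [c, dist_eq_norm, sub_sub] using hy' ⟨0, by omega⟩
    have h1 : ‖(y - x) + u‖ ≤ 1 := by
      have := hy' ⟨1, by omega⟩
      simp only [c, one_ne_zero, if_false, Metric.mem_closedBall, dist_eq_norm] at this
      rwa [show y - x + u = y - (x - u) by abel]
    have hpar := parallelogram_law_with_norm ℝ (y - x) u
    have hz : ‖y - x‖ = 0 := by
      nlinarith [norm_nonneg (y - x), norm_nonneg ((y - x) - u), norm_nonneg ((y - x) + u)]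
    exact sub_eq_zero.1 (norm_eq_zero.1 hz)
  refine ⟨_, c, ⟨?_, ?_⟩, rfl⟩
  · intro y hy
    rw [hsub hy]
    exact hK.isCompact.isClosed.frontier_subset hx
  · intro y hy
    rw [hsub hy.1]
    exact hx

/-! A unit disk is inscribed in itself, so nothing is to be shown if `K` is one. Otherwise any two
points of `K` have distance less than 2 (`eq_closedBall_or_sqDist_lt`), and the concavity follows,
in the manner of Dowker's theorems, from a quadrangle (Monge) inequality and an uncrossing of two
polygons.

The loss of a chord `a c` is `capLoss K a c`: the area of the cap of `K` to its right minus the area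
of the unit-disk segment over it. The part of `K` left of the chord lies in the unit disk that
carries this segment (`sqDist_arcCenter_le`). Hence the disks over the sides of an inscribed polygon
form an inscribed disk-polygon with area at least that of `K` minus the total loss
(`IsInscribedSeq.exists_isInscribedDiskPolygon`). Conversely, a disk-m-gon in `K` has at most the
area of the unit hull of m boundary points (`exists_stuck_of_diskPolygon`), and that hull has at
most the area of `K` minus the total loss (`IsInscribedSeq.volume_unitHull_le`). It remains to
recombine an m-gon and an (m+2)-gon into two (m+1)-gons without raising the total loss.

This rests on `capLoss K a c + capLoss K b d ≤ capLoss K a d + capLoss K b c` for `a, b, c, d` in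
counterclockwise order. Additivity of caps reduces it to a statement on half a determinant plus a
segment area. One endpoint moves from `a` to `b` and the other from `c` to `d`, both along unit
arcs; the mixed second derivative of that function is nonnegative (`mixed_derivative_nonneg`),
provided that the radii at the moving points turn by at most π.

The proviso comes from a choice of the m-gon. Scaling a point set up does not decrease the area of
its unit hull, so the points may be replaced by a largest enlarged translate in `K`. Such a set is
stuck: no direction leads from all of its points into the interior of `K`
(`exists_maximal_enlargement`, `exists_stuck_boundary_set`). A turn by more than π would put all
normals at the stuck points into one open half-plane, which gives such a direction
(`radii_cross_nonneg`). This needs the stuck points to lie outside the two arcs; therefore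
`exists_exchange` makes every exchange within a gap between consecutive vertices of the m-gon. -/

/-! ### Plane geometry in coordinates -/

/-- The squared distance of two points, in coordinates. -/
def sqDist (x y : Plane) : ℝ := (x 0 - y 0) ^ 2 + (x 1 - y 1) ^ 2

/-- The determinant of two vectors of the plane. -/
def cross (u v : Plane) : ℝ := u 0 * v 1 - u 1 * v 0

/-- The scalar product of two vectors of the plane, in coordinates. -/
def dotp (u v : Plane) : ℝ := u 0 * v 0 + u 1 * v 1

/-- The orientation determinant of three points, positive for a counterclockwise triangle. -/
def orient (a b c : Plane) : ℝ := (b 0 - a 0) * (c 1 - a 1) - (b 1 - a 1) * (c 0 - a 0)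

theorem dist_sq_eq_sqDist (x y : Plane) : dist x y ^ 2 = sqDist x y := by
  rw [EuclideanSpace.dist_eq, Real.sq_sqrt (by positivity), Fin.sum_univ_two, Real.dist_eq,
    Real.dist_eq, sq_abs, sq_abs, sqDist]

theorem dist_le_one_iff {x y : Plane} : dist x y ≤ 1 ↔ sqDist x y ≤ 1 := by
  rw [← dist_sq_eq_sqDist, sq_le_one_iff₀ dist_nonneg]

theorem mem_unitBall_iff {x c : Plane} : x ∈ Metric.closedBall c 1 ↔ sqDist x c ≤ 1 := by
  rw [Metric.mem_closedBall, dist_le_one_iff]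

theorem dist_eq_one_iff {x y : Plane} : dist x y = 1 ↔ sqDist x y = 1 := by
  rw [← dist_sq_eq_sqDist, pow_eq_one_iff_of_nonneg dist_nonneg two_ne_zero]

theorem sqDist_nonneg (x y : Plane) : 0 ≤ sqDist x y := by
  unfold sqDist; positivity

theorem sqDist_comm (x y : Plane) : sqDist x y = sqDist y x := by
  unfold sqDist; ring

theorem plane_ext {x y : Plane} (h0 : x 0 = y 0) (h1 : x 1 = y 1) : x = y := by
  ext i; fin_cases i <;> assumption

theorem sqDist_pos {x y : Plane} (h : x ≠ y) : 0 < sqDist x y := by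
  rw [← dist_sq_eq_sqDist]
  have := dist_pos.2 h
  positivity

theorem eq_of_sqDist_eq_zero {x y : Plane} (h : sqDist x y = 0) : x = y := by
  by_contra hne
  exact (sqDist_pos hne).ne' h

theorem mem_spindle_iff {p q x : Plane} :
    x ∈ spindle p q ↔ ∀ c : Plane, sqDist p c ≤ 1 → sqDist q c ≤ 1 → sqDist x c ≤ 1 := by
  simp only [spindle, Set.mem_iInter, Set.mem_ofPred_eq, mem_unitBall_iff]
  exact ⟨fun h c h1 h2 => h c ⟨h1, h2⟩, fun h c hc => h c hc.1 hc.2⟩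

theorem mem_diskPolygon_iff {n : ℕ} {c : Fin n → Plane} {x : Plane} :
    x ∈ diskPolygon c ↔ ∀ i, sqDist x (c i) ≤ 1 := by
  simp [diskPolygon, Set.mem_iInter, ← mem_unitBall_iff]

/-! ### Normals and the supporting unit disks -/

/-- `n` is an outer unit normal of `K` at `y`. -/
def IsUnitNormal (K : Set Plane) (n y : Plane) : Prop :=
  n 0 ^ 2 + n 1 ^ 2 = 1 ∧ ∀ x ∈ K, n 0 * (x 0 - y 0) + n 1 * (x 1 - y 1) ≤ 0

/-- A point raised from a chord by the amount that strong convexity allows lies in the spindle. -/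
theorem raised_mem_spindle {x y n : Plane} (hn : n 0 ^ 2 + n 1 ^ 2 = 1) {t : ℝ} (h0 : 0 ≤ t)
    (h1 : t ≤ 1) :
    (!₂[y 0 + t * (x 0 - y 0) + t * (1 - t) * sqDist x y / 2 * n 0,
      y 1 + t * (x 1 - y 1) + t * (1 - t) * sqDist x y / 2 * n 1] : Plane) ∈ spindle x y := by
  rw [mem_spindle_iff]
  intro c hx hy
  set r := t * (1 - t) * sqDist x y with hr
  have hr0 : 0 ≤ r := mul_nonneg (mul_nonneg h0 (by linarith)) (sqDist_nonneg _ _)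
  set u0 := y 0 + t * (x 0 - y 0) - c 0 with hu0
  set u1 := y 1 + t * (x 1 - y 1) - c 1 with hu1
  have hu : u0 ^ 2 + u1 ^ 2 ≤ 1 - r := by
    have : u0 ^ 2 + u1 ^ 2 = (1 - t) * sqDist y c + t * sqDist x c - r := by
      simp only [hu0, hu1, hr, sqDist]; ring
    rw [this]
    nlinarith
  have hcs : (u0 * n 0 + u1 * n 1) ^ 2 ≤ u0 ^ 2 + u1 ^ 2 := by
    nlinarith [sq_nonneg (u0 * n 1 - u1 * n 0)]
  have hlin : u0 * n 0 + u1 * n 1 ≤ 1 - r / 2 := by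
    have hr1 : r ≤ 1 := by nlinarith [sq_nonneg u0, sq_nonneg u1]
    apply abs_le_of_sq_le_sq' _ (by linarith) |>.2
    nlinarith
  have : sqDist (!₂[y 0 + t * (x 0 - y 0) + r / 2 * n 0,
      y 1 + t * (x 1 - y 1) + r / 2 * n 1] : Plane) c
      = u0 ^ 2 + u1 ^ 2 + r * (u0 * n 0 + u1 * n 1) + r ^ 2 / 4 * (n 0 ^ 2 + n 1 ^ 2) := by
    simp [sqDist, hu0, hu1]; ring
  rw [this, hn]
  nlinarith

/-- The normal inequality at a raised point of the chord, divided by `t`, gives the claim as `t`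
tends to 0. Completing the square, it says that `K` lies in the unit disk about `y - n`, which
touches `K` at `y`. -/
theorem IsUnitNormal.sqDist_le {K : Set Plane} (hK : IsSpindleConvexDisk K) {n y : Plane}
    (hn : IsUnitNormal K n y) (hy : y ∈ K) {x : Plane} (hx : x ∈ K) :
    sqDist x y + 2 * (n 0 * (x 0 - y 0) + n 1 * (x 1 - y 1)) ≤ 0 := by
  set A := n 0 * (x 0 - y 0) + n 1 * (x 1 - y 1) with hA
  have key : ∀ t : ℝ, 0 < t → t ≤ 1 → A + (1 - t) * sqDist x y / 2 ≤ 0 := by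
    intro t h0 h1
    have h := hn.2 _ (hK.spindle_subset x hx y hy (raised_mem_spindle (x := x) (y := y) hn.1 h0.le h1))
    simp only [Matrix.cons_val_zero, Matrix.cons_val_one] at h
    have : t * (A + (1 - t) * sqDist x y / 2) ≤ 0 := by
      calc _ = t * A + t * (1 - t) * sqDist x y / 2 * (n 0 ^ 2 + n 1 ^ 2) := by rw [hn.1]; ring
        _ ≤ 0 := by rw [hA]; linarith
    by_contra hc
    push Not at hc
    nlinarith [mul_pos h0 hc]
  by_contra hc
  push Not at hc
  have hs := sqDist_nonneg x y
  rcases le_or_gt (sqDist x y + 2 * A) (sqDist x y) with h | h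
  · have hs' : 0 < sqDist x y := by linarith
    -- For this `t` the left side of `key` equals a quarter of `sqDist x y + 2 * A`, which is
    -- positive.
    have := key ((sqDist x y + 2 * A) / (2 * sqDist x y)) (by positivity)
      (by rw [div_le_one (by positivity)]; linarith)
    have e : (sqDist x y + 2 * A) / (2 * sqDist x y) * sqDist x y = (sqDist x y + 2 * A) / 2 := by
      field_simp
    nlinarith
  · have := key 1 one_pos le_rfl
    linarith

theorem linear_form_eq (f : Plane →L[ℝ] ℝ) (x : Plane) :
    f x = f (EuclideanSpace.single 0 1) * x 0 + f (EuclideanSpace.single 1 1) * x 1 := by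
  have : x = x 0 • EuclideanSpace.single 0 (1 : ℝ) + x 1 • EuclideanSpace.single 1 (1 : ℝ) := by
    apply plane_ext <;> simp
  conv_lhs => rw [this]
  simp [mul_comm]

/-- A nonconstant linear form that is maximal at `y` on `K` normalizes to a unit normal. -/
theorem exists_isUnitNormal_of_linear {K : Set Plane} {y : Plane} (f : Plane →L[ℝ] ℝ) (hf : f ≠ 0)
    (h : ∀ x ∈ K, f x ≤ f y) :
    ∃ n, IsUnitNormal K n y ∧ ∃ r : ℝ, 0 < r ∧ ∀ z : Plane, dotp n z = r * f z := by
  set a := f (EuclideanSpace.single 0 1)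
  set b := f (EuclideanSpace.single 1 1)
  have hab : 0 < a ^ 2 + b ^ 2 := by
    by_contra hc
    have ha : a = 0 := by nlinarith [sq_nonneg a, sq_nonneg b]
    have hb : b = 0 := by nlinarith [sq_nonneg a, sq_nonneg b]
    apply hf
    ext z
    rw [linear_form_eq f z]
    show a * _ + b * _ = _
    simp [ha, hb]
  set s := √(a ^ 2 + b ^ 2) with hs
  have hs0 : 0 < s := Real.sqrt_pos.2 hab
  have hs2 : s ^ 2 = a ^ 2 + b ^ 2 := Real.sq_sqrt hab.le
  refine ⟨!₂[a / s, b / s], ⟨?_, fun x hx => ?_⟩, s⁻¹, inv_pos.2 hs0, fun z => ?_⟩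
  · simp only [Matrix.cons_val_zero, Matrix.cons_val_one, div_pow, hs2]
    field_simp
  · have := h x hx
    rw [linear_form_eq f x, linear_form_eq f y] at this
    simp only [Matrix.cons_val_zero, Matrix.cons_val_one]
    have e : a / s * (x 0 - y 0) + b / s * (x 1 - y 1)
      = (a * x 0 + b * x 1 - (a * y 0 + b * y 1)) / s := by ring
    rw [e]
    apply div_nonpos_of_nonpos_of_nonneg _ hs0.le
    linarith
  · rw [linear_form_eq f z]
    simp only [dotp, Matrix.cons_val_zero, Matrix.cons_val_one]
    ring

theorem IsSpindleConvexDisk.frontier_subset {K : Set Plane} (hK : IsSpindleConvexDisk K) :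
    frontier K ⊆ K := hK.isCompact.isClosed.frontier_subset

theorem IsSpindleConvexDisk.subset_closure_interior {K : Set Plane} (hK : IsSpindleConvexDisk K) :
    K ⊆ closure (interior K) := by
  rw [hK.convex.closure_interior_eq_closure_of_nonempty_interior hK.nonempty_interior]
  exact subset_closure

theorem exists_isUnitNormal {K : Set Plane} (hK : IsSpindleConvexDisk K) {y : Plane}
    (hy : y ∈ frontier K) : ∃ n, IsUnitNormal K n y := by
  have hyi : y ∉ interior K := hy.2
  obtain ⟨f, hf⟩ := geometric_hahn_banach_open_point hK.convex.interior isOpen_interior hyi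
  have hne : f ≠ 0 := by
    rintro rfl
    obtain ⟨x, hx⟩ := hK.nonempty_interior
    simpa using hf x hx
  obtain ⟨n, hn, -⟩ := exists_isUnitNormal_of_linear (K := K) f hne (y := y) (by
    intro x hx
    have : closure (interior K) ⊆ {x | f x ≤ f y} :=
      closure_minimal (fun x hx => (hf x hx).le) (isClosed_le f.continuous continuous_const)
    exact this (hK.subset_closure_interior hx))
  exact ⟨n, hn⟩

/-- At every boundary point, some linear form has a strict maximum. -/
theorem exists_strict_normal {K : Set Plane} (hK : IsSpindleConvexDisk K) {y : Plane}
    (hy : y ∈ frontier K) :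
    ∃ n : Plane, ∀ x ∈ K, x ≠ y → n 0 * (x 0 - y 0) + n 1 * (x 1 - y 1) < 0 := by
  obtain ⟨n, hn⟩ := exists_isUnitNormal hK hy
  refine ⟨n, fun x hx hne => ?_⟩
  have := hn.sqDist_le hK (hK.frontier_subset hy) hx
  linarith [sqDist_pos hne]

theorem IsUnitNormal.lt {K : Set Plane} (hK : IsSpindleConvexDisk K) {n y : Plane}
    (hn : IsUnitNormal K n y) (hy : y ∈ K) {x : Plane} (hx : x ∈ K) (hne : x ≠ y) :
    n 0 * (x 0 - y 0) + n 1 * (x 1 - y 1) < 0 := by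
  have := hn.sqDist_le hK hy hx
  linarith [sqDist_pos hne]

/-- A boundary point is not a proper convex combination of points of `K`. -/
theorem no_barycenter {K : Set Plane} (hK : IsSpindleConvexDisk K) {y a b c : Plane}
    (hy : y ∈ frontier K) (ha : a ∈ K) (hb : b ∈ K) (hc : c ∈ K) {r s t : ℝ} (hr : 0 < r)
    (hs : 0 ≤ s) (ht : 0 ≤ t) (hay : a ≠ y)
    (h0 : r * (a 0 - y 0) + s * (b 0 - y 0) + t * (c 0 - y 0) = 0)
    (h1 : r * (a 1 - y 1) + s * (b 1 - y 1) + t * (c 1 - y 1) = 0) : False := by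
  obtain ⟨n, hn⟩ := exists_isUnitNormal hK hy
  have ea := hn.lt hK (hK.frontier_subset hy) ha hay
  have eb := hn.2 b hb
  have ec := hn.2 c hc
  have : r * (n 0 * (a 0 - y 0) + n 1 * (a 1 - y 1)) + s * (n 0 * (b 0 - y 0) + n 1 * (b 1 - y 1))
    + t * (n 0 * (c 0 - y 0) + n 1 * (c 1 - y 1)) = 0 := by
    linear_combination n 0 * h0 + n 1 * h1
  nlinarith [mul_neg_of_pos_of_neg hr ea, mul_nonneg hs (neg_nonneg.2 eb),
    mul_nonneg ht (neg_nonneg.2 ec)]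

/-- Either `K` is a unit disk, or its diameter is less than two. -/
theorem eq_closedBall_or_sqDist_lt {K : Set Plane} (hK : IsSpindleConvexDisk K) :
    (∃ o, K = Metric.closedBall o 1) ∨ ∀ x ∈ K, ∀ y ∈ K, sqDist x y < 4 := by
  by_contra hcon
  push Not at hcon
  obtain ⟨hball, x, hx, y, hy, hxy⟩ := hcon
  -- No unit disk contains two points at distance more than 2, so their spindle is the whole plane.
  have hne : ∀ x ∈ K, ∀ y ∈ K, ¬ 4 < sqDist x y := by
    intro x hx y hy hxy
    have hsub := hK.spindle_subset x hx y hy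
    have : K = Set.univ := by
      refine Set.eq_univ_of_forall fun z => hsub (mem_spindle_iff.2 fun c h1 h2 => ?_)
      exfalso
      unfold sqDist at *
      nlinarith [sq_nonneg (x 0 - c 0 + (y 0 - c 0)), sq_nonneg (x 1 - c 1 + (y 1 - c 1))]
    exact noncompact_univ Plane (this ▸ hK.isCompact)
  have hxy4 : sqDist x y = 4 := le_antisymm (not_lt.1 (hne x hx y hy)) hxy
  set o : Plane := !₂[(x 0 + y 0) / 2, (x 1 + y 1) / 2] with ho
  have ho0 : o 0 = (x 0 + y 0) / 2 := by simp [ho]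
  have ho1 : o 1 = (x 1 + y 1) / 2 := by simp [ho]
  -- At distance exactly 2, the only unit disk through both points is the one about their midpoint,
  -- and it is the spindle.
  have hsub : Metric.closedBall o 1 ⊆ K := by
    refine Set.Subset.trans (fun z hz => mem_spindle_iff.2 fun c h1 h2 => ?_)
      (hK.spindle_subset x hx y hy)
    have : c = o := by
      apply eq_of_sqDist_eq_zero
      apply le_antisymm _ (sqDist_nonneg _ _)
      unfold sqDist at *
      rw [ho0, ho1]
      nlinarith
    rw [this]
    exact mem_unitBall_iff.1 hz
  refine hball o (Set.Subset.antisymm (fun z hz => ?_) hsub)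
  rw [mem_unitBall_iff]
  by_contra hc
  push Not at hc
  set s := √(sqDist z o)
  have hs2 : s ^ 2 = sqDist z o := Real.sq_sqrt (by linarith)
  have hs1 : 1 < s := by
    by_contra h
    push Not at h
    nlinarith [Real.sqrt_nonneg (sqDist z o)]
  -- The point of the unit circle opposite to `z`; its distance from `z` is `s + 1`, more than 2.
  set w : Plane := !₂[o 0 - (z 0 - o 0) / s, o 1 - (z 1 - o 1) / s] with hw
  have hw0 : w 0 = o 0 - (z 0 - o 0) / s := by simp [hw]
  have hw1 : w 1 = o 1 - (z 1 - o 1) / s := by simp [hw]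
  have hwo : sqDist w o = 1 := by
    have : sqDist w o = sqDist z o / s ^ 2 := by
      unfold sqDist; rw [hw0, hw1]; field_simp; ring
    rw [this, ← hs2]; field_simp
  apply hne z hz w (hsub (mem_unitBall_iff.2 hwo.le))
  have : sqDist z w = (s + 1) ^ 2 := by
    have : sqDist z w = sqDist z o * (1 + 1 / s) ^ 2 := by
      unfold sqDist; rw [hw0, hw1]; ring
    rw [this, ← hs2]; field_simp
  rw [this]; nlinarith

/-! ### Unit disks over chords, and spindles -/

/-- The center of the unit circle through `a` and `c` that lies to the left of the chord from `a`
to `c`. -/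
noncomputable def arcCenter (a c : Plane) : Plane :=
  !₂[(a 0 + c 0) / 2 - √(1 / sqDist a c - 1 / 4) * (c 1 - a 1),
    (a 1 + c 1) / 2 + √(1 / sqDist a c - 1 / 4) * (c 0 - a 0)]

/-- Replaces the square root by a polynomial relation for `t`, the distance of the center from the
chord divided by the length of the chord. -/
theorem exists_arcCenter_eq {a c : Plane} (hne : a ≠ c) (hL : sqDist a c ≤ 4) :
    ∃ t : ℝ, 0 ≤ t ∧ t ^ 2 * sqDist a c = 1 - sqDist a c / 4 ∧
      arcCenter a c 0 = (a 0 + c 0) / 2 - t * (c 1 - a 1) ∧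
      arcCenter a c 1 = (a 1 + c 1) / 2 + t * (c 0 - a 0) := by
  refine ⟨√(1 / sqDist a c - 1 / 4), Real.sqrt_nonneg _, ?_, by simp [arcCenter],
    by simp [arcCenter]⟩
  have h := sqDist_pos hne
  rw [Real.sq_sqrt]
  · field_simp
  · rw [sub_nonneg, div_le_div_iff₀ (by norm_num) h]; linarith

theorem sqDist_arcCenter_left {a c : Plane} (hne : a ≠ c) (hL : sqDist a c ≤ 4) :
    sqDist a (arcCenter a c) = 1 := by
  obtain ⟨t, -, ht, h0, h1⟩ := exists_arcCenter_eq hne hL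
  unfold sqDist at *
  rw [h0, h1]
  linear_combination ht

theorem sqDist_arcCenter_right {a c : Plane} (hne : a ≠ c) (hL : sqDist a c ≤ 4) :
    sqDist c (arcCenter a c) = 1 := by
  obtain ⟨t, -, ht, h0, h1⟩ := exists_arcCenter_eq hne hL
  unfold sqDist at *
  rw [h0, h1]
  linear_combination ht

/-- In a frame whose first axis points from `a` to the arc center, `(k1, -k2)` is the chord, `m` an
inner normal of `K` and `y` a point seen from `a`. By `hmk`, `m` is turned from the first axis
towards the chord, and `y` lies on the other side of that axis. So `y` has a larger component along
the axis than along `m`. -/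
theorem frame_inequality {y1 y2 m1 m2 k1 k2 : ℝ} (hk1 : 0 < k1) (hk2 : 0 ≤ k2)
    (hm : m1 ^ 2 + m2 ^ 2 = 1) (hmk : k1 ≤ k1 * m1 - k2 * m2) (hy : 0 ≤ k1 * y2 + k2 * y1)
    (hy2 : 0 ≤ y2) : m1 * y1 + m2 * y2 ≤ y1 := by
  have hm1 : m1 ≤ 1 := by nlinarith [sq_nonneg m2]
  rcases hk2.eq_or_lt with rfl | hk2
  · have : m1 = 1 := by nlinarith
    have : m2 = 0 := by subst this; nlinarith
    simp_all
  · have hm2 : m2 ≤ 0 := by nlinarith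
    rcases le_or_gt 0 y1 with h | h
    · nlinarith
    · have : 0 ≤ k2 * (y1 * (1 - m1) - m2 * y2) := by nlinarith
      have := nonneg_of_mul_nonneg_right this hk2
      linarith

theorem sqDist_le_one_of_cone {a c o x : Plane} {d α γ : ℝ} (hd : 0 < d) (hα : 0 ≤ α) (hγ : 0 ≤ γ)
    (hsum : α + γ ≤ d) (hac : sqDist a o = 1) (hcc : sqDist c o = 1)
    (hx0 : d * (x 0 - o 0) = α * (a 0 - o 0) + γ * (c 0 - o 0))
    (hx1 : d * (x 1 - o 1) = α * (a 1 - o 1) + γ * (c 1 - o 1)) : sqDist x o ≤ 1 := by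
  have e : d ^ 2 * sqDist x o = α ^ 2 * sqDist a o + γ ^ 2 * sqDist c o
      + α * γ * (sqDist a o + sqDist c o - sqDist a c) := by
    have : d ^ 2 * sqDist x o = (d * (x 0 - o 0)) ^ 2 + (d * (x 1 - o 1)) ^ 2 := by
      unfold sqDist; ring
    rw [this, hx0, hx1]; unfold sqDist; ring
  rw [hac, hcc] at e
  have h1 : (α + γ) ^ 2 ≤ d ^ 2 := pow_le_pow_left₀ (by positivity) hsum 2
  have h2 := mul_nonneg (mul_nonneg hα hγ) (sqDist_nonneg a c)
  have : d ^ 2 * sqDist x o ≤ d ^ 2 * 1 := by rw [e]; nlinarith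
  exact le_of_mul_le_mul_left this (by positivity)

theorem cramer_fst {d a0 a1 c0 c1 x0 x1 : ℝ} (hd : d ≠ 0) (h : a0 * c1 - a1 * c0 = d) :
    x0 = (x0 * c1 - x1 * c0) / d * a0 + (a0 * x1 - a1 * x0) / d * c0 := by
  field_simp
  rw [← h]; ring

theorem cramer_snd {d a0 a1 c0 c1 x0 x1 : ℝ} (hd : d ≠ 0) (h : a0 * c1 - a1 * c0 = d) :
    x1 = (x0 * c1 - x1 * c0) / d * a1 + (a0 * x1 - a1 * x0) / d * c1 := by
  field_simp
  rw [← h]; ring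

/-- The part of `K` to the left of a chord lies in the unit disk through the endpoints of the chord
with center on the left. -/
theorem sqDist_arcCenter_le {K : Set Plane} (hK : IsSpindleConvexDisk K) {a c x : Plane}
    (ha : a ∈ frontier K) (hc : c ∈ frontier K) (hne : a ≠ c) (hL : sqDist a c ≤ 4) (hx : x ∈ K)
    (ho : 0 ≤ orient a c x) : sqDist x (arcCenter a c) ≤ 1 := by
  obtain ⟨t, ht0, ht, h0, h1⟩ := exists_arcCenter_eq hne hL
  have hLp := sqDist_pos hne
  have hac := sqDist_arcCenter_left hne hL
  have hcc := sqDist_arcCenter_right hne hL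
  set o := arcCenter a c
  have haK := hK.frontier_subset ha
  have hcK := hK.frontier_subset hc
  obtain ⟨n, hn⟩ := exists_isUnitNormal hK ha
  obtain ⟨n', hn'⟩ := exists_isUnitNormal hK hc
  have e1 := hn.sqDist_le hK haK hx
  have e2 := hn.sqDist_le hK haK hcK
  have e3 := hn'.sqDist_le hK hcK hx
  have e4 := hn'.sqDist_le hK hcK haK
  have hu := hn.1
  have hu' := hn'.1
  have hox : sqDist x o = 1 + sqDist x a
      - 2 * ((o 0 - a 0) * (x 0 - a 0) + (o 1 - a 1) * (x 1 - a 1)) := by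
    rw [← hac]; unfold sqDist; ring
  have hox' : sqDist x o = 1 + sqDist x c
      - 2 * ((o 0 - c 0) * (x 0 - c 0) + (o 1 - c 1) * (x 1 - c 1)) := by
    rw [← hcc]; unfold sqDist; ring
  have hdot : (o 0 - a 0) * (c 0 - a 0) + (o 1 - a 1) * (c 1 - a 1) = sqDist a c / 2 := by
    rw [h0, h1]; unfold sqDist; ring
  have hdot' : (o 0 - c 0) * (a 0 - c 0) + (o 1 - c 1) * (a 1 - c 1) = sqDist a c / 2 := by
    rw [h0, h1]; unfold sqDist; ring
  have hdet : (c 0 - a 0) * (o 1 - a 1) - (c 1 - a 1) * (o 0 - a 0) = t * sqDist a c := by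
    rw [h0, h1]; unfold sqDist; ring
  have hdet' : (o 0 - c 0) * (a 1 - c 1) - (o 1 - c 1) * (a 0 - c 0) = t * sqDist a c := by
    rw [h0, h1]; unfold sqDist; ring
  have htL : 0 ≤ t * sqDist a c := by positivity
  have hac' : (o 0 - a 0) ^ 2 + (o 1 - a 1) ^ 2 = 1 := by rw [← hac]; unfold sqDist; ring
  have hcc' : (o 0 - c 0) ^ 2 + (o 1 - c 1) ^ 2 = 1 := by rw [← hcc]; unfold sqDist; ring
  -- If `x` lies left of the ray from `a` to `o`, the supporting unit disk at `a` suffices.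
  by_cases hA : 0 ≤ (o 0 - a 0) * (x 1 - a 1) - (o 1 - a 1) * (x 0 - a 0)
  · have := frame_inequality (y1 := (o 0 - a 0) * (x 0 - a 0) + (o 1 - a 1) * (x 1 - a 1))
      (y2 := (o 0 - a 0) * (x 1 - a 1) - (o 1 - a 1) * (x 0 - a 0))
      (m1 := -((o 0 - a 0) * n 0 + (o 1 - a 1) * n 1))
      (m2 := -((o 0 - a 0) * n 1 - (o 1 - a 1) * n 0)) (k1 := sqDist a c / 2)
      (k2 := t * sqDist a c) (by linarith) htL
      (by linear_combination hac' + ((o 0 - a 0) ^ 2 + (o 1 - a 1) ^ 2) * hu) ?_ ?_ hA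
    · have e : -((o 0 - a 0) * n 0 + (o 1 - a 1) * n 1) *
          ((o 0 - a 0) * (x 0 - a 0) + (o 1 - a 1) * (x 1 - a 1)) +
          -((o 0 - a 0) * n 1 - (o 1 - a 1) * n 0) *
          ((o 0 - a 0) * (x 1 - a 1) - (o 1 - a 1) * (x 0 - a 0))
          = -(n 0 * (x 0 - a 0) + n 1 * (x 1 - a 1)) := by
        linear_combination -(n 0 * (x 0 - a 0) + n 1 * (x 1 - a 1)) * hac'
      rw [e] at this
      linarith
    · rw [← hdot, ← hdet]
      have e : ((o 0 - a 0) * (c 0 - a 0) + (o 1 - a 1) * (c 1 - a 1)) *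
          -((o 0 - a 0) * n 0 + (o 1 - a 1) * n 1) -
          ((c 0 - a 0) * (o 1 - a 1) - (c 1 - a 1) * (o 0 - a 0)) *
          -((o 0 - a 0) * n 1 - (o 1 - a 1) * n 0)
          = -(n 0 * (c 0 - a 0) + n 1 * (c 1 - a 1)) := by
        linear_combination -(n 0 * (c 0 - a 0) + n 1 * (c 1 - a 1)) * hac'
      rw [e, hdot]
      rw [sqDist_comm] at e2
      linarith
    · rw [← hdot, ← hdet]
      have e : ((o 0 - a 0) * (c 0 - a 0) + (o 1 - a 1) * (c 1 - a 1)) *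
          ((o 0 - a 0) * (x 1 - a 1) - (o 1 - a 1) * (x 0 - a 0)) +
          ((c 0 - a 0) * (o 1 - a 1) - (c 1 - a 1) * (o 0 - a 0)) *
          ((o 0 - a 0) * (x 0 - a 0) + (o 1 - a 1) * (x 1 - a 1)) = orient a c x := by
        unfold orient
        linear_combination ((c 0 - a 0) * (x 1 - a 1) - (c 1 - a 1) * (x 0 - a 0)) * hac'
      rw [e]; exact ho
  -- The mirror image at `c`.
  by_cases hC : 0 ≤ (o 1 - c 1) * (x 0 - c 0) - (o 0 - c 0) * (x 1 - c 1)
  · have := frame_inequality (y1 := (o 0 - c 0) * (x 0 - c 0) + (o 1 - c 1) * (x 1 - c 1))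
      (y2 := (o 1 - c 1) * (x 0 - c 0) - (o 0 - c 0) * (x 1 - c 1))
      (m1 := -((o 0 - c 0) * n' 0 + (o 1 - c 1) * n' 1))
      (m2 := ((o 0 - c 0) * n' 1 - (o 1 - c 1) * n' 0)) (k1 := sqDist a c / 2)
      (k2 := t * sqDist a c) (by linarith) htL
      (by linear_combination hcc' + ((o 0 - c 0) ^ 2 + (o 1 - c 1) ^ 2) * hu') ?_ ?_ hC
    · have e : -((o 0 - c 0) * n' 0 + (o 1 - c 1) * n' 1) *
          ((o 0 - c 0) * (x 0 - c 0) + (o 1 - c 1) * (x 1 - c 1)) +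
          ((o 0 - c 0) * n' 1 - (o 1 - c 1) * n' 0) *
          ((o 1 - c 1) * (x 0 - c 0) - (o 0 - c 0) * (x 1 - c 1))
          = -(n' 0 * (x 0 - c 0) + n' 1 * (x 1 - c 1)) := by
        linear_combination -(n' 0 * (x 0 - c 0) + n' 1 * (x 1 - c 1)) * hcc'
      rw [e] at this
      linarith
    · rw [← hdot', ← hdet']
      have e : ((o 0 - c 0) * (a 0 - c 0) + (o 1 - c 1) * (a 1 - c 1)) *
          -((o 0 - c 0) * n' 0 + (o 1 - c 1) * n' 1) -
          ((o 0 - c 0) * (a 1 - c 1) - (o 1 - c 1) * (a 0 - c 0)) *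
          ((o 0 - c 0) * n' 1 - (o 1 - c 1) * n' 0)
          = -(n' 0 * (a 0 - c 0) + n' 1 * (a 1 - c 1)) := by
        linear_combination -(n' 0 * (a 0 - c 0) + n' 1 * (a 1 - c 1)) * hcc'
      rw [e, hdot']
      linarith
    · rw [← hdot', ← hdet']
      have e : ((o 0 - c 0) * (a 0 - c 0) + (o 1 - c 1) * (a 1 - c 1)) *
          ((o 1 - c 1) * (x 0 - c 0) - (o 0 - c 0) * (x 1 - c 1)) +
          ((o 0 - c 0) * (a 1 - c 1) - (o 1 - c 1) * (a 0 - c 0)) *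
          ((o 0 - c 0) * (x 0 - c 0) + (o 1 - c 1) * (x 1 - c 1)) = orient a c x := by
        unfold orient
        linear_combination ((a 1 - c 1) * (x 0 - c 0) - (a 0 - c 0) * (x 1 - c 1)) * hcc'
      rw [e]; exact ho
  -- What remains is the triangle `a c o`, which lies in the disk by convexity.
  push Not at hA hC
  have hA' : 0 < (o 1 - a 1) * (x 0 - a 0) - (o 0 - a 0) * (x 1 - a 1) := by linarith
  have hC' : 0 < (o 0 - c 0) * (x 1 - c 1) - (o 1 - c 1) * (x 0 - c 0) := by linarith
  have hsum : ((o 0 - c 0) * (x 1 - c 1) - (o 1 - c 1) * (x 0 - c 0))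
      + ((o 1 - a 1) * (x 0 - a 0) - (o 0 - a 0) * (x 1 - a 1)) + orient a c x
      = t * sqDist a c := by
    rw [← hdet]; unfold orient; ring
  refine sqDist_le_one_of_cone (d := t * sqDist a c) (by linarith) hC'.le hA'.le (by linarith)
    hac hcc ?_ ?_ <;> rw [← hdet] <;> ring

/-- The coordinates of a point of a circular segment with respect to the radii to the endpoints
of its chord are nonnegative. -/
theorem segment_coords {c r lam mu : ℝ} (hc1 : c < 1) (hsum : 1 ≤ lam + mu)
    (hr : lam ^ 2 + mu ^ 2 + 2 * lam * mu * c = r) (hr1 : r ≤ 1) : 0 ≤ lam := by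
  by_contra h
  push Not at h
  have hmu : 0 < mu := by linarith
  nlinarith [mul_pos (mul_pos (neg_pos.2 h) hmu) (sub_pos.2 hc1)]

/-- In terms of the two radii, `x - o` has nonnegative coordinates with sum at least 1. If a unit
disk about `q` contains `a` and `c`, then twice the scalar product of either radius with `o - q` is
at most `-sqDist o q`, and the combination for `x` is at most that too. -/
theorem mem_spindle_of_segment {a c x : Plane} (hne : a ≠ c) (hL : sqDist a c < 4)
    (hx : sqDist x (arcCenter a c) ≤ 1) (ho : orient a c x ≤ 0) : x ∈ spindle a c := by
  obtain ⟨t, ht0, ht, h0, h1⟩ := exists_arcCenter_eq hne hL.le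
  have hLp := sqDist_pos hne
  have hac := sqDist_arcCenter_left hne hL.le
  have hcc := sqDist_arcCenter_right hne hL.le
  set o := arcCenter a c
  have ht0 : 0 < t := by
    rcases ht0.eq_or_lt with rfl | h
    · linarith
    · exact h
  set d := t * sqDist a c with hd
  have hd0 : 0 < d := by positivity
  have hdet : (a 0 - o 0) * (c 1 - o 1) - (a 1 - o 1) * (c 0 - o 0) = d := by
    rw [h0, h1, hd]; unfold sqDist; ring
  set lam := ((x 0 - o 0) * (c 1 - o 1) - (x 1 - o 1) * (c 0 - o 0)) / d with hlam
  set mu := ((a 0 - o 0) * (x 1 - o 1) - (a 1 - o 1) * (x 0 - o 0)) / d with hmu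
  have hx0 : x 0 - o 0 = lam * (a 0 - o 0) + mu * (c 0 - o 0) := cramer_fst hd0.ne' hdet
  have hx1 : x 1 - o 1 = lam * (a 1 - o 1) + mu * (c 1 - o 1) := cramer_snd hd0.ne' hdet
  have hsum : 1 ≤ lam + mu := by
    rw [hlam, hmu, ← add_div, le_div_iff₀ hd0, ← hdet]
    unfold orient at ho
    linarith
  have hr : lam ^ 2 + mu ^ 2 + 2 * lam * mu * (1 - sqDist a c / 2) = sqDist x o := by
    have e : sqDist x o = lam ^ 2 * sqDist a o + mu ^ 2 * sqDist c o
        + lam * mu * (sqDist a o + sqDist c o - sqDist a c) := by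
      have : sqDist x o = (x 0 - o 0) ^ 2 + (x 1 - o 1) ^ 2 := rfl
      rw [this, hx0, hx1]; unfold sqDist; ring
    rw [e, hac, hcc]; ring
  have hlam0 : 0 ≤ lam := segment_coords (by linarith) hsum hr hx
  have hmu0 : 0 ≤ mu := segment_coords (c := 1 - sqDist a c / 2) (lam := mu) (mu := lam)
    (by linarith) (by linarith) (by rw [← hr]; ring) hx
  rw [mem_spindle_iff]
  intro q ha hc
  have ea : sqDist a q = sqDist a o + sqDist o q
      + 2 * ((a 0 - o 0) * (o 0 - q 0) + (a 1 - o 1) * (o 1 - q 1)) := by unfold sqDist; ring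
  have ec : sqDist c q = sqDist c o + sqDist o q
      + 2 * ((c 0 - o 0) * (o 0 - q 0) + (c 1 - o 1) * (o 1 - q 1)) := by unfold sqDist; ring
  have ex : sqDist x q = sqDist x o + sqDist o q
      + (lam * (2 * ((a 0 - o 0) * (o 0 - q 0) + (a 1 - o 1) * (o 1 - q 1)))
      + mu * (2 * ((c 0 - o 0) * (o 0 - q 0) + (c 1 - o 1) * (o 1 - q 1)))) := by
    have : sqDist x q = sqDist x o + sqDist o q
      + 2 * ((x 0 - o 0) * (o 0 - q 0) + (x 1 - o 1) * (o 1 - q 1)) := by unfold sqDist; ring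
    rw [this, hx0, hx1]; ring
  have hq := sqDist_nonneg o q
  nlinarith [mul_nonneg hlam0 (sub_nonneg.2 ha), mul_nonneg hmu0 (sub_nonneg.2 hc)]

/-! ### Chords of a strictly convex set -/

theorem orient_rotate (a b c : Plane) : orient b c a = orient a b c := by
  unfold orient; ring

theorem orient_swap (a b c : Plane) : orient b a c = -orient a b c := by
  unfold orient; ring

/-- A point of `K` beyond one side of an inscribed triangle is strictly inside the next side. -/
theorem orient_pos_of_next {K : Set Plane} (hK : IsSpindleConvexDisk K) {a b c x : Plane}
    (ha : a ∈ K) (hb : b ∈ frontier K) (hc : c ∈ K) (hx : x ∈ K) (hxb : x ≠ b)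
    (habc : 0 < orient a b c) (habx : orient a b x ≤ 0) : 0 < orient b c x := by
  by_contra h
  push Not at h
  -- By the linear relation between `x - b`, `a - b` and `c - b`, these signs would make `b` a
  -- proper convex combination of the other three points.
  refine no_barycenter hK hb hx ha hc habc (s := -orient b c x) (t := -orient a b x)
    (by linarith) (by linarith) hxb ?_ ?_ <;> unfold orient <;> ring

theorem ne_of_orient_ne_zero {a b x : Plane} (h : orient a b x ≠ 0) : a ≠ b ∧ x ≠ a ∧ x ≠ b := by
  refine ⟨?_, ?_, ?_⟩ <;> rintro rfl <;> apply h <;> unfold orient <;> ring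

/-- Caps are nested: at the vertex `a`, a point beyond both `c a` and `a b` would contradict
`orient_pos_of_next`. -/
theorem orient_neg_of_first {K : Set Plane} (hK : IsSpindleConvexDisk K) {a b c x : Plane}
    (ha : a ∈ frontier K) (hb : b ∈ K) (hc : c ∈ K) (hx : x ∈ K)
    (habc : 0 < orient a b c) (habx : orient a b x < 0) : orient a c x < 0 := by
  by_contra h
  push Not at h
  have := orient_pos_of_next hK hc ha hb hx (ne_of_orient_ne_zero habx.ne).2.1
    (by rwa [← orient_rotate]) (by rw [orient_swap]; linarith)
  linarith

theorem orient_neg_of_second {K : Set Plane} (hK : IsSpindleConvexDisk K) {a b c x : Plane}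
    (ha : a ∈ K) (hb : b ∈ K) (hc : c ∈ frontier K) (hx : x ∈ K)
    (habc : 0 < orient a b c) (hbcx : orient b c x < 0) : orient a c x < 0 := by
  have := orient_pos_of_next hK hb hc ha hx (ne_of_orient_ne_zero hbcx.ne).2.2
    (by rwa [orient_rotate]) hbcx.le
  rw [orient_swap] at this
  linarith

/-- The parts of `K` beyond two opposite sides of an inscribed quadrangle are disjoint. -/
theorem orient_nonneg_of_opposite {K : Set Plane} (hK : IsSpindleConvexDisk K) {a b c d x : Plane}
    (ha : a ∈ frontier K) (hb : b ∈ K) (hc : c ∈ frontier K) (hd : d ∈ K)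
    (hx : x ∈ K) (habc : 0 < orient a b c) (hacd : 0 < orient a c d)
    (habx : orient a b x < 0) : 0 < orient c d x := by
  have h := orient_neg_of_first hK ha hb (hK.frontier_subset hc) hx habc habx
  exact orient_pos_of_next hK (hK.frontier_subset ha) hc hd hx (ne_of_orient_ne_zero h.ne).2.2
    hacd h.le

/-! ### Areas of triangles and circular segments -/

open MeasureTheory in
/-- The area of the preimage of a set under an affine map of the plane onto itself. -/
theorem volume_affine_preimage (p q : Plane) (r s : ℝ) (h : cross p q ≠ 0) (S : Set (ℝ × ℝ)) :
    volume {x : Plane | (dotp p x + r, dotp q x + s) ∈ S}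
      = ENNReal.ofReal |(cross p q)⁻¹| * volume S := by
  set M : Matrix (Fin 2) (Fin 2) ℝ := !![p 0, p 1; q 0, q 1] with hM
  have hdet : LinearMap.det (Matrix.toLin' M) = cross p q := by
    rw [LinearMap.det_toLin', Matrix.det_fin_two]
    simp [hM, cross]
  have e1 : {x : Plane | (dotp p x + r, dotp q x + s) ∈ S}
      = (MeasurableEquiv.toLp 2 (Fin 2 → ℝ)).symm ⁻¹' (Matrix.toLin' M ⁻¹'
        (MeasurableEquiv.finTwoArrow ⁻¹' ((fun z : ℝ × ℝ => z + (r, s)) ⁻¹' S))) := by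
    ext x
    simp [hM, dotp, dotProduct, Fin.sum_univ_two]
  rw [e1, (EuclideanSpace.volume_preserving_symm_measurableEquiv_toLp (Fin 2)).measure_preimage_equiv,
    Measure.addHaar_preimage_linearMap _ (by rw [hdet]; exact h), hdet,
    (volume_preserving_finTwoArrow ℝ).measure_preimage_equiv, measure_preimage_add_right]

open MeasureTheory in
/-- The area of a plane set whose vertical sections have the lengths given by `g`. -/
theorem volume_of_sections {S : Set (ℝ × ℝ)} (hS : MeasurableSet S) {α β : ℝ} (hαβ : α ≤ β)
    {g : ℝ → ℝ} (hg : Continuous g) (hg0 : ∀ u ∈ Set.Icc α β, 0 ≤ g u)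
    (hin : ∀ u ∈ Set.Icc α β, volume (Prod.mk u ⁻¹' S) = ENNReal.ofReal (g u))
    (hout : ∀ u ∉ Set.Icc α β, volume (Prod.mk u ⁻¹' S) = 0) :
    volume S = ENNReal.ofReal (∫ u in α..β, g u) := by
  rw [Measure.volume_eq_prod, Measure.prod_apply hS, intervalIntegral.integral_of_le hαβ,
    ← integral_Icc_eq_integral_Ioc, ofReal_integral_eq_lintegral_ofReal]
  · rw [← lintegral_indicator measurableSet_Icc]
    refine lintegral_congr fun u => ?_
    by_cases hu : u ∈ Set.Icc α β
    · rw [Set.indicator_of_mem hu, hin u hu]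
    · rw [Set.indicator_of_notMem hu, hout u hu]
  · exact hg.integrableOn_Icc
  · exact (ae_restrict_iff' measurableSet_Icc).2 (Filter.Eventually.of_forall hg0)

-- The two nonnegative determinants serve as coordinates; they map the triangle to a right isosceles
-- one with legs `D`, with Jacobian `D`. The third side is left out so that the triangle and the two
-- caps in `volume_cap_add` tile the big cap exactly.
open MeasureTheory in
theorem volume_triangle {a b c : Plane} (h : 0 < orient a b c) :
    volume {x : Plane | 0 ≤ orient a b x ∧ 0 ≤ orient b c x ∧ orient a c x < 0}
      = ENNReal.ofReal (orient a b c / 2) := by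
  set D := orient a b c with hD
  set S : Set (ℝ × ℝ) := {z | 0 ≤ z.1 ∧ 0 ≤ z.2 ∧ z.1 + z.2 < D} with hS
  have hSm : MeasurableSet S :=
    (measurableSet_le measurable_const measurable_fst).inter
      ((measurableSet_le measurable_const measurable_snd).inter
        (measurableSet_lt (measurable_fst.add measurable_snd) measurable_const))
  have hvol : volume S = ENNReal.ofReal (∫ u in (0 : ℝ)..D, (D - u)) := by
    refine volume_of_sections hSm h.le (by fun_prop) (fun u hu => by linarith [hu.2])
      (fun u hu => ?_) (fun u hu => ?_)
    · have : Prod.mk u ⁻¹' S = Set.Ico 0 (D - u) := by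
        ext v
        simp only [hS, Set.mem_preimage, Set.mem_ofPred_eq, Set.mem_Ico]
        exact ⟨fun h => ⟨h.2.1, by linarith⟩, fun h => ⟨hu.1, h.1, by linarith⟩⟩
      rw [this, Real.volume_Ico, sub_zero]
    · have : Prod.mk u ⁻¹' S = ∅ := by
        ext v
        simp only [hS, Set.mem_preimage, Set.mem_ofPred_eq, Set.mem_empty_iff_false, iff_false]
        exact fun h => hu ⟨h.1, by linarith⟩
      rw [this, measure_empty]
  have hint : ∫ u in (0 : ℝ)..D, (D - u) = D ^ 2 / 2 := by
    rw [intervalIntegral.integral_sub (by simp) (by simp), integral_id]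
    simp
    ring
  have hset : {x : Plane | 0 ≤ orient a b x ∧ 0 ≤ orient b c x ∧ orient a c x < 0}
      = {x : Plane | (dotp !₂[-(b 1 - a 1), b 0 - a 0] x + ((b 1 - a 1) * a 0 - (b 0 - a 0) * a 1),
          dotp !₂[-(c 1 - b 1), c 0 - b 0] x + ((c 1 - b 1) * b 0 - (c 0 - b 0) * b 1)) ∈ S} := by
    ext x
    have e1 : dotp !₂[-(b 1 - a 1), b 0 - a 0] x + ((b 1 - a 1) * a 0 - (b 0 - a 0) * a 1)
        = orient a b x := by
      simp [dotp, orient]; ring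
    have e2 : dotp !₂[-(c 1 - b 1), c 0 - b 0] x + ((c 1 - b 1) * b 0 - (c 0 - b 0) * b 1)
        = orient b c x := by
      simp [dotp, orient]; ring
    simp only [hS, Set.mem_ofPred_eq, e1, e2]
    have e3 : orient a c x = orient a b x + orient b c x - D := by
      rw [hD]; unfold orient; ring
    rw [e3, sub_neg]
  have hcr : cross !₂[-(b 1 - a 1), b 0 - a 0] !₂[-(c 1 - b 1), c 0 - b 0] = D := by
    simp [cross, hD, orient]; ring
  rw [hset, volume_affine_preimage _ _ _ _ (by rw [hcr]; exact h.ne'), hvol, hint, hcr,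
    ← ENNReal.ofReal_mul (abs_nonneg _), abs_of_pos (inv_pos.2 h)]
  congr 1
  field_simp

/-- The area of the segment that a chord of squared length `L` cuts off from a unit disk. -/
noncomputable def segArea (L : ℝ) : ℝ := Real.arcsin (√L / 2) - √L / 2 * √(1 - L / 4)

theorem hasDerivAt_mul_sqrt_one_sub_sq {u : ℝ} (h0 : -1 < u) (h1 : u < 1) :
    HasDerivAt (fun u => (Real.arcsin u + u * √(1 - u ^ 2)) / 2) (√(1 - u ^ 2)) u := by
  have hpos : 0 < 1 - u ^ 2 := by nlinarith
  have hs := Real.sqrt_pos.2 hpos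
  have hs2 := Real.sq_sqrt hpos.le
  have d1 := Real.hasDerivAt_arcsin h0.ne' h1.ne
  have d2 : HasDerivAt (fun u : ℝ => 1 - u ^ 2) (-(2 * u)) u := by
    simpa using ((hasDerivAt_id u).pow 2).const_sub 1
  have d3 := (d1.add ((hasDerivAt_id u).mul (d2.sqrt hpos.ne'))).div_const 2
  refine d3.congr_deriv ?_
  simp only [id]
  field_simp
  rw [hs2]; ring

theorem integral_segment {σ : ℝ} (h0 : 0 ≤ σ) (h1 : σ < 1) (κ : ℝ) :
    ∫ u in (-σ)..σ, (√(1 - u ^ 2) - κ) = Real.arcsin σ + σ * √(1 - σ ^ 2) - 2 * κ * σ := by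
  rw [intervalIntegral.integral_sub (Continuous.intervalIntegrable (by fun_prop) _ _) (by simp),
    intervalIntegral.integral_eq_sub_of_hasDerivAt
      (f := fun u => (Real.arcsin u + u * √(1 - u ^ 2)) / 2)
      (fun u hu => ?_) (Continuous.intervalIntegrable (by fun_prop) _ _)]
  · simp [Real.arcsin_neg]; ring
  · rw [Set.uIcc_of_le (by linarith)] at hu
    exact hasDerivAt_mul_sqrt_one_sub_sq (by linarith [hu.1]) (by linarith [hu.2])

open MeasureTheory in
theorem volume_standard_segment {σ κ : ℝ} (h0 : 0 ≤ σ) (h1 : σ < 1) (hκ : 0 ≤ κ)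
    (hκσ : κ ^ 2 = 1 - σ ^ 2) :
    volume {z : ℝ × ℝ | z.1 ^ 2 + z.2 ^ 2 ≤ 1 ∧ κ < z.2}
      = ENNReal.ofReal (Real.arcsin σ - σ * κ) := by
  have hκs : √(1 - σ ^ 2) = κ := by rw [← hκσ, Real.sqrt_sq hκ]
  have hm : MeasurableSet {z : ℝ × ℝ | z.1 ^ 2 + z.2 ^ 2 ≤ 1 ∧ κ < z.2} :=
    (measurableSet_le (f := fun z : ℝ × ℝ => z.1 ^ 2 + z.2 ^ 2) (by fun_prop)
      measurable_const).inter (measurableSet_lt measurable_const measurable_snd)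
  rw [volume_of_sections hm (α := -σ) (β := σ) (by linarith) (g := fun u => √(1 - u ^ 2) - κ)
    (by fun_prop), integral_segment h0 h1, hκs]
  · congr 1; ring
  · intro u hu
    have : u ^ 2 ≤ σ ^ 2 := sq_le_sq' hu.1 hu.2
    rw [← hκs]
    linarith [Real.sqrt_le_sqrt (show 1 - σ ^ 2 ≤ 1 - u ^ 2 by linarith)]
  · intro u hu
    have hu2 : u ^ 2 ≤ σ ^ 2 := sq_le_sq' hu.1 hu.2
    have hnn : 0 ≤ 1 - u ^ 2 := by nlinarith
    have : Prod.mk u ⁻¹' {z : ℝ × ℝ | z.1 ^ 2 + z.2 ^ 2 ≤ 1 ∧ κ < z.2}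
        = Set.Ioc κ √(1 - u ^ 2) := by
      ext v
      simp only [Set.mem_preimage, Set.mem_ofPred_eq, Set.mem_Ioc]
      constructor
      · rintro ⟨h, h'⟩
        exact ⟨h', Real.le_sqrt_of_sq_le (by linarith)⟩
      · rintro ⟨h, h'⟩
        refine ⟨?_, h⟩
        have := (Real.le_sqrt (by linarith) hnn).1 h'
        linarith
    rw [this, Real.volume_Ioc]
  · intro u hu
    have : Prod.mk u ⁻¹' {z : ℝ × ℝ | z.1 ^ 2 + z.2 ^ 2 ≤ 1 ∧ κ < z.2} = ∅ := by
      ext v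
      simp only [Set.mem_preimage, Set.mem_ofPred_eq, Set.mem_empty_iff_false, iff_false]
      rintro ⟨h, h'⟩
      apply hu
      apply abs_le.1
      apply abs_le_of_sq_le_sq _ h0
      nlinarith
    rw [this, measure_empty]

-- Coordinates along the chord (`p`) and along its right normal (`q`), with origin at the arc
-- center, give the standard segment; `t * ℓ` is the distance of the center from the chord.
open MeasureTheory in
theorem volume_segment {a c : Plane} (hne : a ≠ c) (hL : sqDist a c < 4) :
    volume {x : Plane | sqDist x (arcCenter a c) ≤ 1 ∧ orient a c x < 0}
      = ENNReal.ofReal (segArea (sqDist a c)) := by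
  obtain ⟨t, ht0, ht, h0, h1⟩ := exists_arcCenter_eq hne hL.le
  have hLp := sqDist_pos hne
  set o := arcCenter a c
  set L := sqDist a c with hLdef
  set ℓ := √L with hℓ
  have hℓ0 : 0 < ℓ := Real.sqrt_pos.2 hLp
  have hℓ2 : ℓ ^ 2 = L := Real.sq_sqrt hLp.le
  have hℓ3 : ℓ < 2 := by nlinarith
  have hκ : t * ℓ = √(1 - L / 4) := by
    rw [← ht, ← hℓ2, ← mul_pow, Real.sqrt_sq (by positivity)]
  set p : Plane := !₂[(c 0 - a 0) / ℓ, (c 1 - a 1) / ℓ] with hp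
  set q : Plane := !₂[(c 1 - a 1) / ℓ, -(c 0 - a 0) / ℓ] with hq
  have hp0 : p 0 = (c 0 - a 0) / ℓ := by simp [hp]
  have hp1 : p 1 = (c 1 - a 1) / ℓ := by simp [hp]
  have hq0 : q 0 = (c 1 - a 1) / ℓ := by simp [hq]
  have hq1 : q 1 = -(c 0 - a 0) / ℓ := by simp [hq]
  have hLexp : L = (a 0 - c 0) ^ 2 + (a 1 - c 1) ^ 2 := rfl
  have hcr : cross p q = -1 := by
    unfold cross
    rw [hp0, hp1, hq0, hq1]
    field_simp
    rw [hℓ2, hLexp]; ring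
  have hset : {x : Plane | sqDist x o ≤ 1 ∧ orient a c x < 0}
      = {x : Plane | (dotp p x + -dotp p o, dotp q x + -dotp q o)
          ∈ {z : ℝ × ℝ | z.1 ^ 2 + z.2 ^ 2 ≤ 1 ∧ t * ℓ < z.2}} := by
    ext x
    simp only [Set.mem_ofPred_eq]
    have e1 : (dotp p x + -dotp p o) ^ 2 + (dotp q x + -dotp q o) ^ 2 = sqDist x o := by
      unfold dotp
      rw [hp0, hp1, hq0, hq1]
      have : ((c 0 - a 0) / ℓ * x 0 + (c 1 - a 1) / ℓ * x 1 +
        -((c 0 - a 0) / ℓ * o 0 + (c 1 - a 1) / ℓ * o 1)) ^ 2 +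
        ((c 1 - a 1) / ℓ * x 0 + -(c 0 - a 0) / ℓ * x 1 +
        -((c 1 - a 1) / ℓ * o 0 + -(c 0 - a 0) / ℓ * o 1)) ^ 2
        = L / ℓ ^ 2 * sqDist x o := by
        rw [hLexp]; unfold sqDist; ring
      rw [this, hℓ2, div_self hLp.ne', one_mul]
    have e2 : orient a c x = ℓ * (t * ℓ - (dotp q x + -dotp q o)) := by
      unfold dotp orient
      rw [hq0, hq1, h0, h1]
      field_simp
      rw [hℓ2, hLexp]; ring
    rw [e1, e2, mul_neg_iff]
    constructor
    · rintro ⟨h, h'⟩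
      refine ⟨h, ?_⟩
      rcases h' with h' | h' <;> linarith
    · rintro ⟨h, h'⟩
      exact ⟨h, Or.inl ⟨hℓ0, by linarith⟩⟩
  rw [hset, volume_affine_preimage _ _ _ _ (by rw [hcr]; norm_num), hcr,
    volume_standard_segment (σ := ℓ / 2) (by positivity) (by linarith) (by positivity)
      (by rw [mul_pow, hℓ2, ht, div_pow, hℓ2]; ring), hκ]
  simp [segArea, hℓ]

theorem continuous_segArea : Continuous segArea := by
  unfold segArea
  have := Real.continuous_arcsin
  fun_prop

/-! ### The mixed second derivative along two unit arcs -/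

/-- The derivative of `segArea`, up to the factor four: the tangent of half the opening angle. -/
noncomputable def tanHalf (L : ℝ) : ℝ := √(L / (4 - L))

theorem tanHalf_pos {L : ℝ} (h0 : 0 < L) (h4 : L < 4) : 0 < tanHalf L :=
  Real.sqrt_pos.2 (div_pos h0 (by linarith))

theorem tanHalf_sq {L : ℝ} (h0 : 0 < L) (h4 : L < 4) : L * (1 + tanHalf L ^ 2) = 4 * tanHalf L ^ 2 := by
  have : 4 - L ≠ 0 := by linarith
  rw [tanHalf, Real.sq_sqrt (div_pos h0 (by linarith)).le]
  field_simp
  ring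

theorem hasDerivAt_segArea {L : ℝ} (h0 : 0 < L) (h4 : L < 4) :
    HasDerivAt segArea (tanHalf L / 4) L := by
  have hκp : 0 < 1 - L / 4 := by linarith
  have hℓ := Real.sqrt_pos.2 h0
  have hκ := Real.sqrt_pos.2 hκp
  have hℓ2 := Real.sq_sqrt h0.le
  have hκ2 := Real.sq_sqrt hκp.le
  have hT : tanHalf L = √L / (2 * √(1 - L / 4)) := by
    rw [tanHalf, Real.sqrt_div h0.le, show 4 - L = 2 ^ 2 * (1 - L / 4) by ring,
      Real.sqrt_mul (by positivity), Real.sqrt_sq (by norm_num)]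
  have hlt : √L / 2 < 1 := by nlinarith
  have d1 : HasDerivAt (fun L => √L / 2) (1 / (2 * √L) / 2) L :=
    ((hasDerivAt_id L).sqrt h0.ne').div_const 2
  have d2 : HasDerivAt (fun L : ℝ => √(1 - L / 4)) (-(1 / 4) / (2 * √(1 - L / 4))) L := by
    have : HasDerivAt (fun L : ℝ => 1 - L / 4) (-(1 / 4)) L := by
      simpa using ((hasDerivAt_id L).div_const 4).const_sub 1
    exact this.sqrt hκp.ne'
  have d3 := (Real.hasDerivAt_arcsin (x := √L / 2) (by linarith) hlt.ne).comp L d1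
  refine (d3.sub (d1.mul d2)).congr_deriv ?_
  have e : 1 - (√L / 2) ^ 2 = 1 - L / 4 := by rw [div_pow, hℓ2]; norm_num
  rw [e, hT]
  generalize √(1 - L / 4) = κ at *
  generalize √L = ℓ at *
  field_simp
  linear_combination -4 * hκ2 - hℓ2

theorem hasDerivAt_tanHalf {L : ℝ} (h0 : 0 < L) (h4 : L < 4) :
    HasDerivAt tanHalf ((1 + tanHalf L ^ 2) ^ 2 / (8 * tanHalf L)) L := by
  have h4' : 4 - L ≠ 0 := by linarith
  have hp : 0 < L / (4 - L) := div_pos h0 (by linarith)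
  have hT := Real.sqrt_pos.2 hp
  have hT2 := Real.sq_sqrt hp.le
  have d1 : HasDerivAt (fun L : ℝ => 4 - L) (-1) L := by
    simpa using (hasDerivAt_id L).const_sub 4
  have d2 := ((hasDerivAt_id L).div d1 h4').sqrt hp.ne'
  refine d2.congr_deriv ?_
  unfold tanHalf
  rw [hT2]
  simp only [id, Pi.div_apply]
  field_simp
  ring

/-- The algebraic core of the quadrangle inequality. -/
theorem mixed_derivative_nonneg {T X Y X' Y' L : ℝ} (hT : 0 < T) (hL : 0 < L)
    (hTL : L * (1 + T ^ 2) = 4 * T ^ 2) (hX : X ^ 2 + Y ^ 2 = L) (hX' : X' ^ 2 + Y' ^ 2 = L)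
    (hY : L / 2 ≤ Y) (hY' : L / 2 ≤ Y') (hdet : 0 ≤ X * Y' + Y * X') :
    0 ≤ X * Y' + Y * X' + T * (Y * Y') - T * (2 + T ^ 2) * (X * X') := by
  -- With `φ` half the opening angle, `L` is `4 sin² φ` and `T` is `tan φ`. A vector of length `2
  -- sin φ` with `Y` at least `2 sin² φ` has slope `X / Y` at most `cot φ`.
  have aux : ∀ {X Y : ℝ}, X ^ 2 + Y ^ 2 = L → L / 2 ≤ Y → T * X ≤ Y := by
    intro X Y hX hY
    have hY0 : 0 < Y := by linarith
    apply abs_le_of_sq_le_sq' _ hY0.le |>.2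
    have h1 : L ^ 2 / 4 ≤ Y ^ 2 := by nlinarith
    have h2 : (1 + T ^ 2) * (L ^ 2 / 4) ≤ (1 + T ^ 2) * Y ^ 2 :=
      mul_le_mul_of_nonneg_left h1 (by positivity)
    have h3 : (1 + T ^ 2) * (L ^ 2 / 4) = T ^ 2 * L := by linear_combination L / 4 * hTL
    have h4 : (T * X) ^ 2 = T ^ 2 * L - T ^ 2 * Y ^ 2 := by rw [← hX]; ring
    linarith
  have hx := aux hX hY
  have hx' := aux hX' hY'
  have hY0 : 0 < Y := by linarith
  have hY0' : 0 < Y' := by linarith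
  set ξ := T * X
  set η := T * X'
  have hd : 0 ≤ ξ * Y' + Y * η := by
    have : ξ * Y' + Y * η = T * (X * Y' + Y * X') := by ring
    rw [this]; positivity
  suffices h : 0 ≤ ξ * Y' + Y * η + T ^ 2 * (Y * Y') - (2 + T ^ 2) * (ξ * η) by
    have e : ξ * Y' + Y * η + T ^ 2 * (Y * Y') - (2 + T ^ 2) * (ξ * η)
      = T * (X * Y' + Y * X' + T * (Y * Y') - T * (2 + T ^ 2) * (X * X')) := by ring
    rw [e] at h
    exact nonneg_of_mul_nonneg_right h hT
  have hT2 : 0 < T ^ 2 := by positivity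
  -- If the product is not positive, no term is negative. Otherwise both factors are positive, and
  -- the three positive terms dominate 1, 1 and `T ^ 2` times `ξ * η`.
  rcases le_or_gt (ξ * η) 0 with h | h
  · nlinarith [mul_pos hT2 (mul_pos hY0 hY0')]
  · have hξ : 0 < ξ := by
      by_contra hc
      push Not at hc
      have hη : η < 0 := by
        by_contra hc'
        push Not at hc'
        nlinarith
      nlinarith
    have hη : 0 < η := by
      by_contra hc
      push Not at hc
      nlinarith
    have h1 : ξ * η ≤ ξ * Y' := mul_le_mul_of_nonneg_left hx' hξ.le
    have h2 : ξ * η ≤ Y * η := mul_le_mul_of_nonneg_right hx hη.le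
    have h3 : ξ * η ≤ Y * Y' := mul_le_mul hx hx' hη.le hY0.le
    nlinarith [mul_le_mul_of_nonneg_left h3 hT2.le]

/-- The squared distance of the points with angles `α`, `β` on the unit circles about `o`, `r`. -/
noncomputable def arcSqDist (o r : Plane) (α β : ℝ) : ℝ :=
  (o 0 + Real.cos α - (r 0 + Real.cos β)) ^ 2 + (o 1 + Real.sin α - (r 1 + Real.sin β)) ^ 2

/-- Half the determinant plus the area of the segment for two points on unit circles. -/
noncomputable def arcArea (o r : Plane) (α β : ℝ) : ℝ :=
  ((o 0 + Real.cos α) * (r 1 + Real.sin β) - (o 1 + Real.sin α) * (r 0 + Real.cos β)) / 2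
    + segArea (arcSqDist o r α β)

/-- The derivative of `arcArea` in its first angle. -/
noncomputable def arcAreaDeriv (o r : Plane) (α β : ℝ) : ℝ :=
  (-Real.sin α * (r 1 + Real.sin β) - Real.cos α * (r 0 + Real.cos β)) / 2
    + tanHalf (arcSqDist o r α β) / 4 *
      (2 * (o 0 + Real.cos α - (r 0 + Real.cos β)) * -Real.sin α
        + 2 * (o 1 + Real.sin α - (r 1 + Real.sin β)) * Real.cos α)

theorem hasDerivAt_arcArea {o r : Plane} {α β : ℝ} (h0 : 0 < arcSqDist o r α β)
    (h4 : arcSqDist o r α β < 4) :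
    HasDerivAt (fun α => arcArea o r α β) (arcAreaDeriv o r α β) α := by
  have dc : HasDerivAt (fun α => o 0 + Real.cos α) (-Real.sin α) α :=
    (Real.hasDerivAt_cos α).const_add _
  have ds : HasDerivAt (fun α => o 1 + Real.sin α) (Real.cos α) α :=
    (Real.hasDerivAt_sin α).const_add _
  have dL : HasDerivAt (fun α => arcSqDist o r α β)
      (2 * (o 0 + Real.cos α - (r 0 + Real.cos β)) * -Real.sin α
        + 2 * (o 1 + Real.sin α - (r 1 + Real.sin β)) * Real.cos α) α := by
    refine (((dc.sub_const (r 0 + Real.cos β)).pow 2).add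
      ((ds.sub_const (r 1 + Real.sin β)).pow 2)).congr_deriv ?_
    push_cast
    ring
  exact (((dc.mul_const _).sub (ds.mul_const _)).div_const 2).add
    (HasDerivAt.comp (h₂ := segArea) (h := fun α => arcSqDist o r α β) α
      (hasDerivAt_segArea h0 h4) dL)

theorem hasDerivAt_arcAreaDeriv {o r : Plane} {α β : ℝ} (h0 : 0 < arcSqDist o r α β)
    (h4 : arcSqDist o r α β < 4) :
    HasDerivAt (fun β => arcAreaDeriv o r α β)
      ((-Real.sin α * Real.cos β + Real.cos α * Real.sin β) / 2
        + (1 + tanHalf (arcSqDist o r α β) ^ 2) ^ 2 / (8 * tanHalf (arcSqDist o r α β)) *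
          (2 * (o 0 + Real.cos α - (r 0 + Real.cos β)) * Real.sin β
            - 2 * (o 1 + Real.sin α - (r 1 + Real.sin β)) * Real.cos β) / 4 *
          (2 * (o 0 + Real.cos α - (r 0 + Real.cos β)) * -Real.sin α
            + 2 * (o 1 + Real.sin α - (r 1 + Real.sin β)) * Real.cos α)
        + tanHalf (arcSqDist o r α β) / 4 *
          (-2 * (Real.sin α * Real.sin β + Real.cos α * Real.cos β))) β := by
  have dc : HasDerivAt (fun β => r 0 + Real.cos β) (-Real.sin β) β :=
    (Real.hasDerivAt_cos β).const_add _
  have ds : HasDerivAt (fun β => r 1 + Real.sin β) (Real.cos β) β :=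
    (Real.hasDerivAt_sin β).const_add _
  have dc' := dc.const_sub (o 0 + Real.cos α)
  have ds' := ds.const_sub (o 1 + Real.sin α)
  have dL : HasDerivAt (fun β => arcSqDist o r α β)
      (2 * (o 0 + Real.cos α - (r 0 + Real.cos β)) * Real.sin β
        - 2 * (o 1 + Real.sin α - (r 1 + Real.sin β)) * Real.cos β) β := by
    refine ((dc'.pow 2).add (ds'.pow 2)).congr_deriv ?_
    push_cast
    ring
  have dT := ((hasDerivAt_tanHalf h0 h4).comp β dL).div_const 4
  have dM := ((dc'.const_mul 2).mul_const (-Real.sin α)).add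
    ((ds'.const_mul 2).mul_const (Real.cos α))
  have d := (((ds.const_mul (-Real.sin α)).sub (dc.const_mul (Real.cos α))).div_const 2).add
    (dT.mul dM)
  refine d.congr_deriv ?_
  simp only [Function.comp, Pi.add_apply]
  ring

/-- Up to the factor `1 / (2 * L)` this is the expression of `mixed_derivative_nonneg`. `X`, `Y` are
the components of the chord along the tangent and the inner normal at its first endpoint, `X'`, `Y'`
those along the tangent and the outer normal at the second. That each unit disk contains the other
endpoint gives `Y, Y' ≥ L / 2`, and `X * Y' + Y * X'` is `L` times the sine of the angle between the
radii. -/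
theorem arcAreaDeriv_deriv_nonneg {o r : Plane} {α β : ℝ} (h0 : 0 < arcSqDist o r α β)
    (h4 : arcSqDist o r α β < 4)
    (ho : (r 0 + Real.cos β - o 0) ^ 2 + (r 1 + Real.sin β - o 1) ^ 2 ≤ 1)
    (hr : (o 0 + Real.cos α - r 0) ^ 2 + (o 1 + Real.sin α - r 1) ^ 2 ≤ 1)
    (hdet : 0 ≤ Real.cos α * Real.sin β - Real.sin α * Real.cos β) :
    0 ≤ (-Real.sin α * Real.cos β + Real.cos α * Real.sin β) / 2
        + (1 + tanHalf (arcSqDist o r α β) ^ 2) ^ 2 / (8 * tanHalf (arcSqDist o r α β)) *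
          (2 * (o 0 + Real.cos α - (r 0 + Real.cos β)) * Real.sin β
            - 2 * (o 1 + Real.sin α - (r 1 + Real.sin β)) * Real.cos β) / 4 *
          (2 * (o 0 + Real.cos α - (r 0 + Real.cos β)) * -Real.sin α
            + 2 * (o 1 + Real.sin α - (r 1 + Real.sin β)) * Real.cos α)
        + tanHalf (arcSqDist o r α β) / 4 *
          (-2 * (Real.sin α * Real.sin β + Real.cos α * Real.cos β)) := by
  have hT := tanHalf_pos h0 h4
  have hTL := tanHalf_sq h0 h4
  set L := arcSqDist o r α β with hL
  set T := tanHalf L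
  have hLe : L = (o 0 + Real.cos α - (r 0 + Real.cos β)) ^ 2
    + (o 1 + Real.sin α - (r 1 + Real.sin β)) ^ 2 := rfl
  set v0 := r 0 + Real.cos β - (o 0 + Real.cos α) with hv0
  set v1 := r 1 + Real.sin β - (o 1 + Real.sin α) with hv1
  have e0 : o 0 + Real.cos α - (r 0 + Real.cos β) = -v0 := by rw [hv0]; ring
  have e1 : o 1 + Real.sin α - (r 1 + Real.sin β) = -v1 := by rw [hv1]; ring
  rw [e0, e1] at hLe ⊢
  have ca := Real.sin_sq_add_cos_sq α
  have cb := Real.sin_sq_add_cos_sq β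
  have ho' : (v0 + Real.cos α) ^ 2 + (v1 + Real.sin α) ^ 2 ≤ 1 := by
    rw [hv0, hv1]; convert ho using 2 <;> ring
  have hr' : (Real.cos β - v0) ^ 2 + (Real.sin β - v1) ^ 2 ≤ 1 := by
    rw [hv0, hv1]; convert hr using 2 <;> ring
  clear_value v0 v1
  generalize Real.sin α = sa at *
  generalize Real.cos α = ca' at *
  generalize Real.sin β = sb at *
  generalize Real.cos β = cb' at *
  have key := mixed_derivative_nonneg (X := -sa * v0 + ca' * v1) (Y := -sa * v1 - ca' * v0)
    (X' := -sb * v0 + cb' * v1) (Y' := v0 * cb' + v1 * sb) hT h0 hTL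
    (by rw [hLe]; linear_combination (v0 ^ 2 + v1 ^ 2) * ca)
    (by rw [hLe]; linear_combination (v0 ^ 2 + v1 ^ 2) * cb)
    (by rw [hLe]; nlinarith) (by rw [hLe]; nlinarith)
    (by
      have : (-sa * v0 + ca' * v1) * (v0 * cb' + v1 * sb)
        + (-sa * v1 - ca' * v0) * (-sb * v0 + cb' * v1) = L * (ca' * sb - sa * cb') := by
        rw [hLe]; ring
      rw [this]; positivity)
  -- This form of the derivative of `tanHalf` makes `2 * L` the common denominator.
  have hfac : (1 + T ^ 2) ^ 2 / (8 * T) = T * (1 + T ^ 2) / (2 * L) := by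
    rw [div_eq_div_iff (by positivity) (by positivity)]
    linear_combination 2 * (1 + T ^ 2) * hTL
  rw [hfac]
  have e : (-sa * cb' + ca' * sb) / 2
      + T * (1 + T ^ 2) / (2 * L) * (2 * -v0 * sb - 2 * -v1 * cb') / 4 *
        (2 * -v0 * -sa + 2 * -v1 * ca') + T / 4 * (-2 * (sa * sb + ca' * cb'))
      = ((-sa * v0 + ca' * v1) * (v0 * cb' + v1 * sb)
        + (-sa * v1 - ca' * v0) * (-sb * v0 + cb' * v1)
        + T * ((-sa * v1 - ca' * v0) * (v0 * cb' + v1 * sb))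
        - T * (2 + T ^ 2) * ((-sa * v0 + ca' * v1) * (-sb * v0 + cb' * v1))) / (2 * L) := by
    rw [eq_div_iff (by positivity)]
    have : T * (1 + T ^ 2) / (2 * L) * (2 * -v0 * sb - 2 * -v1 * cb') / 4 *
        (2 * -v0 * -sa + 2 * -v1 * ca') * (2 * L)
        = T * (1 + T ^ 2) * (2 * -v0 * sb - 2 * -v1 * cb') / 4 *
        (2 * -v0 * -sa + 2 * -v1 * ca') := by
      field_simp
    rw [add_mul, add_mul, this, hLe]
    ring
  rw [e]
  positivity

/-- The quadrangle inequality along two unit arcs. -/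
theorem arcArea_quadrangle {o r : Plane} {α₁ α₂ β₁ β₂ : ℝ} (hα : α₁ ≤ α₂) (hβ : β₁ ≤ β₂)
    (hL : ∀ α ∈ Set.Ioo α₁ α₂, ∀ β ∈ Set.Icc β₁ β₂, 0 < arcSqDist o r α β ∧ arcSqDist o r α β < 4)
    (hin : ∀ α ∈ Set.Ioo α₁ α₂, ∀ β ∈ Set.Ioo β₁ β₂,
      (r 0 + Real.cos β - o 0) ^ 2 + (r 1 + Real.sin β - o 1) ^ 2 ≤ 1 ∧
      (o 0 + Real.cos α - r 0) ^ 2 + (o 1 + Real.sin α - r 1) ^ 2 ≤ 1 ∧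
      0 ≤ Real.cos α * Real.sin β - Real.sin α * Real.cos β) :
    arcArea o r α₁ β₂ + arcArea o r α₂ β₁ ≤ arcArea o r α₁ β₁ + arcArea o r α₂ β₂ := by
  have hmono : ∀ α ∈ Set.Ioo α₁ α₂, arcAreaDeriv o r α β₁ ≤ arcAreaDeriv o r α β₂ := by
    intro α hα'
    refine monotoneOn_of_deriv_nonneg (convex_Icc β₁ β₂) (f := fun β => arcAreaDeriv o r α β)
      (fun β hβ' => ?_) (fun β hβ' => ?_) (fun β hβ' => ?_) (Set.left_mem_Icc.2 hβ)
      (Set.right_mem_Icc.2 hβ) hβ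
    · obtain ⟨h0, h4⟩ := hL α hα' β hβ'
      exact (hasDerivAt_arcAreaDeriv h0 h4).continuousAt.continuousWithinAt
    · obtain ⟨h0, h4⟩ := hL α hα' β (interior_subset hβ')
      exact (hasDerivAt_arcAreaDeriv h0 h4).differentiableAt.differentiableWithinAt
    · obtain ⟨h0, h4⟩ := hL α hα' β (interior_subset hβ')
      rw [(hasDerivAt_arcAreaDeriv h0 h4).deriv]
      rw [interior_Icc] at hβ'
      obtain ⟨h1, h2, h3⟩ := hin α hα' β hβ'
      exact arcAreaDeriv_deriv_nonneg h0 h4 h1 h2 h3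
  have hder : ∀ α ∈ Set.Ioo α₁ α₂, HasDerivAt (fun α => arcArea o r α β₂ - arcArea o r α β₁)
      (arcAreaDeriv o r α β₂ - arcAreaDeriv o r α β₁) α := by
    intro α hα'
    obtain ⟨h0, h4⟩ := hL α hα' β₂ (Set.right_mem_Icc.2 hβ)
    obtain ⟨h0', h4'⟩ := hL α hα' β₁ (Set.left_mem_Icc.2 hβ)
    exact (hasDerivAt_arcArea h0 h4).sub (hasDerivAt_arcArea h0' h4')
  -- `segArea` is continuous everywhere, so no bounds on the chord are needed at the ends of the
  -- `α`-interval.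
  have hcont : Continuous (fun α => arcArea o r α β₂ - arcArea o r α β₁) := by
    have := continuous_segArea
    unfold arcArea arcSqDist
    fun_prop
  have := monotoneOn_of_deriv_nonneg (convex_Icc α₁ α₂) hcont.continuousOn
    (fun α hα' => (hder α (by rwa [interior_Icc] at hα')).differentiableAt.differentiableWithinAt)
    (fun α hα' => by
      rw [interior_Icc] at hα'
      rw [(hder α hα').deriv]
      linarith [hmono α hα'])
    (Set.left_mem_Icc.2 hα) (Set.right_mem_Icc.2 hα) hα
  simp only at this
  linarith

/-! ### The quadrangle inequality for segments -/

/-- Two vectors that span a positive angle have polar angles less than `π` apart. -/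
theorem exists_arc_angles {o a b : Plane} (ha : sqDist a o = 1) (hb : sqDist b o = 1)
    (hab : 0 < orient o a b) :
    ∃ α₁ α₂ : ℝ, α₁ < α₂ ∧ α₂ < α₁ + Real.pi ∧ a 0 = o 0 + Real.cos α₁ ∧ a 1 = o 1 + Real.sin α₁ ∧
      b 0 = o 0 + Real.cos α₂ ∧ b 1 = o 1 + Real.sin α₂ := by
  unfold sqDist at ha hb
  unfold orient at hab
  obtain ⟨α, hc, hs⟩ : ∃ α : ℝ, a 0 - o 0 = Real.cos α ∧ a 1 - o 1 = Real.sin α := by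
    have hz : ‖(⟨a 0 - o 0, a 1 - o 1⟩ : ℂ)‖ = 1 := by
      rw [← sq_eq_sq₀ (norm_nonneg _) zero_le_one, Complex.sq_norm, Complex.normSq_mk]
      linarith
    refine ⟨Complex.arg ⟨a 0 - o 0, a 1 - o 1⟩, ?_, ?_⟩
    · rw [Complex.cos_arg (by intro h; rw [h] at hz; simp at hz), hz, div_one]
    · rw [Complex.sin_arg, hz, div_one]
  set x := (a 0 - o 0) * (b 0 - o 0) + (a 1 - o 1) * (b 1 - o 1) with hx
  set y := (a 0 - o 0) * (b 1 - o 1) - (a 1 - o 1) * (b 0 - o 0) with hy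
  have hxy : x ^ 2 + y ^ 2 = 1 := by
    have : x ^ 2 + y ^ 2 = ((a 0 - o 0) ^ 2 + (a 1 - o 1) ^ 2)
      * ((b 0 - o 0) ^ 2 + (b 1 - o 1) ^ 2) := by rw [hx, hy]; ring
    rw [this, ha, hb]; norm_num
  have hx1 : -1 < x := by nlinarith
  have hx2 : x < 1 := by nlinarith
  have hcos : Real.cos (Real.arccos x) = x := Real.cos_arccos hx1.le hx2.le
  have hsin : Real.sin (Real.arccos x) = y := by
    rw [Real.sin_arccos, show 1 - x ^ 2 = y ^ 2 by linarith, Real.sqrt_sq hab.le]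
  have h1 : b 0 - o 0 = (a 0 - o 0) * x - (a 1 - o 1) * y := by
    rw [hx, hy]; linear_combination -(b 0 - o 0) * ha
  have h2 : b 1 - o 1 = (a 1 - o 1) * x + (a 0 - o 0) * y := by
    rw [hx, hy]; linear_combination -(b 1 - o 1) * ha
  refine ⟨α, α + Real.arccos x, ?_, ?_, by linarith, by linarith, ?_, ?_⟩
  · linarith [Real.arccos_pos.2 hx2]
  · have : Real.arccos x ≠ Real.pi := by rw [Ne, Real.arccos_eq_pi]; linarith
    linarith [lt_of_le_of_ne (Real.arccos_le_pi x) this]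
  · rw [Real.cos_add, hcos, hsin, ← hc, ← hs]; linarith
  · rw [Real.sin_add, hcos, hsin, ← hc, ← hs]; linarith

theorem orient_arcCenter_pos {a b : Plane} (hne : a ≠ b) (hL : sqDist a b < 4) :
    0 < orient (arcCenter a b) a b := by
  obtain ⟨t, ht0, ht, h0, h1⟩ := exists_arcCenter_eq hne hL.le
  have hLp := sqDist_pos hne
  have ht0 : 0 < t := by
    rcases ht0.eq_or_lt with rfl | h
    · linarith
    · exact h
  have : orient (arcCenter a b) a b = t * sqDist a b := by
    unfold orient sqDist; rw [h0, h1]; ring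
  rw [this]; positivity

/-- The point with angle `α` on the unit circle about `o`. -/
noncomputable def circlePoint (o : Plane) (α : ℝ) : Plane :=
  !₂[o 0 + Real.cos α, o 1 + Real.sin α]

theorem circlePoint_zero (o : Plane) (α : ℝ) : circlePoint o α 0 = o 0 + Real.cos α := by
  simp [circlePoint]

theorem circlePoint_one (o : Plane) (α : ℝ) : circlePoint o α 1 = o 1 + Real.sin α := by
  simp [circlePoint]

theorem sqDist_circlePoint (o : Plane) (α : ℝ) : sqDist (circlePoint o α) o = 1 := by
  unfold sqDist
  rw [circlePoint_zero, circlePoint_one]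
  linear_combination Real.sin_sq_add_cos_sq α

/-- The determinant is `sin (s + t) - sin s - sin t` for the two angles into which the point divides
the arc. It is negative, since both sines are positive and both cosines less than 1. -/
theorem orient_circlePoint_neg {o a b : Plane} {α₁ α₂ α : ℝ} (hα : α ∈ Set.Ioo α₁ α₂)
    (hπ : α₂ < α₁ + Real.pi) (ha0 : a 0 = o 0 + Real.cos α₁) (ha1 : a 1 = o 1 + Real.sin α₁)
    (hb0 : b 0 = o 0 + Real.cos α₂) (hb1 : b 1 = o 1 + Real.sin α₂) :
    orient a b (circlePoint o α) < 0 := by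
  obtain ⟨h1, h2⟩ := hα
  have e : orient a b (circlePoint o α) =
      Real.sin ((α - α₁) + (α₂ - α)) - Real.sin (α - α₁) - Real.sin (α₂ - α) := by
    unfold orient
    rw [circlePoint_zero, circlePoint_one, ha0, ha1, hb0, hb1,
      show α - α₁ + (α₂ - α) = α₂ - α₁ by ring, Real.sin_sub, Real.sin_sub, Real.sin_sub]
    ring
  rw [e, Real.sin_add]
  have s1 : 0 < Real.sin (α - α₁) := Real.sin_pos_of_pos_of_lt_pi (by linarith) (by linarith)
  have s2 : 0 < Real.sin (α₂ - α) := Real.sin_pos_of_pos_of_lt_pi (by linarith) (by linarith)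
  have c1 : Real.cos (α - α₁) < 1 := by
    nlinarith [Real.sin_sq_add_cos_sq (α - α₁), Real.cos_le_one (α - α₁)]
  have c2 : Real.cos (α₂ - α) < 1 := by
    nlinarith [Real.sin_sq_add_cos_sq (α₂ - α), Real.cos_le_one (α₂ - α)]
  nlinarith

/-- Around a boundary point, the orientation order of the points of `K` is transitive. -/
theorem orient_trans {K : Set Plane} (hK : IsSpindleConvexDisk K) {s x y z : Plane}
    (hs : s ∈ frontier K) (hx : x ∈ K) (hy : y ∈ K) (hz : z ∈ K)
    (hxy : 0 < orient s x y) (hyz : 0 < orient s y z) : 0 < orient s x z := by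
  obtain ⟨n, hn⟩ := exists_strict_normal hK hs
  have h1 := hn x hx (ne_of_orient_ne_zero hxy.ne').1.symm
  have h2 := hn y hy (ne_of_orient_ne_zero hxy.ne').2.1
  have h3 := hn z hz (ne_of_orient_ne_zero hyz.ne').2.1
  have e : (n 0 * (y 0 - s 0) + n 1 * (y 1 - s 1)) * orient s x z
      = (n 0 * (x 0 - s 0) + n 1 * (x 1 - s 1)) * orient s y z
      + (n 0 * (z 0 - s 0) + n 1 * (z 1 - s 1)) * orient s x y := by
    unfold orient; ring
  nlinarith [mul_pos (neg_pos.2 h1) hyz, mul_pos (neg_pos.2 h3) hxy]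

/-- If the tangents at two points of the arcs over two chords turn by more than `π`, then all
normals at the boundary points outside lie in the half-plane of the sum of the two radii. -/
theorem normal_in_halfplane {w0 w1 w0' w1' e0 e1 y0 y1 n0 n1 : ℝ}
    (hwe : 0 < w0 * e1 - w1 * e0) (hwy : 0 < w0 * y1 - w1 * y0)
    (hew : 0 < e0 * w1' - e1 * w0') (hwy' : 0 ≤ w0' * (y1 - e1) - w1' * (y0 - e0))
    (hey : 0 < e0 * y1 - e1 * y0) (hy : 0 ≤ n0 * y0 + n1 * y1)
    (hy' : 0 ≤ n0 * (y0 - e0) + n1 * (y1 - e1)) (hbad : w0 * w1' - w1 * w0' < 0) :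
    n0 * w0 + n1 * w1 ≤ 0 ∧ 0 ≤ n0 * w0' + n1 * w1' := by
  have p1 : (n0 * e0 + n1 * e1) * (w0 * y1 - w1 * y0)
      = (n0 * w0 + n1 * w1) * (e0 * y1 - e1 * y0) + (n0 * y0 + n1 * y1) * (w0 * e1 - w1 * e0) := by
    ring
  have p2 : (n0 * w0' + n1 * w1') * (e0 * y1 - e1 * y0)
      = (n0 * e0 + n1 * e1) * (w0' * (y1 - e1) - w1' * (y0 - e0))
      + (n0 * (y0 - e0) + n1 * (y1 - e1)) * (e0 * w1' - e1 * w0') := by ring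
  have p3 : (n0 * e0 + n1 * e1) * (w0 * w1' - w1 * w0')
      = (n0 * w0 + n1 * w1) * (e0 * w1' - e1 * w0')
      + (n0 * w0' + n1 * w1') * (w0 * e1 - w1 * e0) := by ring
  generalize n0 * e0 + n1 * e1 = ne at *
  generalize n0 * w0 + n1 * w1 = nw at *
  generalize n0 * w0' + n1 * w1' = nw' at *
  generalize n0 * y0 + n1 * y1 = ny at *
  generalize n0 * (y0 - e0) + n1 * (y1 - e1) = ny' at *
  generalize w0 * w1' - w1 * w0' = ww at *
  generalize w0 * e1 - w1 * e0 = we at *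
  generalize e0 * w1' - e1 * w0' = ew at *
  generalize e0 * y1 - e1 * y0 = ey at *
  generalize w0 * y1 - w1 * y0 = wy at *
  generalize w0' * (y1 - e1) - w1' * (y0 - e0) = wy' at *
  constructor
  · by_contra hc
    push Not at hc
    have h1 : 0 < ne := by
      have : 0 < ne * wy := by rw [p1]; nlinarith [mul_pos hc hey, mul_nonneg hy hwe.le]
      exact pos_of_mul_pos_left this hwy.le
    have h2 : 0 ≤ nw' := by
      have : 0 ≤ nw' * ey := by rw [p2]; positivity
      exact nonneg_of_mul_nonneg_left this hey
    nlinarith [mul_pos hc hew, mul_nonneg h2 hwe.le]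
  · by_contra hc
    push Not at hc
    have h1 : ne < 0 := by
      by_contra h
      push Not at h
      have : 0 ≤ nw' * ey := by rw [p2]; positivity
      nlinarith
    have h2 : nw < 0 := by
      by_contra h
      push Not at h
      have : 0 ≤ ne * wy := by rw [p1]; positivity
      nlinarith
    nlinarith [mul_pos (neg_pos.2 h2) hew, mul_pos (neg_pos.2 hc) hwe,
      mul_pos (neg_pos.2 h1) (neg_pos.2 hbad)]

/-- The radii of two arcs span a nonnegative angle, if no half-plane contains all normals at
the points of a set outside the two arcs. -/
theorem radii_cross_nonneg {K : Set Plane} (hK : IsSpindleConvexDisk K)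
    {a b c d p q o r : Plane} {P : Set Plane}
    (hb : b ∈ frontier K) (hc : c ∈ frontier K)
    (ha : a ∈ K) (hd : d ∈ K) (hp : p ∈ K) (hq : q ∈ K)
    (habp : orient a b p < 0) (hcdq : orient c d q < 0)
    (hpo : sqDist p o = 1) (hqr : sqDist q r = 1) (hpr : sqDist p r ≤ 1) (hqo : sqDist q o ≤ 1)
    (hpq : p ≠ q)
    (hP : ∀ s ∈ P, s ∈ frontier K ∧ sqDist s o ≤ 1 ∧ sqDist s r ≤ 1 ∧
      (s = a ∨ 0 < orient s a b) ∧ 0 < orient s b c ∧ (s = d ∨ 0 < orient s c d))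
    (hstuck : ∀ z : Plane, ∃ s ∈ P, ∃ n, IsUnitNormal K n s ∧ 0 ≤ dotp n z) :
    0 ≤ (p 0 - o 0) * (q 1 - r 1) - (p 1 - o 1) * (q 0 - r 0) := by
  by_contra hbad
  push Not at hbad
  -- The direction opposite to the sum of the two radii.
  obtain ⟨s, hs, n, hn, hz⟩ := hstuck
    !₂[-((p 0 - o 0) + (q 0 - r 0)), -((p 1 - o 1) + (q 1 - r 1))]
  obtain ⟨hsK, hso, hsr, hsa, hsbc, hsd⟩ := hP s hs
  have hsK' := hK.frontier_subset hsK
  have hpb := (ne_of_orient_ne_zero habp.ne).2.2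
  have hpa := (ne_of_orient_ne_zero habp.ne).2.1
  have hqc := (ne_of_orient_ne_zero hcdq.ne).2.1
  have hspb : 0 < orient s p b := by
    rcases hsa with rfl | hsa
    · have : orient s p b = -orient s b p := by unfold orient; ring
      linarith
    · rw [orient_rotate b s p]
      exact orient_pos_of_next hK ha hb hsK' hp hpb (by rwa [orient_rotate]) habp.le
  have hscq : 0 < orient s c q := by
    rcases hsd with rfl | hsd
    · have : orient s c q = -orient c s q := by unfold orient; ring
      linarith
    · by_contra h
      push Not at h
      have := orient_pos_of_next hK hsK' hc hd hq hqc hsd h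
      linarith
  -- Seen from `s`, the points `p`, `b`, `c`, `q` follow each other counterclockwise.
  have hspq : 0 < orient s p q :=
    orient_trans hK hsK hp (hK.frontier_subset hc) hq
      (orient_trans hK hsK hp (hK.frontier_subset hb) (hK.frontier_subset hc) hspb hsbc) hscq
  have hsp : s ≠ p := (ne_of_orient_ne_zero hspq.ne').1
  -- `w` and `w'` are the tangents at `p` and `q`, `e` is the chord `q - p`, and `y` is `s - p`. The
  -- signs say that each disk contains the relevant other points.
  have key := normal_in_halfplane (w0 := -(p 1 - o 1)) (w1 := p 0 - o 0) (w0' := -(q 1 - r 1))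
    (w1' := q 0 - r 0) (e0 := q 0 - p 0) (e1 := q 1 - p 1) (y0 := s 0 - p 0) (y1 := s 1 - p 1)
    (n0 := n 0) (n1 := n 1) ?_ ?_ ?_ ?_ ?_ ?_ ?_ ?_
  · obtain ⟨k1, k2⟩ := key
    have hpo' : (p 0 - o 0) ^ 2 + (p 1 - o 1) ^ 2 = 1 := hpo
    have hqr' : (q 0 - r 0) ^ 2 + (q 1 - r 1) ^ 2 = 1 := hqr
    have hz' : n 0 * (p 0 - o 0 + (q 0 - r 0)) + n 1 * (p 1 - o 1 + (q 1 - r 1)) ≤ 0 := by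
      simp only [dotp, Matrix.cons_val_zero, Matrix.cons_val_one] at hz
      linarith
    have hn1 := hn.1
    generalize p 0 - o 0 = A0 at *
    generalize p 1 - o 1 = A1 at *
    generalize q 0 - r 0 = B0 at *
    generalize q 1 - r 1 = B1 at *
    set D := A0 * B1 - A1 * B0
    set C := A0 * B0 + A1 * B1
    have hCD : C ^ 2 + D ^ 2 = 1 := by
      have : C ^ 2 + D ^ 2 = (A0 ^ 2 + A1 ^ 2) * (B0 ^ 2 + B1 ^ 2) := by ring
      rw [this, hpo', hqr']; norm_num
    have hC : 0 < 1 + C := by nlinarith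
    -- The left side is nonpositive by the choice of direction, the right side nonnegative by `key`.
    -- So `n` is orthogonal to both tangents, which are independent as `D` is not 0; a unit vector
    -- cannot be.
    have e : -D * (n 0 * (A0 + B0) + n 1 * (A1 + B1))
        = (1 + C) * ((n 0 * -B1 + n 1 * B0) - (n 0 * -A1 + n 1 * A0)) := by
      linear_combination (-n 0 * B1 + n 1 * B0) * (hpo') + (-n 1 * A0 + n 0 * A1) * hqr'
    have h1 : -D * (n 0 * (A0 + B0) + n 1 * (A1 + B1)) ≤ 0 := by nlinarith
    have h2 : (n 0 * -B1 + n 1 * B0) = 0 ∧ (n 0 * -A1 + n 1 * A0) = 0 := by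
      rw [e] at h1
      have : (n 0 * -B1 + n 1 * B0) - (n 0 * -A1 + n 1 * A0) ≤ 0 := by
        by_contra h
        push Not at h
        nlinarith
      constructor <;> linarith
    have h3 : n 0 * D = 0 := by
      linear_combination B0 * h2.2 - A0 * h2.1
    have h4 : n 1 * D = 0 := by
      linear_combination B1 * h2.2 - A1 * h2.1
    have h5 : n 0 = 0 := (mul_eq_zero.1 h3).resolve_right hbad.ne
    have h6 : n 1 = 0 := (mul_eq_zero.1 h4).resolve_right hbad.ne
    rw [h5, h6] at hn1
    norm_num at hn1
  · have := sqDist_pos hpq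
    unfold sqDist at this hpo hqo
    nlinarith
  · have := sqDist_pos hsp
    unfold sqDist at this hpo hso
    nlinarith
  · have := sqDist_pos hpq
    unfold sqDist at this hqr hpr
    nlinarith
  · have := sqDist_nonneg s q
    unfold sqDist at this hqr hsr
    nlinarith
  · have : orient s p q = (q 0 - p 0) * (s 1 - p 1) - (q 1 - p 1) * (s 0 - p 0) := by
      unfold orient; ring
    linarith
  · have := hn.2 p hp
    linarith
  · have := hn.2 q hq
    linarith
  · linarith

/-- The quadrangle inequality for half the determinant plus the area of the segment. -/
theorem segArea_quadrangle {K : Set Plane} (hK : IsSpindleConvexDisk K)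
    (hdiam : ∀ x ∈ K, ∀ y ∈ K, sqDist x y < 4) {a b c d : Plane} {P : Set Plane}
    (ha : a ∈ frontier K) (hb : b ∈ frontier K) (hc : c ∈ frontier K) (hd : d ∈ frontier K)
    (habc : 0 < orient a b c) (habd : 0 < orient a b d) (hacd : 0 < orient a c d)
    (hbcd : 0 < orient b c d)
    (hP : ∀ s ∈ P, s ∈ frontier K ∧
      (s = a ∨ 0 < orient s a b) ∧ 0 < orient s b c ∧ (s = d ∨ 0 < orient s c d))
    (hstuck : ∀ z : Plane, ∃ s ∈ P, ∃ n, IsUnitNormal K n s ∧ 0 ≤ dotp n z) :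
    cross a d / 2 + segArea (sqDist a d) + (cross b c / 2 + segArea (sqDist b c))
      ≤ cross a c / 2 + segArea (sqDist a c) + (cross b d / 2 + segArea (sqDist b d)) := by
  have haK := hK.frontier_subset ha
  have hbK := hK.frontier_subset hb
  have hcK := hK.frontier_subset hc
  have hdK := hK.frontier_subset hd
  have hab : a ≠ b := (ne_of_orient_ne_zero habc.ne').1
  have hcd : c ≠ d := (ne_of_orient_ne_zero hacd.ne').2.2.symm
  have hLab := hdiam a haK b hbK
  have hLcd := hdiam c hcK d hdK
  obtain ⟨α₁, α₂, hα, hαπ, ha0, ha1, hb0, hb1⟩ := exists_arc_angles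
    (sqDist_arcCenter_left hab hLab.le) (sqDist_arcCenter_right hab hLab.le)
    (orient_arcCenter_pos hab hLab)
  obtain ⟨β₁, β₂, hβ, hβπ, hc0, hc1, hd0, hd1⟩ := exists_arc_angles
    (sqDist_arcCenter_left hcd hLcd.le) (sqDist_arcCenter_right hcd hLcd.le)
    (orient_arcCenter_pos hcd hLcd)
  have hDab : ∀ x ∈ K, 0 ≤ orient a b x → sqDist x (arcCenter a b) ≤ 1 :=
    fun x hx h => sqDist_arcCenter_le hK ha hb hab hLab.le hx h
  have hDcd : ∀ x ∈ K, 0 ≤ orient c d x → sqDist x (arcCenter c d) ≤ 1 :=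
    fun x hx h => sqDist_arcCenter_le hK hc hd hcd hLcd.le hx h
  set o := arcCenter a b
  set r := arcCenter c d
  have hparc : ∀ α ∈ Set.Ioo α₁ α₂, orient a b (circlePoint o α) < 0 ∧
      circlePoint o α ∈ spindle a b := by
    intro α hα'
    have h := orient_circlePoint_neg hα' hαπ ha0 ha1 hb0 hb1
    exact ⟨h, mem_spindle_of_segment hab hLab (sqDist_circlePoint o α).le h.le⟩
  have hqarc : ∀ β ∈ Set.Ioo β₁ β₂, orient c d (circlePoint r β) < 0 ∧
      circlePoint r β ∈ spindle c d := by
    intro β hβ'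
    have h := orient_circlePoint_neg hβ' hβπ hc0 hc1 hd0 hd1
    exact ⟨h, mem_spindle_of_segment hcd hLcd (sqDist_circlePoint r β).le h.le⟩
  have hpK : ∀ α ∈ Set.Ioo α₁ α₂, circlePoint o α ∈ K := fun α h =>
    hK.spindle_subset a haK b hbK (hparc α h).2
  have hqK : ∀ β ∈ Set.Ioo β₁ β₂, circlePoint r β ∈ K := fun β h =>
    hK.spindle_subset c hcK d hdK (hqarc β h).2
  have hβc : circlePoint r β₁ = c :=
    plane_ext (by rw [circlePoint_zero, hc0]) (by rw [circlePoint_one, hc1])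
  have hβd : circlePoint r β₂ = d :=
    plane_ext (by rw [circlePoint_zero, hd0]) (by rw [circlePoint_one, hd1])
  have hne : ∀ α ∈ Set.Ioo α₁ α₂, ∀ β ∈ Set.Icc β₁ β₂,
      circlePoint r β ∈ K ∧ circlePoint o α ≠ circlePoint r β := by
    intro α hα' β hβ'
    have h := (hparc α hα').1
    rcases hβ'.1.eq_or_lt with rfl | h1
    · rw [hβc]
      refine ⟨hcK, ?_⟩
      rintro heq
      rw [heq] at h
      linarith
    rcases hβ'.2.eq_or_lt with rfl | h2
    · rw [hβd]
      refine ⟨hdK, ?_⟩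
      rintro heq
      rw [heq] at h
      linarith
    refine ⟨hqK β ⟨h1, h2⟩, fun heq => ?_⟩
    have h3 := orient_nonneg_of_opposite hK ha hbK hc hdK (hpK α hα') habc hacd h
    have h4 := (hqarc β ⟨h1, h2⟩).1
    rw [← heq] at h4
    linarith
  have hsq : ∀ α β, arcSqDist o r α β = sqDist (circlePoint o α) (circlePoint r β) := by
    intro α β
    unfold arcSqDist sqDist
    simp only [circlePoint_zero, circlePoint_one]
  have main := arcArea_quadrangle (o := o) (r := r) hα.le hβ.le (fun α hα' β hβ' => ?_)
    (fun α hα' β hβ' => ?_)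
  · unfold arcArea arcSqDist at main
    rw [← ha0, ← ha1, ← hb0, ← hb1, ← hc0, ← hc1, ← hd0, ← hd1] at main
    exact main
  · obtain ⟨h1, h2⟩ := hne α hα' β hβ'
    rw [hsq]
    exact ⟨sqDist_pos h2, hdiam _ (hpK α hα') _ h1⟩
  · have hp := hpK α hα'
    have hq := hqK β hβ'
    -- `a` and `b` lie left of `c d`, hence in the disk about `r`, and then so does their spindle.
    have hpr : sqDist (circlePoint o α) r ≤ 1 :=
      mem_spindle_iff.1 (hparc α hα').2 r
        (hDcd a haK (by rw [orient_rotate]; exact hacd.le))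
        (hDcd b hbK (by rw [orient_rotate]; exact hbcd.le))
    have hqo : sqDist (circlePoint r β) o ≤ 1 :=
      mem_spindle_iff.1 (hqarc β hβ').2 o (hDab c hcK habc.le) (hDab d hdK habd.le)
    have h := radii_cross_nonneg hK (o := o) (r := r) hb hc haK hdK hp hq (hparc α hα').1
      (hqarc β hβ').1 (sqDist_circlePoint o α) (sqDist_circlePoint r β) hpr hqo
      (hne α hα' β (Set.Ioo_subset_Icc_self hβ')).2 (P := P) (fun s hs => ?_) hstuck
    · simp only [circlePoint_zero, circlePoint_one, add_sub_cancel_left] at h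
      unfold sqDist at hpr hqo
      simp only [circlePoint_zero, circlePoint_one] at hpr hqo
      exact ⟨hqo, hpr, h⟩
    · obtain ⟨h1, h2, h3, h4⟩ := hP s hs
      have hsK := hK.frontier_subset h1
      refine ⟨h1, hDab s hsK ?_, hDcd s hsK ?_, h2, h3, h4⟩
      · rcases h2 with rfl | h2
        · have : orient s b s = 0 := by unfold orient; ring
          rw [this]
        · rw [orient_rotate]; exact h2.le
      · rcases h4 with rfl | h4
        · have : orient c s s = 0 := by unfold orient; ring
          rw [this]
        · rw [orient_rotate]; exact h4.le

/-! ### Caps and losses -/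

/-- The part of `K` strictly to the right of the chord from `a` to `c`. -/
def cap (K : Set Plane) (a c : Plane) : Set Plane := K ∩ {x | orient a c x < 0}

/-- The segment strictly to the right of the chord from `a` to `c`, in the unit disk through `a` and
`c` with center on the left. -/
def discSegment (a c : Plane) : Set Plane :=
  {x | sqDist x (arcCenter a c) ≤ 1 ∧ orient a c x < 0}

/-- The area of the part of `K` outside the unit disk through `a` and `c` with center to the left
of the chord from `a` to `c`. -/
noncomputable def capLoss (K : Set Plane) (a c : Plane) : ℝ :=
  MeasureTheory.volume.real (cap K a c) - segArea (sqDist a c)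

theorem measurable_orient (a c : Plane) : Measurable (orient a c) := by
  unfold orient; fun_prop

theorem measurable_sqDist (c : Plane) : Measurable (fun x => sqDist x c) := by
  unfold sqDist; fun_prop

theorem measurableSet_orient_neg (a c : Plane) : MeasurableSet {x | orient a c x < 0} :=
  measurableSet_lt (measurable_orient a c) measurable_const

theorem IsSpindleConvexDisk.measurableSet {K : Set Plane} (hK : IsSpindleConvexDisk K) :
    MeasurableSet K := hK.isCompact.isClosed.measurableSet

theorem measurableSet_cap {K : Set Plane} (hK : IsSpindleConvexDisk K) (a c : Plane) :
    MeasurableSet (cap K a c) := hK.measurableSet.inter (measurableSet_orient_neg a c)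

theorem measurableSet_discSegment (a c : Plane) : MeasurableSet (discSegment a c) :=
  (measurableSet_le (measurable_sqDist _) measurable_const).inter (measurableSet_orient_neg a c)

theorem cap_ne_top {K : Set Plane} (hK : IsSpindleConvexDisk K) (a c : Plane) :
    MeasureTheory.volume (cap K a c) ≠ ⊤ :=
  ((MeasureTheory.measure_mono Set.inter_subset_left).trans_lt hK.isCompact.measure_lt_top).ne

theorem segArea_nonneg {L : ℝ} (h0 : 0 ≤ L) (h4 : L < 4) : 0 ≤ segArea L := by
  unfold segArea
  have h1 : √L / 2 ≤ Real.arcsin (√L / 2) := by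
    have hl : √L ≤ 2 := (Real.sqrt_le_left (by norm_num)).2 (by linarith)
    have h := Real.sin_le (x := Real.arcsin (√L / 2)) (Real.arcsin_nonneg.2 (by positivity))
    rwa [Real.sin_arcsin (by linarith [Real.sqrt_nonneg L]) (by linarith)] at h
  have h2 : √(1 - L / 4) ≤ 1 := Real.sqrt_le_one.2 (by linarith)
  nlinarith [Real.sqrt_nonneg L]

theorem volume_discSegment {a c : Plane} (hne : a ≠ c) (hL : sqDist a c < 4) :
    MeasureTheory.volume.real (discSegment a c) = segArea (sqDist a c) := by
  rw [MeasureTheory.measureReal_def, discSegment, volume_segment hne hL,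
    ENNReal.toReal_ofReal (segArea_nonneg (sqDist_nonneg _ _) hL)]

theorem mem_of_barycentric {K : Set Plane} (hK : Convex ℝ K) {a b c x : Plane} (ha : a ∈ K)
    (hb : b ∈ K) (hc : c ∈ K) (habc : 0 < orient a b c) (h1 : 0 ≤ orient b c x)
    (h2 : 0 ≤ orient c a x) (h3 : 0 ≤ orient a b x) : x ∈ K := by
  have hsum : orient b c x + orient c a x + orient a b x = orient a b c := by
    unfold orient; ring
  have := hK.sum_mem (t := Finset.univ) (w := ![orient b c x / orient a b c,
    orient c a x / orient a b c, orient a b x / orient a b c]) (z := ![a, b, c]) ?_ ?_ ?_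
  · convert this using 1
    simp only [Fin.sum_univ_three, Matrix.cons_val_zero, Matrix.cons_val_one, Matrix.cons_val]
    have e0 : orient a b c * x 0
        = orient b c x * a 0 + orient c a x * b 0 + orient a b x * c 0 := by unfold orient; ring
    have e1 : orient a b c * x 1
        = orient b c x * a 1 + orient c a x * b 1 + orient a b x * c 1 := by unfold orient; ring
    apply plane_ext
    · simp only [PiLp.add_apply, PiLp.smul_apply, smul_eq_mul]
      field_simp
      linarith
    · simp only [PiLp.add_apply, PiLp.smul_apply, smul_eq_mul]
      field_simp
      linarith
  · intro i _
    fin_cases i <;> simp <;> positivity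
  · simp only [Fin.sum_univ_three, Matrix.cons_val_zero, Matrix.cons_val_one, Matrix.cons_val]
    rw [← add_div, ← add_div, hsum, div_self habc.ne']
  · intro i _
    fin_cases i <;> simpa

-- The cap over `a c` is the disjoint union of the caps over `a b` and `b c` and the half-open
-- triangle. Strict convexity at `b` separates the two small caps.
open MeasureTheory in
theorem volume_cap_add {K : Set Plane} (hK : IsSpindleConvexDisk K) {a b c : Plane}
    (ha : a ∈ frontier K) (hb : b ∈ frontier K) (hc : c ∈ frontier K) (habc : 0 < orient a b c) :
    volume.real (cap K a c)
      = volume.real (cap K a b) + volume.real (cap K b c) + orient a b c / 2 := by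
  have haK := hK.frontier_subset ha
  have hbK := hK.frontier_subset hb
  have hcK := hK.frontier_subset hc
  set T : Set Plane := {x | 0 ≤ orient a b x ∧ 0 ≤ orient b c x ∧ orient a c x < 0} with hT
  have hTm : MeasurableSet T :=
    (measurableSet_le measurable_const (measurable_orient a b)).inter
      ((measurableSet_le measurable_const (measurable_orient b c)).inter
        (measurableSet_orient_neg a c))
  have hTv : volume.real T = orient a b c / 2 := by
    rw [measureReal_def, volume_triangle habc, ENNReal.toReal_ofReal (by positivity)]
  have hTK : T ⊆ K := by
    rintro x ⟨h1, h2, h3⟩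
    exact mem_of_barycentric hK.convex haK hbK hcK habc h2 (by rw [orient_swap]; linarith) h1
  have hset : cap K a c = (cap K a b ∪ cap K b c) ∪ T := by
    ext x
    constructor
    · rintro ⟨hx, h⟩
      by_cases h1 : orient a b x < 0
      · exact Or.inl (Or.inl ⟨hx, h1⟩)
      by_cases h2 : orient b c x < 0
      · exact Or.inl (Or.inr ⟨hx, h2⟩)
      exact Or.inr ⟨not_lt.1 h1, not_lt.1 h2, h⟩
    · rintro ((⟨hx, h⟩ | ⟨hx, h⟩) | h)
      · exact ⟨hx, orient_neg_of_first hK ha hbK hcK hx habc h⟩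
      · exact ⟨hx, orient_neg_of_second hK haK hbK hc hx habc h⟩
      · exact ⟨hTK h, h.2.2⟩
  have hd1 : Disjoint (cap K a b) (cap K b c) := by
    rw [Set.disjoint_left]
    rintro x ⟨hx, h⟩ ⟨-, h'⟩
    have h : orient a b x < 0 := h
    have := orient_pos_of_next hK haK hb hcK hx (ne_of_orient_ne_zero h.ne).2.2 habc h.le
    exact lt_asymm this h'
  have hd2 : Disjoint (cap K a b ∪ cap K b c) T := by
    rw [Set.disjoint_left]
    rintro x (⟨-, h⟩ | ⟨-, h⟩) h'
    · exact not_lt.2 h'.1 h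
    · exact not_lt.2 h'.2.1 h
  have hTtop : volume T ≠ ⊤ := ((measure_mono hTK).trans_lt hK.isCompact.measure_lt_top).ne
  rw [hset, measureReal_union hd2 hTm (measure_union_ne_top (cap_ne_top hK a b) (cap_ne_top hK b c))
    hTtop, measureReal_union hd1 (measurableSet_cap hK b c) (cap_ne_top hK a b)
    (cap_ne_top hK b c), hTv]

/-- The quadrangle inequality for the area that a unit disk through two boundary points misses. -/
theorem capLoss_quadrangle {K : Set Plane} (hK : IsSpindleConvexDisk K)
    (hdiam : ∀ x ∈ K, ∀ y ∈ K, sqDist x y < 4) {a b c d : Plane} {P : Set Plane}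
    (ha : a ∈ frontier K) (hb : b ∈ frontier K) (hc : c ∈ frontier K) (hd : d ∈ frontier K)
    (habc : 0 < orient a b c) (habd : 0 < orient a b d) (hacd : 0 < orient a c d)
    (hbcd : 0 < orient b c d)
    (hP : ∀ s ∈ P, s ∈ frontier K ∧
      (s = a ∨ 0 < orient s a b) ∧ 0 < orient s b c ∧ (s = d ∨ 0 < orient s c d))
    (hstuck : ∀ z : Plane, ∃ s ∈ P, ∃ n, IsUnitNormal K n s ∧ 0 ≤ dotp n z) :
    capLoss K a c + capLoss K b d ≤ capLoss K a d + capLoss K b c := by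
  have h := segArea_quadrangle hK hdiam ha hb hc hd habc habd hacd hbcd hP hstuck
  have h1 := volume_cap_add hK ha hb hd habd
  have h2 := volume_cap_add hK ha hb hc habc
  -- The cap over `a b` cancels between `h1` and `h2`; the difference of the triangles supplies
  -- exactly the determinants in `segArea_quadrangle`.
  have e : orient a b d - orient a b c = cross a c + cross b d - cross a d - cross b c := by
    unfold orient cross; ring
  unfold capLoss
  linarith

/-! ### Inscribed polygons and their disk-polygons -/

/-- The first `m` terms of `p` are the consecutive vertices of a convex polygon with vertices on the
boundary of `K`, and the next term closes it. -/
structure IsInscribedSeq (K : Set Plane) (m : ℕ) (p : ℕ → Plane) : Prop where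
  mem : ∀ i < m, p i ∈ frontier K
  closed : p m = p 0
  ccw : ∀ i j k, i < j → j < k → k < m → 0 < orient (p i) (p j) (p k)

namespace IsInscribedSeq

variable {K : Set Plane} {m : ℕ} {p : ℕ → Plane}

theorem mem_of_le (h : IsInscribedSeq K m p) (hm : 3 ≤ m) {i : ℕ} (hi : i ≤ m) :
    p i ∈ frontier K := by
  rcases hi.eq_or_lt with rfl | hi
  · rw [h.closed]; exact h.mem 0 (by omega)
  · exact h.mem i hi

theorem side_nonneg (h : IsInscribedSeq K m p) {i j : ℕ} (hi : i < m) (hj : j < m) :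
    0 ≤ orient (p i) (p (i + 1)) (p j) := by
  have z1 : ∀ a b : Plane, orient a b a = 0 := fun a b => by unfold orient; ring
  have z2 : ∀ a b : Plane, orient a b b = 0 := fun a b => by unfold orient; ring
  rcases eq_or_ne j i with rfl | hji
  · rw [z1]
  rcases (show i + 1 < m ∨ i + 1 = m by omega) with hi1 | hi1
  · rcases eq_or_ne j (i + 1) with rfl | hji1
    · rw [z2]
    rcases lt_or_gt_of_ne hji with hlt | hgt
    · rw [orient_rotate]; exact (h.ccw j i (i + 1) hlt (by omega) hi1).le
    · exact (h.ccw i (i + 1) j (by omega) (by omega) hj).le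
  · rw [hi1, h.closed]
    rcases Nat.eq_zero_or_pos j with rfl | hj0
    · rw [z2]
    · rw [← orient_rotate]; exact (h.ccw 0 j i hj0 (by omega) hi).le

theorem side_ne (h : IsInscribedSeq K m p) (hm : 3 ≤ m) {i : ℕ} (hi : i < m) :
    p i ≠ p (i + 1) := by
  rcases (show i + 1 < m ∨ i + 1 = m by omega) with hi1 | hi1
  · rcases (show i + 2 < m ∨ i + 2 = m by omega) with hi2 | hi2
    · exact (ne_of_orient_ne_zero (h.ccw i (i + 1) (i + 2) (by omega) (by omega) hi2).ne').1
    · exact (ne_of_orient_ne_zero (h.ccw 0 i (i + 1) (by omega) (by omega) hi1).ne').2.2.symm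
  · rw [hi1, h.closed]
    exact (ne_of_orient_ne_zero (h.ccw 0 1 i (by omega) (by omega) hi).ne').2.1

/-- Adjacent sides fall under `orient_pos_of_next`, including the first and last side at `p 0`; the
others are opposite sides of a quadrangle. -/
theorem caps_disjoint (h : IsInscribedSeq K m p) (hK : IsSpindleConvexDisk K) (hm : 3 ≤ m)
    {i j : ℕ} (hij : i < j) (hj : j < m) {x : Plane} (hx : x ∈ K)
    (hi : orient (p i) (p (i + 1)) x < 0) : 0 ≤ orient (p j) (p (j + 1)) x := by
  have hF : ∀ i, i ≤ m → p i ∈ K := fun i hi => hK.frontier_subset (h.mem_of_le hm hi)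
  rcases (show j = i + 1 ∨ i + 1 < j by omega) with rfl | hij1
  · refine (orient_pos_of_next hK (hF i (by omega)) (h.mem _ hj) (hF _ (by omega)) hx
      (ne_of_orient_ne_zero hi.ne).2.2 ?_ hi.le).le
    rcases (show i + 1 + 1 < m ∨ i + 1 + 1 = m by omega) with h1 | h1
    · exact h.ccw i (i + 1) (i + 1 + 1) (by omega) (by omega) h1
    · rw [h1, h.closed, orient_rotate]
      exact h.ccw 0 i (i + 1) (by omega) (by omega) hj
  · rcases (show j + 1 < m ∨ j + 1 = m by omega) with h1 | h1
    · exact (orient_nonneg_of_opposite hK (h.mem i (by omega)) (hF _ (by omega)) (h.mem j hj)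
        (hF _ (by omega)) hx (h.ccw i (i + 1) j (by omega) hij1 hj)
        (h.ccw i j (j + 1) hij (by omega) h1) hi).le
    · rw [h1, h.closed]
      rcases Nat.eq_zero_or_pos i with rfl | hi0
      · by_contra hc
        push Not at hc
        have := orient_pos_of_next hK (hF j (by omega)) (h.mem 0 (by omega)) (hF 1 (by omega)) hx
          (ne_of_orient_ne_zero hc.ne).2.2
          (by rw [← orient_rotate]; exact h.ccw 0 1 j (by omega) (by omega) hj) hc.le
        exact lt_asymm this hi
      · exact (orient_nonneg_of_opposite hK (h.mem i (by omega)) (hF _ (by omega)) (h.mem j hj)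
          (hF 0 (by omega)) hx (h.ccw i (i + 1) j (by omega) hij1 hj)
          (by rw [orient_rotate]; exact h.ccw 0 i j hi0 hij hj) hi).le

/-- Fan triangulation from `p 0`: the first diagonal that does not have `x` strictly on its left
closes a triangle containing `x`. -/
theorem mem_of_side_nonneg (h : IsInscribedSeq K m p) (hK : IsSpindleConvexDisk K) (hm : 3 ≤ m)
    {x : Plane} (hx : ∀ i < m, 0 ≤ orient (p i) (p (i + 1)) x) : x ∈ K := by
  have hF : ∀ i, i ≤ m → p i ∈ K := fun i hi => hK.frontier_subset (h.mem_of_le hm hi)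
  classical
  have hlast : orient (p 0) (p (m - 2 + 1)) x ≤ 0 := by
    have := hx (m - 1) (by omega)
    rw [show m - 1 + 1 = m by omega, h.closed, orient_swap] at this
    rw [show m - 2 + 1 = m - 1 by omega]
    linarith
  have hex : ∃ i, 1 ≤ i ∧ orient (p 0) (p (i + 1)) x ≤ 0 := ⟨m - 2, by omega, hlast⟩
  obtain ⟨h1, h2⟩ := Nat.find_spec hex
  have hle : Nat.find hex ≤ m - 2 := Nat.find_min' hex ⟨by omega, hlast⟩
  have hmin : ∀ j < Nat.find hex, ¬ (1 ≤ j ∧ orient (p 0) (p (j + 1)) x ≤ 0) :=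
    fun j hj => Nat.find_min hex hj
  generalize Nat.find hex = i at *
  have h3 : 0 ≤ orient (p 0) (p i) x := by
    rcases h1.eq_or_lt with rfl | h1
    · exact hx 0 (by omega)
    · have := hmin (i - 1) (by omega)
      rw [show i - 1 + 1 = i by omega] at this
      by_contra hc
      exact this ⟨by omega, (not_le.1 hc).le⟩
  exact mem_of_barycentric hK.convex (hF 0 (by omega)) (hF i (by omega)) (hF (i + 1) (by omega))
    (h.ccw 0 i (i + 1) (by omega) (by omega) (by omega)) (hx i (by omega))
    (by rw [orient_swap]; linarith) h3

open MeasureTheory in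
/-- A subset of `K` in all unit disks of an inscribed polygon misses at least the sum of the losses
of the sides. -/
theorem volume_le (h : IsInscribedSeq K m p) (hK : IsSpindleConvexDisk K)
    (hdiam : ∀ x ∈ K, ∀ y ∈ K, sqDist x y < 4) (hm : 3 ≤ m) {Q : Set Plane} (hQK : Q ⊆ K)
    (hQ : ∀ x ∈ Q, ∀ i < m, sqDist x (arcCenter (p i) (p (i + 1))) ≤ 1) :
    volume.real Q ≤ volume.real K - ∑ i ∈ Finset.range m, capLoss K (p i) (p (i + 1)) := by
  have hF : ∀ i, i ≤ m → p i ∈ K := fun i hi => hK.frontier_subset (h.mem_of_le hm hi)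
  set C : Set Plane := ⋃ i ∈ Finset.range m, cap K (p i) (p (i + 1)) with hC
  have hCm : MeasurableSet C :=
    Finset.measurableSet_biUnion _ fun i _ => measurableSet_cap hK _ _
  have hCK : C ⊆ K := Set.iUnion₂_subset fun i _ => Set.inter_subset_left
  have hKtop : volume K ≠ ⊤ := hK.isCompact.measure_lt_top.ne
  have hCv : volume.real C = ∑ i ∈ Finset.range m, volume.real (cap K (p i) (p (i + 1))) := by
    refine measureReal_biUnion_finset ?_ (fun i _ => measurableSet_cap hK _ _)
      (fun i _ => cap_ne_top hK _ _)
    have key : ∀ i j, i < j → j < m → Disjoint (cap K (p i) (p (i + 1))) (cap K (p j) (p (j + 1))) := by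
      intro i j hij hj
      rw [Set.disjoint_left]
      rintro x ⟨hx, hxi⟩ ⟨-, hxj⟩
      exact not_lt.2 (h.caps_disjoint hK hm hij hj hx hxi) hxj
    intro i hi j hj hij
    simp only [Finset.coe_range, Set.mem_Iio] at hi hj
    rcases lt_or_gt_of_ne hij with hlt | hgt
    · exact key i j hlt hj
    · exact (key j i hgt hi).symm
  -- Inside a cap, the disk over its side confines `Q` to the segment.
  have hsub : Q ⊆ (K \ C) ∪ ⋃ i ∈ Finset.range m, discSegment (p i) (p (i + 1)) := by
    intro x hx
    by_cases hxC : x ∈ C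
    · right
      simp only [hC, Set.mem_iUnion] at hxC ⊢
      obtain ⟨i, hi, hxi⟩ := hxC
      exact ⟨i, hi, hQ x hx i (Finset.mem_range.1 hi), hxi.2⟩
    · exact Or.inl ⟨hQK hx, hxC⟩
  have hsegtop : volume (⋃ i ∈ Finset.range m, discSegment (p i) (p (i + 1))) ≠ ⊤ := by
    refine ((measure_biUnion_finset_le _ _).trans_lt (ENNReal.sum_lt_top.2 fun i hi => ?_)).ne
    have hi := Finset.mem_range.1 hi
    rw [discSegment, volume_segment (h.side_ne hm hi) (hdiam _ (hF i hi.le) _ (hF _ hi))]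
    exact ENNReal.ofReal_lt_top
  calc volume.real Q
      ≤ volume.real ((K \ C) ∪ ⋃ i ∈ Finset.range m, discSegment (p i) (p (i + 1))) :=
        measureReal_mono hsub (measure_union_ne_top
          ((measure_mono Set.sdiff_subset).trans_lt hKtop.lt_top).ne hsegtop)
    _ ≤ volume.real (K \ C) + volume.real (⋃ i ∈ Finset.range m, discSegment (p i) (p (i + 1))) :=
        measureReal_union_le _ _
    _ ≤ volume.real (K \ C) + ∑ i ∈ Finset.range m, volume.real (discSegment (p i) (p (i + 1))) := by
        gcongr
        exact measureReal_biUnion_finset_le _ _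
    _ = volume.real K - ∑ i ∈ Finset.range m, capLoss K (p i) (p (i + 1)) := by
        rw [measureReal_sdiff hCK hCm, hCv]
        unfold capLoss
        rw [Finset.sum_sub_distrib]
        have : ∑ i ∈ Finset.range m, volume.real (discSegment (p i) (p (i + 1)))
            = ∑ i ∈ Finset.range m, segArea (sqDist (p i) (p (i + 1))) :=
          Finset.sum_congr rfl fun i hi => volume_discSegment
            (h.side_ne hm (Finset.mem_range.1 hi))
            (hdiam _ (hF i (Finset.mem_range.1 hi).le) _ (hF _ (Finset.mem_range.1 hi)))
        rw [this]; ring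

end IsInscribedSeq

theorem exists_pos_add_smul_mem {K : Set Plane} {x : Plane} (hx : x ∈ interior K) (u : Plane) :
    ∃ ε : ℝ, 0 < ε ∧ x + ε • u ∈ K := by
  have hc : Continuous fun ε : ℝ => x + ε • u := by fun_prop
  have h : ∀ᶠ ε in nhds (0 : ℝ), x + ε • u ∈ K := by
    apply hc.continuousAt.eventually
    simpa using mem_interior_iff_mem_nhds.1 hx
  have h' : ∀ᶠ ε in nhdsWithin (0 : ℝ) (Set.Ioi 0), x + ε • u ∈ K := nhdsWithin_le_nhds h
  obtain ⟨ε, h1, h2⟩ := (h'.and self_mem_nhdsWithin).exists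
  exact ⟨ε, h2, h1⟩

/-- An interior point of `K` on the unit circle through the endpoints of a chord lies beyond the
chord. -/
theorem orient_neg_of_interior {K : Set Plane} (hK : IsSpindleConvexDisk K) {a c x : Plane}
    (ha : a ∈ frontier K) (hc : c ∈ frontier K) (hne : a ≠ c) (hL : sqDist a c ≤ 4)
    (hx : x ∈ interior K) (hxo : sqDist x (arcCenter a c) = 1) : orient a c x < 0 := by
  by_contra hcon
  push Not at hcon
  set o := arcCenter a c
  -- The sense along the chord in which the distance from `o` grows. A short move that way stays in
  -- `K` on the same side of the chord but leaves the disk.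
  obtain ⟨σ, hσ, hσ'⟩ : ∃ σ : ℝ, σ ^ 2 = 1 ∧
      0 ≤ σ * ((x 0 - o 0) * (c 0 - a 0) + (x 1 - o 1) * (c 1 - a 1)) := by
    rcases le_total 0 ((x 0 - o 0) * (c 0 - a 0) + (x 1 - o 1) * (c 1 - a 1)) with h | h
    · exact ⟨1, by norm_num, by linarith⟩
    · exact ⟨-1, by norm_num, by linarith⟩
  obtain ⟨ε, hε, hy⟩ := exists_pos_add_smul_mem hx (σ • (c - a))
  have h1 : orient a c (x + ε • σ • (c - a)) = orient a c x := by
    unfold orient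
    simp only [PiLp.add_apply, PiLp.smul_apply, PiLp.sub_apply, smul_eq_mul]
    ring
  have h2 := sqDist_arcCenter_le hK ha hc hne hL hy (by rw [h1]; exact hcon)
  have h3 : sqDist (x + ε • σ • (c - a)) o = sqDist x o
      + 2 * (ε * (σ * ((x 0 - o 0) * (c 0 - a 0) + (x 1 - o 1) * (c 1 - a 1))))
      + ε ^ 2 * (σ ^ 2 * sqDist a c) := by
    unfold sqDist
    simp only [PiLp.add_apply, PiLp.smul_apply, PiLp.sub_apply, smul_eq_mul]
    ring
  change sqDist (x + ε • σ • (c - a)) o ≤ 1 at h2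
  rw [h3, hσ, hxo] at h2
  have := sqDist_pos hne
  have h4 : 0 < ε ^ 2 * (1 * sqDist a c) := by positivity
  have h5 := mul_nonneg hε.le hσ'
  linarith

open MeasureTheory in
/-- The disk-polygon of an inscribed polygon is inscribed, and misses at most the sum of the losses
of the sides. -/
theorem IsInscribedSeq.exists_isInscribedDiskPolygon {K : Set Plane} {m : ℕ} {p : ℕ → Plane}
    (h : IsInscribedSeq K m p) (hK : IsSpindleConvexDisk K)
    (hdiam : ∀ x ∈ K, ∀ y ∈ K, sqDist x y < 4) (hm : 3 ≤ m) :
    ∃ c : Fin m → Plane, IsInscribedDiskPolygon c K ∧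
      volume.real K - ∑ i ∈ Finset.range m, capLoss K (p i) (p (i + 1))
        ≤ volume.real (diskPolygon c) := by
  have hF : ∀ i, i ≤ m → p i ∈ K := fun i hi => hK.frontier_subset (h.mem_of_le hm hi)
  have hL : ∀ i, i < m → sqDist (p i) (p (i + 1)) < 4 := fun i hi =>
    hdiam _ (hF i hi.le) _ (hF _ hi)
  have hsegK : ∀ i, i < m → discSegment (p i) (p (i + 1)) ⊆ K := fun i hi x hx =>
    hK.spindle_subset _ (hF i hi.le) _ (hF _ hi)
      (mem_spindle_of_segment (h.side_ne hm hi) (hL i hi) hx.1 (le_of_lt hx.2))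
  set c : Fin m → Plane := fun i => arcCenter (p i) (p (i + 1)) with hc
  have hQK : diskPolygon c ⊆ K := by
    intro x hx
    rw [mem_diskPolygon_iff] at hx
    by_cases hall : ∀ i < m, 0 ≤ orient (p i) (p (i + 1)) x
    · exact h.mem_of_side_nonneg hK hm hall
    · push Not at hall
      obtain ⟨i, hi, hxi⟩ := hall
      exact hsegK i hi ⟨hx ⟨i, hi⟩, hxi⟩
  refine ⟨c, ⟨hQK, ?_⟩, ?_⟩
  · rintro x ⟨hxQ, i, j, hij, hxi, hxj⟩
    by_contra hcon
    have hxK := hQK hxQ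
    have hxint : x ∈ interior K := by
      rw [hK.isCompact.isClosed.frontier_eq] at hcon
      by_contra hni
      exact hcon ⟨hxK, hni⟩
    -- A vertex in the interior of `K` would lie in two different caps, which are disjoint.
    have key : ∀ i : Fin m, dist x (c i) = 1 → orient (p i) (p (i + 1)) x < 0 := fun i hi =>
      orient_neg_of_interior hK (h.mem_of_le hm i.2.le) (h.mem_of_le hm i.2) (h.side_ne hm i.2)
        (hL i i.2).le hxint (dist_eq_one_iff.1 hi)
    have hij' : (i : ℕ) ≠ j := fun he => hij (by rw [Fin.ext he])
    rcases lt_or_gt_of_ne hij' with hlt | hgt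
    · exact not_lt.2 (h.caps_disjoint hK hm hlt j.2 hxK (key i hxi)) (key j hxj)
    · exact not_lt.2 (h.caps_disjoint hK hm hgt i.2 hxK (key j hxj)) (key i hxi)
  · have hKtop : volume K ≠ ⊤ := hK.isCompact.measure_lt_top.ne
    have hdiff : ∀ i < m, volume.real (cap K (p i) (p (i + 1)) \ discSegment (p i) (p (i + 1)))
        = capLoss K (p i) (p (i + 1)) := by
      intro i hi
      have hss : discSegment (p i) (p (i + 1)) ⊆ cap K (p i) (p (i + 1)) :=
        fun x hx => ⟨hsegK i hi hx, hx.2⟩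
      rw [measureReal_sdiff hss (measurableSet_discSegment _ _) (cap_ne_top hK _ _), volume_discSegment (h.side_ne hm hi) (hL i hi), capLoss]
    have hsub : K ⊆ diskPolygon c ∪ ⋃ i ∈ Finset.range m,
        (cap K (p i) (p (i + 1)) \ discSegment (p i) (p (i + 1))) := by
      intro x hx
      by_cases hxQ : x ∈ diskPolygon c
      · exact Or.inl hxQ
      · right
        rw [mem_diskPolygon_iff] at hxQ
        push Not at hxQ
        obtain ⟨i, hi⟩ := hxQ
        simp only [Set.mem_iUnion]
        refine ⟨i, Finset.mem_range.2 i.2, ⟨hx, ?_⟩, fun hs => not_lt.2 hs.1 hi⟩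
        by_contra hcon
        exact not_lt.2 (sqDist_arcCenter_le hK (h.mem_of_le hm i.2.le) (h.mem_of_le hm i.2)
          (h.side_ne hm i.2) (hL i i.2).le hx (not_lt.1 hcon)) hi
    have htop : volume (diskPolygon c ∪ ⋃ i ∈ Finset.range m,
        (cap K (p i) (p (i + 1)) \ discSegment (p i) (p (i + 1)))) ≠ ⊤ := by
      refine ((measure_mono (t := K) (Set.union_subset hQK (Set.iUnion₂_subset fun i _ => ?_))).trans_lt
        hKtop.lt_top).ne
      exact Set.sdiff_subset.trans Set.inter_subset_left
    have h1 : volume.real K ≤ _ := measureReal_mono hsub htop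
    have h2 := measureReal_union_le (μ := volume) (diskPolygon c) (⋃ i ∈ Finset.range m,
        (cap K (p i) (p (i + 1)) \ discSegment (p i) (p (i + 1))))
    have h3 := measureReal_biUnion_finset_le (μ := volume) (Finset.range m)
      (fun i => cap K (p i) (p (i + 1)) \ discSegment (p i) (p (i + 1)))
    rw [Finset.sum_congr rfl fun i hi => hdiff i (Finset.mem_range.1 hi)] at h3
    linarith

/-! ### A disk-polygon is covered by the unit hull of its side starts -/

/-- The intersection of all unit disks that contain `S`. -/
def unitHull (S : Set Plane) : Set Plane :=
  {x | ∀ o : Plane, (∀ s ∈ S, sqDist s o ≤ 1) → sqDist x o ≤ 1}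

/-- On the open half circle around the direction `d`, the component perpendicular to `d` increases
with the angle. So an extremum of a linear form finds the ends of a side. -/
theorem cross_nonneg_of_le {u0 u1 v0 v1 d0 d1 : ℝ} (hu : u0 ^ 2 + u1 ^ 2 = 1)
    (hv : v0 ^ 2 + v1 ^ 2 = 1) (hud : 0 < u0 * d0 + u1 * d1) (hvd : 0 < v0 * d0 + v1 * d1)
    (h : d0 * u1 - d1 * u0 ≤ d0 * v1 - d1 * v0) : 0 ≤ u0 * v1 - u1 * v0 := by
  have e1 : (u0 * d0 + u1 * d1) ^ 2 + (d0 * u1 - d1 * u0) ^ 2 = d0 ^ 2 + d1 ^ 2 := by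
    linear_combination (d0 ^ 2 + d1 ^ 2) * hu
  have e2 : (v0 * d0 + v1 * d1) ^ 2 + (d0 * v1 - d1 * v0) ^ 2 = d0 ^ 2 + d1 ^ 2 := by
    linear_combination (d0 ^ 2 + d1 ^ 2) * hv
  have e3 : (u0 * v1 - u1 * v0) * (d0 ^ 2 + d1 ^ 2)
      = (u0 * d0 + u1 * d1) * (d0 * v1 - d1 * v0) - (d0 * u1 - d1 * u0) * (v0 * d0 + v1 * d1) := by
    ring
  generalize u0 * d0 + u1 * d1 = a at *
  generalize v0 * d0 + v1 * d1 = a' at *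
  generalize d0 * u1 - d1 * u0 = b at *
  generalize d0 * v1 - d1 * v0 = b' at *
  have hd : 0 < d0 ^ 2 + d1 ^ 2 := by nlinarith [sq_nonneg b]
  refine nonneg_of_mul_nonneg_left ?_ hd
  rw [e3]
  rcases le_or_gt 0 b with hb | hb
  · have : a' ≤ a := abs_le_of_sq_le_sq' (by nlinarith) hud.le |>.2
    nlinarith
  · rcases le_or_gt 0 b' with hb' | hb'
    · nlinarith
    · have : a ≤ a' := abs_le_of_sq_le_sq' (by nlinarith) hvd.le |>.2
      nlinarith

theorem eq_of_cross_eq_zero {u0 u1 v0 v1 d0 d1 : ℝ} (hu : u0 ^ 2 + u1 ^ 2 = 1)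
    (hv : v0 ^ 2 + v1 ^ 2 = 1) (hud : 0 < u0 * d0 + u1 * d1) (hvd : 0 < v0 * d0 + v1 * d1)
    (h : u0 * v1 - u1 * v0 = 0) : u0 = v0 ∧ u1 = v1 := by
  set s := u0 * v0 + u1 * v1 with hs
  have e0 : v0 = s * u0 := by rw [hs]; linear_combination -v0 * hu - u1 * h
  have e1 : v1 = s * u1 := by rw [hs]; linear_combination -v1 * hu + u0 * h
  have hs2 : s ^ 2 = 1 := by
    have : s ^ 2 = (u0 ^ 2 + u1 ^ 2) * (v0 ^ 2 + v1 ^ 2) - (u0 * v1 - u1 * v0) ^ 2 := by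
      rw [hs]; ring
    rw [this, hu, hv, h]; norm_num
  have hs0 : 0 < s := by
    have : v0 * d0 + v1 * d1 = s * (u0 * d0 + u1 * d1) := by
      linear_combination d0 * e0 + d1 * e1
    rw [this] at hvd
    exact pos_of_mul_pos_left hvd hud.le
  have : s = 1 := by nlinarith
  rw [this] at e0 e1
  constructor <;> linarith

/-- A point of a unit arc lies in every unit disk that contains the endpoints of the arc. -/
theorem sqDist_le_of_between {c p q x o : Plane} {d0 d1 : ℝ} (hp : sqDist p c = 1)
    (hq : sqDist q c = 1) (hx : sqDist x c = 1)
    (hpd : 0 < (p 0 - c 0) * d0 + (p 1 - c 1) * d1) (hqd : 0 < (q 0 - c 0) * d0 + (q 1 - c 1) * d1)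
    (hxd : 0 < (x 0 - c 0) * d0 + (x 1 - c 1) * d1) (hpx : 0 ≤ orient c p x)
    (hxq : 0 ≤ orient c x q) (hpo : sqDist p o ≤ 1) (hqo : sqDist q o ≤ 1) : sqDist x o ≤ 1 := by
  have hpl : ((x 0 - c 0) * d0 + (x 1 - c 1) * d1) * orient c p q
      = ((p 0 - c 0) * d0 + (p 1 - c 1) * d1) * orient c x q
        + ((q 0 - c 0) * d0 + (q 1 - c 1) * d1) * orient c p x := by unfold orient; ring
  have hpq : 0 ≤ orient c p q := by
    refine nonneg_of_mul_nonneg_right ?_ hxd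
    rw [hpl]; positivity
  rcases hpq.eq_or_lt with h0 | hpos
  · rw [← h0, mul_zero] at hpl
    have : orient c p x = 0 := by nlinarith [mul_nonneg hpd.le hxq]
    obtain ⟨h1, h2⟩ := eq_of_cross_eq_zero (u0 := p 0 - c 0) (u1 := p 1 - c 1) (v0 := x 0 - c 0)
      (v1 := x 1 - c 1) hp hx hpd hxd this
    have : p = x := plane_ext (by linarith) (by linarith)
    rwa [← this]
  · set lam := ((x 0 - c 0) * (q 1 - c 1) - (x 1 - c 1) * (q 0 - c 0)) / orient c p q with hlam
    set mu := ((p 0 - c 0) * (x 1 - c 1) - (p 1 - c 1) * (x 0 - c 0)) / orient c p q with hmu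
    have hx0 : x 0 - c 0 = lam * (p 0 - c 0) + mu * (q 0 - c 0) := cramer_fst hpos.ne' rfl
    have hx1 : x 1 - c 1 = lam * (p 1 - c 1) + mu * (q 1 - c 1) := cramer_snd hpos.ne' rfl
    have hlam0 : 0 ≤ lam := div_nonneg hxq hpos.le
    have hmu0 : 0 ≤ mu := div_nonneg hpx hpos.le
    have hsum : 1 ≤ lam + mu := by
      have e : sqDist x c = lam ^ 2 * sqDist p c + mu ^ 2 * sqDist q c
          + lam * mu * (sqDist p c + sqDist q c - sqDist p q) := by
        have : sqDist x c = (x 0 - c 0) ^ 2 + (x 1 - c 1) ^ 2 := rfl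
        rw [this, hx0, hx1]; unfold sqDist; ring
      rw [hx, hp, hq] at e
      have := mul_nonneg (mul_nonneg hlam0 hmu0) (sqDist_nonneg p q)
      nlinarith
    have ep : sqDist p o = sqDist p c + sqDist c o
        + 2 * ((p 0 - c 0) * (c 0 - o 0) + (p 1 - c 1) * (c 1 - o 1)) := by unfold sqDist; ring
    have eq : sqDist q o = sqDist q c + sqDist c o
        + 2 * ((q 0 - c 0) * (c 0 - o 0) + (q 1 - c 1) * (c 1 - o 1)) := by unfold sqDist; ring
    have ex : sqDist x o = sqDist x c + sqDist c o
        + (lam * (2 * ((p 0 - c 0) * (c 0 - o 0) + (p 1 - c 1) * (c 1 - o 1)))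
        + mu * (2 * ((q 0 - c 0) * (c 0 - o 0) + (q 1 - c 1) * (c 1 - o 1)))) := by
      have : sqDist x o = sqDist x c + sqDist c o
        + 2 * ((x 0 - c 0) * (c 0 - o 0) + (x 1 - c 1) * (c 1 - o 1)) := by unfold sqDist; ring
      rw [this, hx0, hx1]; ring
    have hc := sqDist_nonneg c o
    nlinarith [mul_nonneg hlam0 (sub_nonneg.2 hpo), mul_nonneg hmu0 (sub_nonneg.2 hqo)]

section Polygon

variable {n : ℕ} {c : Fin n → Plane}

/-- The part of the boundary of a disk-polygon on the circle with index `i`. -/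
def polygonSide (c : Fin n → Plane) (i : Fin n) : Set Plane :=
  {x | x ∈ diskPolygon c ∧ sqDist x (c i) = 1}

theorem continuous_sqDist (o : Plane) : Continuous fun x => sqDist x o := by
  unfold sqDist; fun_prop

theorem isCompact_diskPolygon (i : Fin n) : IsCompact (diskPolygon c) := by
  refine (isCompact_closedBall (c i) 1).of_isClosed_subset ?_ (Set.iInter_subset _ i)
  exact isClosed_iInter fun i => Metric.isClosed_closedBall

theorem isCompact_polygonSide (i : Fin n) : IsCompact (polygonSide c i) :=
  (isCompact_diskPolygon i).inter_right (isClosed_eq (continuous_sqDist _) continuous_const)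

/-- A point on circle `i` and in disk `j` is at least as near to `c j` as to `c i`. So a side lies
in an open half circle, and its start and end make sense. -/
theorem polygonSide_halfplane {i j : Fin n} (hij : c i ≠ c j) {x : Plane}
    (hx : x ∈ polygonSide c i) :
    0 < (x 0 - c i 0) * (c j 0 - c i 0) + (x 1 - c i 1) * (c j 1 - c i 1) := by
  have h1 := mem_diskPolygon_iff.1 hx.1 j
  have h2 := hx.2
  have h3 := sqDist_pos hij
  unfold sqDist at *
  nlinarith

theorem exists_side_start {i j : Fin n} (hij : c i ≠ c j) (hne : (polygonSide c i).Nonempty) :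
    ∃ p ∈ polygonSide c i, ∀ x ∈ polygonSide c i, 0 ≤ orient (c i) p x := by
  obtain ⟨p, hp, hmin⟩ := (isCompact_polygonSide i).exists_isMinOn hne
    (f := fun x => (c j 0 - c i 0) * (x 1 - c i 1) - (c j 1 - c i 1) * (x 0 - c i 0)) (by fun_prop)
  exact ⟨p, hp, fun x hx => cross_nonneg_of_le hp.2 hx.2 (polygonSide_halfplane hij hp)
    (polygonSide_halfplane hij hx) (hmin hx)⟩

theorem exists_side_end {i j : Fin n} (hij : c i ≠ c j) (hne : (polygonSide c i).Nonempty) :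
    ∃ p ∈ polygonSide c i, ∀ x ∈ polygonSide c i, 0 ≤ orient (c i) x p := by
  obtain ⟨p, hp, hmax⟩ := (isCompact_polygonSide i).exists_isMaxOn hne
    (f := fun x => (c j 0 - c i 0) * (x 1 - c i 1) - (c j 1 - c i 1) * (x 0 - c i 0)) (by fun_prop)
  exact ⟨p, hp, fun x hx => cross_nonneg_of_le hx.2 hp.2 (polygonSide_halfplane hij hx)
    (polygonSide_halfplane hij hp) (hmax hx)⟩

/-- At the end of a side, another circle passes whose normal is further on. -/
theorem exists_next_side {i : Fin n} {e : Plane} (he : e ∈ polygonSide c i)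
    (hend : ∀ x ∈ polygonSide c i, 0 ≤ orient (c i) x e) :
    ∃ j, c j ≠ c i ∧ sqDist e (c j) = 1 ∧
      0 ≤ (e 0 - c i 0) * (e 1 - c j 1) - (e 1 - c i 1) * (e 0 - c j 0) := by
  by_contra hcon
  push Not at hcon
  set u0 := e 0 - c i 0 with hu0
  set u1 := e 1 - c i 1 with hu1
  have hu : u0 ^ 2 + u1 ^ 2 = 1 := he.2
  -- The point `e` rotated about `c i`, with `t` the tangent of half the angle. If no other circle
  -- stops it, it stays in the polygon for small positive `t`, beyond the end of the side.
  let g : ℝ → Plane := fun t => !₂[c i 0 + ((1 - t ^ 2) * u0 - 2 * t * u1) / (1 + t ^ 2),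
    c i 1 + ((1 - t ^ 2) * u1 + 2 * t * u0) / (1 + t ^ 2)]
  have g0 : ∀ t, g t 0 = c i 0 + ((1 - t ^ 2) * u0 - 2 * t * u1) / (1 + t ^ 2) := fun t => by
    simp [g]
  have g1 : ∀ t, g t 1 = c i 1 + ((1 - t ^ 2) * u1 + 2 * t * u0) / (1 + t ^ 2) := fun t => by
    simp [g]
  have hpos : ∀ t : ℝ, 0 < 1 + t ^ 2 := fun t => by positivity
  have hgi : ∀ t, sqDist (g t) (c i) = 1 := by
    intro t
    have := hpos t
    unfold sqDist
    rw [g0, g1]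
    field_simp
    linear_combination (1 + t ^ 2) ^ 2 * hu
  have hev : ∀ᶠ t in nhdsWithin (0 : ℝ) (Set.Ioi 0), ∀ j, sqDist (g t) (c j) ≤ 1 := by
    rw [Filter.eventually_all]
    intro j
    by_cases hji : c j = c i
    · exact Filter.Eventually.of_forall fun t => by rw [hji, hgi]
    set v0 := e 0 - c j 0 with hv0
    set v1 := e 1 - c j 1 with hv1
    have hform : ∀ t, sqDist (g t) (c j) = sqDist e (c j)
        + 4 * t / (1 + t ^ 2) * (t * (1 - (u0 * v0 + u1 * v1)) + (u0 * v1 - u1 * v0)) := by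
      intro t
      have := hpos t
      have a0 : g t 0 - c j 0 = v0 + (-2 * t ^ 2 * u0 - 2 * t * u1) / (1 + t ^ 2) := by
        rw [g0, hv0, hu0]; field_simp; ring
      have a1 : g t 1 - c j 1 = v1 + (-2 * t ^ 2 * u1 + 2 * t * u0) / (1 + t ^ 2) := by
        rw [g1, hv1, hu1]; field_simp; ring
      have : sqDist (g t) (c j) = (g t 0 - c j 0) ^ 2 + (g t 1 - c j 1) ^ 2 := rfl
      rw [this, a0, a1]
      have : sqDist e (c j) = v0 ^ 2 + v1 ^ 2 := rfl
      rw [this]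
      field_simp
      linear_combination (4 * t ^ 4 + 4 * t ^ 2) * hu
    have h1 := mem_diskPolygon_iff.1 he.1 j
    rcases h1.eq_or_lt with h1 | h1
    · have hdet := hcon j hji h1
      have : ∀ᶠ t in nhds (0 : ℝ), t * (1 - (u0 * v0 + u1 * v1)) + (u0 * v1 - u1 * v0) < 0 := by
        have hc : Continuous fun t : ℝ => t * (1 - (u0 * v0 + u1 * v1)) + (u0 * v1 - u1 * v0) := by
          fun_prop
        exact hc.continuousAt.eventually_lt continuousAt_const (by simpa using hdet)
      filter_upwards [nhdsWithin_le_nhds this, self_mem_nhdsWithin] with t ht ht0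
      have ht0 : 0 < t := ht0
      rw [hform, h1]
      have : 0 < 4 * t / (1 + t ^ 2) := by positivity
      nlinarith
    · have : ∀ᶠ t in nhds (0 : ℝ), sqDist (g t) (c j) < 1 := by
        have hc : Continuous fun t : ℝ => sqDist (g t) (c j) := by
          simp_rw [hform]
          have : ∀ t : ℝ, 1 + t ^ 2 ≠ 0 := fun t => (hpos t).ne'
          fun_prop (disch := assumption)
        exact hc.continuousAt.eventually_lt continuousAt_const (by simpa [hform] using h1)
      exact nhdsWithin_le_nhds (this.mono fun t ht => ht.le)
  obtain ⟨t, ht, ht0⟩ := (hev.and self_mem_nhdsWithin).exists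
  have ht0 : 0 < t := ht0
  have := hend (g t) ⟨mem_diskPolygon_iff.2 ht, hgi t⟩
  have e2 : orient (c i) (g t) e = -(2 * t / (1 + t ^ 2)) := by
    have := hpos t
    unfold orient
    rw [g0, g1, ← hu0, ← hu1]
    field_simp
    linear_combination (-2 * t) * hu
  rw [e2] at this
  have h3 : 0 < 2 * t / (1 + t ^ 2) := by positivity
  linarith

/-- `u` and `v` are the radii at the end `e` of a side on its own and on the next circle, `w` the
radius at the start of the side on the next circle. By `hin` the start lies in the first disk, which
forces `v × w` to be nonnegative, so it is not before `e`. If `u` and `v` are parallel, the disks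
touch at `e` and the intersection is a point. -/
theorem next_cross_eq_zero {u0 u1 v0 v1 w0 w1 : ℝ} (hu : u0 ^ 2 + u1 ^ 2 = 1)
    (hv : v0 ^ 2 + v1 ^ 2 = 1) (hw : w0 ^ 2 + w1 ^ 2 = 1)
    (hin : (w0 - v0 + u0) ^ 2 + (w1 - v1 + u1) ^ 2 ≤ 1) (hwv : 0 ≤ w0 * v1 - w1 * v0)
    (huv : 0 ≤ u0 * v1 - u1 * v0) (hne : u0 = v0 → u1 = v1 → False) :
    w0 * v1 - w1 * v0 = 0 := by
  rcases huv.eq_or_lt with h0 | hpos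
  · set s := u0 * v0 + u1 * v1 with hs
    have e0 : v0 = s * u0 := by rw [hs]; linear_combination -v0 * hu + u1 * h0
    have e1 : v1 = s * u1 := by rw [hs]; linear_combination -v1 * hu - u0 * h0
    have hs2 : (s - 1) * (s + 1) = 0 := by
      have : s ^ 2 * (u0 ^ 2 + u1 ^ 2) = 1 := by
        calc _ = (s * u0) ^ 2 + (s * u1) ^ 2 := by ring
          _ = 1 := by rw [← e0, ← e1]; exact hv
      rw [hu] at this
      linear_combination this
    rcases mul_eq_zero.1 hs2 with h | h
    · have hs1 : s = 1 := by linarith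
      rw [hs1] at e0 e1
      exact (hne (by linarith) (by linarith)).elim
    · have hs1 : s = -1 := by linarith
      rw [hs1] at e0 e1
      have f0 : v0 = -u0 := by linarith
      have f1 : v1 = -u1 := by linarith
      clear_value s
      subst f0 f1
      have hz : (w0 + u0) ^ 2 + (w1 + u1) ^ 2 ≤ 0 := by linarith
      have z0 : w0 + u0 = 0 := by nlinarith [sq_nonneg (w0 + u0), sq_nonneg (w1 + u1)]
      have z1 : w1 + u1 = 0 := by nlinarith [sq_nonneg (w0 + u0), sq_nonneg (w1 + u1)]
      linear_combination u0 * z1 - u1 * z0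
  · have e : u0 * w0 + u1 * w1 = (v0 * u0 + v1 * u1) * (v0 * w0 + v1 * w1)
        - (u0 * v1 - u1 * v0) * (v0 * w1 - v1 * w0) := by
      linear_combination -(u0 * w0 + u1 * w1) * hv
    have key : (1 - (v0 * w0 + v1 * w1)) * (1 - (v0 * u0 + v1 * u1))
        ≤ (u0 * v1 - u1 * v0) * (v0 * w1 - v1 * w0) := by
      linarith
    have h1 : v0 * w0 + v1 * w1 ≤ 1 := by
      linarith [sq_nonneg (v0 - w0), sq_nonneg (v1 - w1)]
    have h2 : v0 * u0 + v1 * u1 ≤ 1 := by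
      linarith [sq_nonneg (v0 - u0), sq_nonneg (v1 - u1)]
    have h3 : 0 ≤ v0 * w1 - v1 * w0 := by
      refine nonneg_of_mul_nonneg_right ((mul_nonneg ?_ ?_).trans key) hpos <;> linarith
    linarith

/-- The side on the next circle starts where the previous one ends. -/
theorem side_start_eq {i j : Fin n} {e p : Plane} (hij : c j ≠ c i) (he : e ∈ polygonSide c i)
    (hej : sqDist e (c j) = 1)
    (hdet : 0 ≤ (e 0 - c i 0) * (e 1 - c j 1) - (e 1 - c i 1) * (e 0 - c j 0))
    (hp : p ∈ polygonSide c j) (hstart : ∀ x ∈ polygonSide c j, 0 ≤ orient (c j) p x) : p = e := by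
  have hesj : e ∈ polygonSide c j := ⟨he.1, hej⟩
  have hpe := hstart e hesj
  have hp1 := polygonSide_halfplane hij hp
  have he1 := polygonSide_halfplane hij hesj
  have hpi := mem_diskPolygon_iff.1 hp.1 i
  have hei := he.2
  have hpj := hp.2
  set u0 := e 0 - c i 0 with hu0
  set u1 := e 1 - c i 1 with hu1
  set v0 := e 0 - c j 0 with hv0
  set v1 := e 1 - c j 1 with hv1
  set w0 := p 0 - c j 0 with hw0
  set w1 := p 1 - c j 1 with hw1
  have hu : u0 ^ 2 + u1 ^ 2 = 1 := hei
  have hv : v0 ^ 2 + v1 ^ 2 = 1 := hej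
  have hw : w0 ^ 2 + w1 ^ 2 = 1 := hpj
  have hpi' : (w0 - v0 + u0) ^ 2 + (w1 - v1 + u1) ^ 2 ≤ 1 := by
    have : sqDist p (c i) = (w0 - v0 + u0) ^ 2 + (w1 - v1 + u1) ^ 2 := by
      rw [hw0, hw1, hv0, hv1, hu0, hu1]; unfold sqDist; ring
    linarith
  have hpe' : 0 ≤ w0 * v1 - w1 * v0 := hpe
  have hfin := next_cross_eq_zero hu hv hw hpi' hpe' hdet (fun h0 h1 => hij
    (plane_ext (by linarith) (by linarith)))
  obtain ⟨h1, h2⟩ := eq_of_cross_eq_zero hw hv hp1 he1 hfin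
  exact plane_ext (by linarith) (by linarith)

/-- A disk-polygon with `n` sides is contained in the unit hull of `n` of its points. -/
theorem exists_points_unitHull (hne : ∃ i j, c i ≠ c j) (hQ : (diskPolygon c).Nonempty) :
    ∃ p : Fin n → Plane, (∀ i, p i ∈ diskPolygon c) ∧
      diskPolygon c ⊆ unitHull (Set.range p) := by
  have hother : ∀ i, ∃ j, c i ≠ c j := by
    intro i
    obtain ⟨j, k, hjk⟩ := hne
    by_contra h
    push Not at h
    exact hjk ((h j).symm.trans (h k))
  have hstart : ∀ i, ∃ p ∈ diskPolygon c, (polygonSide c i).Nonempty →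
      p ∈ polygonSide c i ∧ ∀ x ∈ polygonSide c i, 0 ≤ orient (c i) p x := by
    intro i
    by_cases h : (polygonSide c i).Nonempty
    · obtain ⟨j, hj⟩ := hother i
      obtain ⟨p, hp, hp'⟩ := exists_side_start hj h
      exact ⟨p, hp.1, fun _ => ⟨hp, hp'⟩⟩
    -- A circle that carries no side gets an arbitrary point of the polygon.
    · obtain ⟨x, hx⟩ := hQ
      exact ⟨x, hx, fun h' => absurd h' h⟩
  choose p hpQ hp using hstart
  refine ⟨p, hpQ, fun x hx o ho => ?_⟩
  have ho : ∀ i, sqDist (p i) o ≤ 1 := fun i => ho _ ⟨i, rfl⟩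
  -- Each side runs from its chosen start to the chosen start of a next side, so the starts alone
  -- control it.
  have hside : ∀ i, ∀ x ∈ polygonSide c i, sqDist x o ≤ 1 := by
    intro i x hx
    obtain ⟨j, hj⟩ := hother i
    obtain ⟨e, he, hend⟩ := exists_side_end hj ⟨x, hx⟩
    obtain ⟨k, hk, hek, hdet⟩ := exists_next_side he hend
    obtain ⟨hpk, hpk'⟩ := hp k ⟨e, he.1, hek⟩
    have hpe := side_start_eq hk he hek hdet hpk hpk'
    obtain ⟨hpi, hpi'⟩ := hp i ⟨x, hx⟩
    exact sqDist_le_of_between hpi.2 he.2 hx.2 (polygonSide_halfplane hj hpi)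
      (polygonSide_halfplane hj he) (polygonSide_halfplane hj hx) (hpi' x hx) (hend x hx) (ho i)
      (hpe ▸ ho k)
  obtain ⟨i₀, -⟩ := hne
  -- The farthest point from `o`: if it were on no side, it could move further away from `o`.
  obtain ⟨y, hy, hmax⟩ := (isCompact_diskPolygon (c := c) i₀).exists_isMaxOn hQ
    (continuous_sqDist o).continuousOn
  refine (hmax hx).trans ?_
  by_contra hcon
  push Not at hcon
  have hlt : ∀ i, sqDist y (c i) < 1 := by
    intro i
    refine lt_of_le_of_ne (mem_diskPolygon_iff.1 hy i) fun h => ?_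
    exact not_lt.2 (hside i y ⟨hy, h⟩) hcon
  have hev : ∀ᶠ t in nhds (0 : ℝ), ∀ i, sqDist (y + t • (y - o)) (c i) < 1 := by
    rw [Filter.eventually_all]
    intro i
    have hc : Continuous fun t : ℝ => sqDist (y + t • (y - o)) (c i) :=
      (continuous_sqDist (c i)).comp (by fun_prop)
    exact hc.continuousAt.eventually_lt continuousAt_const (by simpa using hlt i)
  have hev' : ∀ᶠ t in nhdsWithin (0 : ℝ) (Set.Ioi 0), ∀ i, sqDist (y + t • (y - o)) (c i) < 1 :=
    nhdsWithin_le_nhds hev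
  obtain ⟨t, ht, ht0⟩ := (hev'.and self_mem_nhdsWithin).exists
  have ht0 : 0 < t := ht0
  have h1 := hmax (mem_diskPolygon_iff.2 fun i => (ht i).le)
  have h2 : sqDist (y + t • (y - o)) o = (1 + t) ^ 2 * sqDist y o := by
    unfold sqDist
    simp only [PiLp.add_apply, PiLp.smul_apply, PiLp.sub_apply, smul_eq_mul]
    ring
  have h1 : sqDist (y + t • (y - o)) o ≤ sqDist y o := h1
  rw [h2] at h1
  nlinarith [mul_pos ht0 (show 0 < sqDist y o by linarith),
    mul_nonneg (sq_nonneg t) (show 0 ≤ sqDist y o by linarith)]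

end Polygon

/-! ### Enlarging a point set until it is stuck on the boundary -/

/-- A linear form that separates `x` from `K` has its maximum on `K` at some `y`; the supporting
unit disk at `y` contains `K` but not `x`. -/
theorem unitHull_subset {K : Set Plane} (hK : IsSpindleConvexDisk K) {S : Set Plane} (hS : S ⊆ K) :
    unitHull S ⊆ K := by
  intro x hx
  by_contra hxK
  obtain ⟨f, u, hfK, hfx⟩ := geometric_hahn_banach_closed_point hK.convex hK.isCompact.isClosed hxK
  obtain ⟨y, hy, hmax⟩ := hK.isCompact.exists_isMaxOn (hK.nonempty_interior.mono interior_subset)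
    f.continuous.continuousOn
  have hf : f ≠ 0 := by
    rintro rfl
    have := hfK y hy
    simp at this hfx
    linarith
  obtain ⟨n, hn, r, hr, hz⟩ := exists_isUnitNormal_of_linear f hf (fun x hx => hmax hx)
  have hball : ∀ q : Plane, sqDist q (y - n)
      = sqDist q y + 2 * (n 0 * (q 0 - y 0) + n 1 * (q 1 - y 1)) + 1 := by
    intro q
    rw [← hn.1]
    unfold sqDist
    simp only [PiLp.sub_apply]
    ring
  have h1 := hx (y - n) fun s hs => by
    rw [hball]
    linarith [hn.sqDist_le hK hy (hS hs)]
  rw [hball] at h1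
  have h2 : n 0 * (x 0 - y 0) + n 1 * (x 1 - y 1) = r * (f x - f y) := by
    have e : n 0 * (x 0 - y 0) + n 1 * (x 1 - y 1) = dotp n x - dotp n y := by unfold dotp; ring
    rw [e, hz, hz]; ring
  have h3 : 0 < r * (f x - f y) := mul_pos hr (by linarith [hfK y hy])
  have := sqDist_nonneg x y
  linarith

theorem unitHull_subset_unitHull {S P : Set Plane}
    (h : ∀ o, (∀ s ∈ P, sqDist s o ≤ 1) → ∀ s ∈ S, sqDist s o ≤ 1) : unitHull S ⊆ unitHull P :=
  fun _ hx o ho => hx o (h o ho)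

/-- Scaling up a set scales up its unit hull at least as much. -/
theorem smul_add_mem_unitHull {S S' : Set Plane} {l : ℝ} {t : Plane} (hl : 1 ≤ l)
    (hS : ∀ s ∈ S, l • s + t ∈ S') {x : Plane} (hx : x ∈ unitHull S) :
    l • x + t ∈ unitHull S' := by
  intro o ho
  have hl0 : 0 < l := by linarith
  have key : ∀ q : Plane, dist q (l⁻¹ • (o - t)) = l⁻¹ * dist (l • q + t) o := by
    intro q
    have e : q - l⁻¹ • (o - t) = l⁻¹ • (l • q + t - o) := by
      rw [smul_sub, smul_sub, smul_add, smul_smul, inv_mul_cancel₀ hl0.ne', one_smul]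
      abel
    rw [dist_eq_norm, dist_eq_norm, e, norm_smul, Real.norm_eq_abs, abs_of_pos (inv_pos.2 hl0)]
  rw [← dist_le_one_iff]
  by_contra hcon
  push Not at hcon
  set y := l⁻¹ • (o - t) with hy
  have hxy : l⁻¹ < dist x y := by
    rw [key]
    nlinarith [inv_pos.2 hl0]
  have hd : 0 < dist x y := (inv_pos.2 hl0).trans hxy
  have hl1 : l⁻¹ ≤ 1 := inv_le_one_of_one_le₀ hl
  -- The preimage of the disk about `o` has radius `l⁻¹` and center `y`. Shifting the center away
  -- from `x` by `1 - l⁻¹` gives a unit disk that still contains it, but not `x`.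
  set k := (1 - l⁻¹) / dist x y with hk
  have hk0 : 0 ≤ k := div_nonneg (by linarith) hd.le
  have hkd : k * dist x y = 1 - l⁻¹ := div_mul_cancel₀ _ hd.ne'
  have h1 := hx (y - k • (x - y)) fun s hs => by
    rw [← dist_le_one_iff]
    have h2 : dist s y ≤ l⁻¹ := by
      rw [key]
      have := dist_le_one_iff.2 (ho _ (hS s hs))
      nlinarith [inv_pos.2 hl0]
    have h3 : dist y (y - k • (x - y)) = 1 - l⁻¹ := by
      rw [dist_eq_norm, sub_sub_cancel, norm_smul, Real.norm_eq_abs, abs_of_nonneg hk0,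
        ← dist_eq_norm, hkd]
    calc dist s (y - k • (x - y)) ≤ dist s y + dist y (y - k • (x - y)) := dist_triangle _ _ _
      _ ≤ 1 := by rw [h3]; linarith
  rw [← dist_le_one_iff] at h1
  have h4 : dist x (y - k • (x - y)) = (1 + k) * dist x y := by
    rw [dist_eq_norm, dist_eq_norm, show x - (y - k • (x - y)) = (1 + k) • (x - y) by
      rw [add_smul, one_smul]; abel, norm_smul, Real.norm_eq_abs, abs_of_pos (by linarith)]
  rw [h4] at h1
  linarith

/-- A direction that makes an obtuse angle with all normals at a point points into the interior. -/
theorem eventually_mem_interior {K : Set Plane} (hK : IsSpindleConvexDisk K) {s z : Plane}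
    (hs : s ∈ K) (h : s ∈ frontier K → ∀ n, IsUnitNormal K n s → dotp n z < 0) :
    ∀ᶠ ε in nhdsWithin (0 : ℝ) (Set.Ioi 0), s + ε • z ∈ interior K := by
  by_cases hex : ∃ ε : ℝ, 0 < ε ∧ s + ε • z ∈ interior K
  · obtain ⟨ε, hε, hin⟩ := hex
    filter_upwards [Ioo_mem_nhdsGT hε] with r hr
    apply hK.convex.openSegment_self_interior_subset_interior hs hin
    refine ⟨1 - r / ε, r / ε, ?_, div_pos hr.1 hε, by ring, ?_⟩
    · rw [sub_pos, div_lt_one hε]; exact hr.2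
    · rw [smul_add, smul_smul, div_mul_cancel₀ _ hε.ne', ← add_assoc, ← add_smul]
      simp
  · exfalso
    push Not at hex
    -- If the open ray misses the interior, a separating form has its maximum on `K` at `s` and does
    -- not decrease along `z`; its normal contradicts `h`.
    have hray : Convex ℝ ((fun ε : ℝ => s + ε • z) '' Set.Ioi 0) := by
      have : (fun ε : ℝ => s + ε • z) = fun ε => AffineMap.lineMap (k := ℝ) s (s + z) ε := by
        ext ε : 1
        rw [AffineMap.lineMap_apply]
        simp [add_comm]
      rw [this]
      exact (convex_Ioi (0 : ℝ)).affine_image (AffineMap.lineMap (k := ℝ) s (s + z))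
    have hdis : Disjoint (interior K) ((fun ε : ℝ => s + ε • z) '' Set.Ioi 0) := by
      rw [Set.disjoint_left]
      rintro _ hx ⟨ε, hε, rfl⟩
      exact hex ε hε hx
    obtain ⟨f, u, hfK, hfr⟩ := geometric_hahn_banach_open hK.convex.interior isOpen_interior hray hdis
    have hle : ∀ x ∈ K, f x ≤ u := by
      intro x hx
      have : closure (interior K) ⊆ {x | f x ≤ u} :=
        closure_minimal (fun x hx => (hfK x hx).le) (isClosed_le f.continuous continuous_const)
      exact this (hK.subset_closure_interior hx)
    have hr : ∀ ε : ℝ, 0 < ε → u ≤ f s + ε * f z := by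
      intro ε hε
      have := hfr _ ⟨ε, hε, rfl⟩
      simpa using this
    have hfs : f s = u := by
      refine le_antisymm (hle s hs) ?_
      have hc : Filter.Tendsto (fun ε : ℝ => f s + ε * f z) (nhdsWithin 0 (Set.Ioi 0))
          (nhds (f s + 0 * f z)) := by
        have : Continuous fun ε : ℝ => f s + ε * f z := by fun_prop
        exact (this.tendsto 0).mono_left nhdsWithin_le_nhds
      have := ge_of_tendsto hc (b := u) (by
        filter_upwards [self_mem_nhdsWithin] with ε hε using hr ε hε)
      simpa using this
    have hf : f ≠ 0 := by
      rintro rfl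
      obtain ⟨x, hx⟩ := hK.nonempty_interior
      have := hfK x hx
      simp at this hfs
      linarith
    obtain ⟨n, hn, r, hr0, hz⟩ := exists_isUnitNormal_of_linear f hf
      (fun x hx => by rw [hfs]; exact hle x hx)
    have hsF : s ∈ frontier K := by
      rw [hK.isCompact.isClosed.frontier_eq]
      exact ⟨hs, fun hsi => (hfK s hsi).ne hfs⟩
    have h1 := h hsF n hn
    rw [hz] at h1
    have h2 := hr 1 one_pos
    have : 0 ≤ f z := by linarith
    have := mul_nonneg hr0.le this
    linarith

theorem infinite_frontier {K : Set Plane} (hK : IsSpindleConvexDisk K) : (frontier K).Infinite := by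
  obtain ⟨h, -, -, hF⟩ := exists_homeomorph_image_interior_closure_frontier_eq_unitBall hK.convex
    hK.nonempty_interior hK.isCompact.isBounded
  have hsph : (Metric.sphere (0 : Plane) 1).Infinite := by
    apply IsPreconnected.infinite_of_nontrivial
    · apply isPreconnected_sphere
      rw [← Module.finrank_eq_rank, finrank_euclideanSpace]
      simp
    · obtain ⟨x, hx⟩ := (NormedSpace.sphere_nonempty (E := Plane) (x := 0) (r := 1)).2 zero_le_one
      have hx' : ‖x‖ = 1 := by simpa using hx
      refine ⟨x, hx, -x, by simpa using hx', fun heq => ?_⟩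
      have : x = 0 := by
        have h0 := congrArg (fun v : Plane => v 0) heq
        have h1 := congrArg (fun v : Plane => v 1) heq
        simp only [PiLp.neg_apply] at h0 h1
        exact plane_ext (by rw [PiLp.zero_apply]; linarith) (by rw [PiLp.zero_apply]; linarith)
      rw [this] at hx'
      simp at hx'
  rw [← hF] at hsph
  exact hsph.of_image _

/-- Among the enlarged translates of a finite set in `K`, a largest one cannot be moved into the
interior of `K`. -/
theorem exists_maximal_enlargement {K : Set Plane} (hK : IsSpindleConvexDisk K) (S : Finset Plane)
    (hSK : ∀ s ∈ S, s ∈ K) {x y : Plane} (hx : x ∈ S) (hy : y ∈ S) (hxy : x ≠ y) :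
    ∃ (l : ℝ) (t : Plane), 1 ≤ l ∧ (∀ s ∈ S, l • s + t ∈ K) ∧
      ∀ z, ∃ s ∈ S, l • s + t + z ∉ interior K := by
  set T : Set (ℝ × Plane) := {q | 1 ≤ q.1 ∧ ∀ s ∈ S, q.1 • s + q.2 ∈ K} with hT
  have hTc : IsClosed T := by
    have : T = {q | 1 ≤ q.1} ∩ ⋂ s ∈ S, {q : ℝ × Plane | q.1 • s + q.2 ∈ K} := by
      ext q; simp [hT]
    rw [this]
    refine (isClosed_le continuous_const continuous_fst).inter (isClosed_biInter fun s _ => ?_)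
    exact hK.isCompact.isClosed.preimage (by fun_prop : Continuous fun q : ℝ × Plane => q.1 • s + q.2)
  obtain ⟨R, hR⟩ := hK.isCompact.isBounded.exists_norm_le
  have hd : 0 < ‖x - y‖ := norm_pos_iff.2 (sub_ne_zero.2 hxy)
  -- The two distinct points `x` and `y` bound the factor, and then the translation.
  have hTK : IsCompact T := by
    refine IsCompact.of_isClosed_subset ((isCompact_Icc (a := (1 : ℝ)) (b := 2 * R / ‖x - y‖)).prod
      (isCompact_closedBall (0 : Plane) (R + 2 * R / ‖x - y‖ * ‖x‖))) hTc ?_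
    rintro ⟨l, t⟩ ⟨hl, hq⟩
    simp only at hl hq
    have h1 := hR _ (hq x hx)
    have h2 := hR _ (hq y hy)
    have h3 : l * ‖x - y‖ ≤ 2 * R := by
      calc l * ‖x - y‖ = ‖(l • x + t) - (l • y + t)‖ := by
            rw [add_sub_add_right_eq_sub, ← smul_sub, norm_smul, Real.norm_eq_abs,
              abs_of_pos (by linarith)]
        _ ≤ 2 * R := (norm_sub_le _ _).trans (by linarith)
    have h4 : l ≤ 2 * R / ‖x - y‖ := by rwa [le_div_iff₀ hd]
    refine ⟨⟨hl, h4⟩, ?_⟩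
    rw [mem_closedBall_zero_iff]
    calc ‖t‖ = ‖(l • x + t) - l • x‖ := by rw [add_sub_cancel_left]
      _ ≤ ‖l • x + t‖ + ‖l • x‖ := norm_sub_le _ _
      _ ≤ R + 2 * R / ‖x - y‖ * ‖x‖ := by
          rw [norm_smul, Real.norm_eq_abs, abs_of_pos (by linarith)]
          gcongr
  obtain ⟨⟨l, t⟩, ⟨hl, hq⟩, hmax⟩ := hTK.exists_isMaxOn
    (⟨(1, 0), le_rfl, fun s hs => by simpa using hSK s hs⟩ : T.Nonempty) continuous_fst.continuousOn
  simp only at hl hq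
  refine ⟨l, t, hl, hq, fun z => ?_⟩
  by_contra hcon
  push Not at hcon
  -- A translate in the interior leaves room for a larger factor, against the maximality of `l`.
  have hev : ∀ᶠ ε in nhds (0 : ℝ), ∀ s ∈ S, (l + ε) • s + (t + z) ∈ interior K := by
    rw [Filter.eventually_all_finset]
    intro s hs
    have hc : Continuous fun ε : ℝ => (l + ε) • s + (t + z) := by fun_prop
    exact hc.continuousAt.eventually (isOpen_interior.mem_nhds (by
      simpa [add_assoc] using hcon s hs))
  have hev' : ∀ᶠ ε in nhdsWithin (0 : ℝ) (Set.Ioi 0),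
      ∀ s ∈ S, (l + ε) • s + (t + z) ∈ interior K := nhdsWithin_le_nhds hev
  obtain ⟨ε, h1, h2⟩ := (hev'.and self_mem_nhdsWithin).exists
  have h2 : 0 < ε := h2
  have h3 : ((l + ε, t + z) : ℝ × Plane) ∈ T :=
    ⟨by simp only; linarith, fun s hs => interior_subset (h1 s hs)⟩
  have h4 : l + ε ≤ l := hmax h3
  linarith

/-- A point of `K` can be pushed from a base point to the boundary of `K`. -/
theorem exists_push {K : Set Plane} (hK : IsSpindleConvexDisk K) {s₀ s : Plane}
    (hs₀ : s₀ ∈ frontier K) (hs : s ∈ K) :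
    ∃ q ∈ frontier K, (s ∈ frontier K → q = s) ∧
      ∀ o, sqDist s₀ o ≤ 1 → sqDist q o ≤ 1 → sqDist s o ≤ 1 := by
  by_cases hsF : s ∈ frontier K
  · exact ⟨s, hsF, fun _ => rfl, fun o _ h => h⟩
  have hne : s ≠ s₀ := fun h => hsF (h ▸ hs₀)
  obtain ⟨R, hR⟩ := hK.isCompact.isBounded.exists_norm_le
  have hd : 0 < ‖s - s₀‖ := norm_pos_iff.2 (sub_ne_zero.2 hne)
  have hcomp : IsCompact {τ : ℝ | 1 ≤ τ ∧ s₀ + τ • (s - s₀) ∈ K} := by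
    refine (isCompact_Icc (a := (1 : ℝ)) (b := (R + ‖s₀‖) / ‖s - s₀‖)).of_isClosed_subset ?_ ?_
    · exact (isClosed_le continuous_const continuous_id).inter
        (hK.isCompact.isClosed.preimage (by fun_prop : Continuous fun τ : ℝ => s₀ + τ • (s - s₀)))
    · rintro τ ⟨h1, h2⟩
      refine ⟨h1, ?_⟩
      rw [le_div_iff₀ hd]
      calc τ * ‖s - s₀‖ = ‖(s₀ + τ • (s - s₀)) - s₀‖ := by
            rw [add_sub_cancel_left, norm_smul, Real.norm_eq_abs, abs_of_pos (by linarith)]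
        _ ≤ ‖s₀ + τ • (s - s₀)‖ + ‖s₀‖ := norm_sub_le _ _
        _ ≤ R + ‖s₀‖ := by gcongr; exact hR _ h2
  obtain ⟨τ, ⟨hτ, hq⟩, hmax⟩ := hcomp.exists_isMaxOn
    (⟨1, le_rfl, by simpa using hs⟩ : Set.Nonempty {τ : ℝ | 1 ≤ τ ∧ s₀ + τ • (s - s₀) ∈ K})
    continuous_id.continuousOn
  have hτ0 : 0 < τ := by linarith
  refine ⟨s₀ + τ • (s - s₀), ?_, fun h => absurd h hsF, fun o h1 h2 => ?_⟩
  · rw [hK.isCompact.isClosed.frontier_eq]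
    refine ⟨hq, fun hqi => ?_⟩
    obtain ⟨ε, hε, hin⟩ := exists_pos_add_smul_mem hqi (s - s₀)
    have hmem : τ + ε ∈ {τ : ℝ | 1 ≤ τ ∧ s₀ + τ • (s - s₀) ∈ K} :=
      ⟨by linarith, by rw [add_smul, ← add_assoc]; exact hin⟩
    have : τ + ε ≤ τ := hmax hmem
    linarith
  -- `s` is between `s₀` and its pushed image, and unit disks are convex.
  · have h3 : s ∈ segment ℝ s₀ (s₀ + τ • (s - s₀)) := by
      refine ⟨1 - τ⁻¹, τ⁻¹, ?_, by positivity, by ring, ?_⟩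
      · rw [sub_nonneg]; exact inv_le_one_of_one_le₀ hτ
      · rw [smul_add, smul_smul, inv_mul_cancel₀ hτ0.ne', one_smul, ← add_assoc, ← add_smul]
        simp
    exact mem_unitBall_iff.1 ((convex_closedBall o 1).segment_subset (mem_unitBall_iff.2 h1)
      (mem_unitBall_iff.2 h2) h3)

open MeasureTheory in
/-- A finite set in `K` is dominated by a set of boundary points that admits no direction into the
interior of `K`. -/
theorem exists_stuck_boundary_set {K : Set Plane} (hK : IsSpindleConvexDisk K) (S : Finset Plane)
    (hSK : ∀ s ∈ S, s ∈ K) {x y : Plane} (hx : x ∈ S) (hy : y ∈ S) (hxy : x ≠ y) {m : ℕ}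
    (hm : S.card ≤ m) :
    ∃ P : Finset Plane, P.card = m ∧ (∀ s ∈ P, s ∈ frontier K) ∧
      volume.real (unitHull (S : Set Plane)) ≤ volume.real (unitHull (P : Set Plane)) ∧
      ∀ z : Plane, ∃ s ∈ P, ∃ n, IsUnitNormal K n s ∧ 0 ≤ dotp n z := by
  classical
  obtain ⟨l, t, hl, hlt, hstuck⟩ := exists_maximal_enlargement hK S hSK hx hy hxy
  have hl0 : l ≠ 0 := by linarith
  have hnormal : ∀ z : Plane, ∃ s ∈ S, l • s + t ∈ frontier K ∧
      ∃ n, IsUnitNormal K n (l • s + t) ∧ 0 ≤ dotp n z := by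
    intro z
    by_contra hcon
    push Not at hcon
    have hev : ∀ᶠ ε in nhdsWithin (0 : ℝ) (Set.Ioi 0), ∀ s ∈ S, l • s + t + ε • z ∈ interior K := by
      rw [Filter.eventually_all_finset]
      intro s hs
      exact eventually_mem_interior hK (hlt s hs) (hcon s hs)
    obtain ⟨ε, hε⟩ := hev.exists
    obtain ⟨s, hs, hs'⟩ := hstuck (ε • z)
    exact hs' (hε s hs)
  -- The zero direction merely provides one image on the boundary, the base point of all pushes.
  obtain ⟨s₀, hs₀, hs₀F, -⟩ := hnormal 0
  have hpush : ∀ s : Plane, ∃ q, s ∈ S → q ∈ frontier K ∧ (l • s + t ∈ frontier K → q = l • s + t) ∧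
      ∀ o, sqDist (l • s₀ + t) o ≤ 1 → sqDist q o ≤ 1 → sqDist (l • s + t) o ≤ 1 := by
    intro s
    by_cases hs : s ∈ S
    · obtain ⟨q, h1, h2, h3⟩ := exists_push hK hs₀F (hlt s hs)
      exact ⟨q, fun _ => ⟨h1, h2, h3⟩⟩
    · exact ⟨0, fun h => absurd h hs⟩
  choose π hπ using hpush
  -- Further boundary points bring the number to exactly `m`; they only enlarge the unit hull and
  -- keep the set stuck.
  obtain ⟨P, hP1, hP2, hP3⟩ := (infinite_frontier hK).exists_superset_ncard_eq
    (s := ((S.image π : Finset Plane) : Set Plane)) (by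
      intro q hq
      obtain ⟨s, hs, rfl⟩ := Finset.mem_image.1 (Finset.mem_coe.1 hq)
      exact (hπ s hs).1) (Finset.finite_toSet _) (k := m) (by
      rw [Set.ncard_coe_finset]
      exact Finset.card_image_le.trans hm)
  have hm0 : 0 < m := lt_of_lt_of_le (Finset.card_pos.2 ⟨x, hx⟩) hm
  have hPfin : P.Finite := Set.finite_of_ncard_pos (by omega)
  have hπP : ∀ s ∈ S, π s ∈ P := fun s hs => hP1 (Finset.mem_coe.2 (Finset.mem_image_of_mem π hs))
  refine ⟨hPfin.toFinset, ?_, ?_, ?_, ?_⟩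
  · rw [← hP3, Set.ncard_eq_toFinset_card P hPfin]
  · intro s hs
    exact hP2 (hPfin.mem_toFinset.1 hs)
  · rw [hPfin.coe_toFinset]
    have htop : volume (unitHull P) ≠ ⊤ := ((measure_mono (unitHull_subset hK
      (hP2.trans hK.frontier_subset))).trans_lt hK.isCompact.measure_lt_top).ne
    rw [measureReal_def, measureReal_def]
    refine ENNReal.toReal_mono htop ?_
    have hsub : unitHull (S : Set Plane)
        ⊆ (fun x : Plane => l • x) ⁻¹' ((fun x => x + t) ⁻¹' unitHull P) := by
      intro q hq
      have h1 : l • q + t ∈ unitHull ((fun s => l • s + t) '' (S : Set Plane)) :=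
        smul_add_mem_unitHull hl (fun s hs => Set.mem_image_of_mem (fun s => l • s + t) hs) hq
      refine unitHull_subset_unitHull (fun o ho s' hs' => ?_) h1
      obtain ⟨s, hs, rfl⟩ := hs'
      have hs : s ∈ S := hs
      refine (hπ s hs).2.2 o ?_ (ho _ (hπP s hs))
      rw [← (hπ s₀ hs₀).2.1 hs₀F]
      exact ho _ (hπP s₀ hs₀)
    refine (measure_mono hsub).trans ?_
    rw [Measure.addHaar_preimage_smul volume hl0, measure_preimage_add_right]
    refine mul_le_of_le_one_left (zero_le) ?_
    rw [ENNReal.ofReal_le_one, abs_of_nonneg (by positivity)]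
    exact inv_le_one_of_one_le₀ (one_le_pow₀ hl)
  · intro z
    obtain ⟨s, hs, hsF, n, hn, hz⟩ := hnormal z
    refine ⟨l • s + t, hPfin.mem_toFinset.2 ?_, n, hn, hz⟩
    rw [← (hπ s hs).2.1 hsF]
    exact hπP s hs

/-! ### The cyclic order of the boundary -/

/-- A function that orders the boundary of `K` counterclockwise, starting at `p₀`. -/
structure IsBoundaryKey (K : Set Plane) (p₀ : Plane) (key : Plane → ℝ) : Prop where
  inj : Set.InjOn key (frontier K)
  min : ∀ x ∈ frontier K, key p₀ ≤ key x
  ccw : ∀ x ∈ frontier K, ∀ y ∈ frontier K, ∀ z ∈ frontier K,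
    key x < key y → key y < key z → 0 < orient x y z

/-- Points that are collinear with a boundary point coincide. -/
theorem eq_of_orient_eq_zero {K : Set Plane} (hK : IsSpindleConvexDisk K) {a x y : Plane}
    (ha : a ∈ frontier K) (hx : x ∈ frontier K) (hy : y ∈ frontier K) (hxa : x ≠ a) (hya : y ≠ a)
    (h : orient a x y = 0) : x = y := by
  by_contra hxy
  obtain ⟨n, hn⟩ := exists_strict_normal hK ha
  have hX := hn x (hK.frontier_subset hx) hxa
  have hY := hn y (hK.frontier_subset hy) hya
  set X := n 0 * (x 0 - a 0) + n 1 * (x 1 - a 1) with hXd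
  set Y := n 0 * (y 0 - a 0) + n 1 * (y 1 - a 1) with hYd
  have e0 : Y * (x 0 - a 0) = X * (y 0 - a 0) := by
    rw [hXd, hYd]; unfold orient at h; linear_combination n 1 * h
  have e1 : Y * (x 1 - a 1) = X * (y 1 - a 1) := by
    rw [hXd, hYd]; unfold orient at h; linear_combination -n 0 * h
  have hxK := hK.frontier_subset hx
  have hyK := hK.frontier_subset hy
  have haK := hK.frontier_subset ha
  rcases le_total X Y with hle | hle
  · refine no_barycenter hK hy hxK haK haK (r := -Y) (s := Y - X) (t := 0) (by linarith)
      (by linarith) le_rfl hxy ?_ ?_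
    · linear_combination -e0
    · linear_combination -e1
  · refine no_barycenter hK hx hyK haK haK (r := -X) (s := X - Y) (t := 0) (by linarith)
      (by linarith) le_rfl (Ne.symm hxy) ?_ ?_
    · linear_combination e0
    · linear_combination e1

/-- Otherwise `y` would be a convex combination of `x`, `z` and `a`. -/
theorem orient_pos_of_fan {K : Set Plane} (hK : IsSpindleConvexDisk K) {a x y z : Plane}
    (ha : a ∈ frontier K) (hx : x ∈ frontier K) (hy : y ∈ frontier K) (hz : z ∈ frontier K)
    (hxy : 0 < orient a x y) (hyz : 0 < orient a y z) :
    0 < orient x y z := by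
  by_contra h
  push Not at h
  refine no_barycenter hK hy (hK.frontier_subset hx) (hK.frontier_subset hz)
    (hK.frontier_subset ha) (r := orient a y z) (s := orient a x y) (t := -orient x y z) hyz hxy.le
    (by linarith) (ne_of_orient_ne_zero hxy.ne').2.2.symm ?_ ?_ <;> unfold orient <;> ring

/-- The key is the angle at which a point is seen from `p₀`. A strict normal puts all other points
into an open half-plane, so this angle is an arctangent and determines the point. -/
theorem exists_isBoundaryKey {K : Set Plane} (hK : IsSpindleConvexDisk K) {p₀ : Plane}
    (hp : p₀ ∈ frontier K) : ∃ key, IsBoundaryKey K p₀ key := by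
  classical
  obtain ⟨n, hn⟩ := exists_strict_normal hK hp
  set u : Plane → ℝ := fun x => -(n 0 * (x 0 - p₀ 0) + n 1 * (x 1 - p₀ 1)) with hu
  set c : Plane → ℝ := fun x => n 0 * (x 1 - p₀ 1) - n 1 * (x 0 - p₀ 0) with hc
  have hu0 : ∀ x ∈ frontier K, x ≠ p₀ → 0 < u x := fun x hx hne => by
    have := hn x (hK.frontier_subset hx) hne
    simp only [hu]; linarith
  set key : Plane → ℝ := fun x => if x = p₀ then -2 else Real.arctan (-(c x / u x)) with hkey
  have hkp : key p₀ = -2 := by simp [hkey]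
  have hkx : ∀ x, x ≠ p₀ → key x = Real.arctan (-(c x / u x)) := fun x hx => by simp [hkey, hx]
  have hlow : ∀ x, x ≠ p₀ → -2 < key x := fun x hx => by
    rw [hkx x hx]
    linarith [Real.neg_pi_div_two_lt_arctan (-(c x / u x)), Real.pi_lt_four]
  have horient : ∀ x y, (n 0 ^ 2 + n 1 ^ 2) * orient p₀ x y = c x * u y - c y * u x := by
    intro x y
    simp only [hu, hc]; unfold orient; ring
  have hn0 : ∀ x ∈ frontier K, x ≠ p₀ → 0 < n 0 ^ 2 + n 1 ^ 2 := by
    intro x hx hne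
    by_contra hcon
    have h0 : n 0 = 0 := by nlinarith [sq_nonneg (n 0), sq_nonneg (n 1)]
    have h1 : n 1 = 0 := by nlinarith [sq_nonneg (n 0), sq_nonneg (n 1)]
    have := hu0 x hx hne
    simp [hu, h0, h1] at this
  have hlt : ∀ x ∈ frontier K, ∀ y ∈ frontier K, x ≠ p₀ → y ≠ p₀ → key x < key y →
      0 < orient p₀ x y := by
    intro x hx y hy hxp hyp h
    rw [hkx x hxp, hkx y hyp, Real.arctan_strictMono.lt_iff_lt, neg_lt_neg_iff,
      div_lt_div_iff₀ (hu0 y hy hyp) (hu0 x hx hxp)] at h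
    have := horient x y
    exact pos_of_mul_pos_right (by linarith) (hn0 x hx hxp).le
  have hmin : ∀ x ∈ frontier K, key p₀ ≤ key x := by
    intro x _
    rcases eq_or_ne x p₀ with rfl | h
    · exact le_rfl
    · rw [hkp]; exact (hlow x h).le
  have hne : ∀ x ∈ frontier K, ∀ y, key x < key y → y ≠ p₀ := by
    rintro x hx y h rfl
    exact (hmin x hx).not_gt h
  refine ⟨key, ?_, hmin, ?_⟩
  · intro x hx y hy hxy
    by_cases hxp : x = p₀
    · by_contra hne
      have := hlow y (fun h => hne (hxp.trans h.symm))
      rw [← hxy, hxp, hkp] at this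
      exact lt_irrefl _ this
    by_cases hyp : y = p₀
    · have := hlow x hxp
      rw [hxy, hyp, hkp] at this
      exact absurd this (lt_irrefl _)
    refine eq_of_orient_eq_zero hK hp hx hy hxp hyp ?_
    rw [hkx x hxp, hkx y hyp] at hxy
    have h := neg_injective (Real.arctan_injective hxy)
    rw [div_eq_div_iff (hu0 x hx hxp).ne' (hu0 y hy hyp).ne'] at h
    have := horient x y
    rw [h, sub_self] at this
    exact (mul_eq_zero.1 this).resolve_left (hn0 x hx hxp).ne'
  · intro x hx y hy z hz hxy hyz
    have hyp := hne x hx y hxy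
    have hzp := hne y hy z hyz
    by_cases hxp : x = p₀
    · rw [hxp]; exact hlt y hy z hz hyp hzp hyz
    · exact orient_pos_of_fan hK hp hx hy hz (hlt x hx y hy hxp hyp hxy) (hlt y hy z hz hyp hzp hyz)

/-- A closed polygon whose vertices run once along the boundary of `K`, in the order of `key`. -/
structure IsKeyedSeq (K : Set Plane) (key : Plane → ℝ) (m : ℕ) (p : ℕ → Plane) : Prop where
  mem : ∀ i < m, p i ∈ frontier K
  closed : p m = p 0
  step : ∀ i, i + 1 < m → key (p i) < key (p (i + 1))

namespace IsKeyedSeq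

variable {K : Set Plane} {key : Plane → ℝ} {m : ℕ} {p q : ℕ → Plane}

theorem lt (h : IsKeyedSeq K key m p) {i j : ℕ} (hij : i < j) (hj : j < m) :
    key (p i) < key (p j) := by
  induction j, hij using Nat.le_induction with
  | base => exact h.step i hj
  | succ j _ ih => exact (ih (by omega)).trans (h.step j hj)

theorem le (h : IsKeyedSeq K key m p) {i j : ℕ} (hij : i ≤ j) (hj : j < m) :
    key (p i) ≤ key (p j) := by
  rcases hij.eq_or_lt with rfl | hij
  · exact le_rfl
  · exact (h.lt hij hj).le

theorem isInscribedSeq {p₀ : Plane} (h : IsKeyedSeq K key m p) (hk : IsBoundaryKey K p₀ key) :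
    IsInscribedSeq K m p where
  mem := h.mem
  closed := h.closed
  ccw i j k hij hjk hkm := hk.ccw _ (h.mem i (by omega)) _ (h.mem j (by omega)) _ (h.mem k hkm)
    (h.lt hij (by omega)) (h.lt hjk hkm)

end IsKeyedSeq

/-- A finite set of boundary points can be enumerated in the order of the boundary. -/
theorem exists_isKeyedSeq {K : Set Plane} {p₀ : Plane} {key : Plane → ℝ}
    (hk : IsBoundaryKey K p₀ key) {P : Finset Plane} (hP : ∀ s ∈ P, s ∈ frontier K) :
    ∃ p : ℕ → Plane, IsKeyedSeq K key P.card p ∧ ∀ s, s ∈ P ↔ ∃ i < P.card, p i = s := by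
  classical
  have hcard : (P.image key).card = P.card :=
    Finset.card_image_of_injOn fun x hx y hy => hk.inj (hP x hx) (hP y hy)
  set e := (P.image key).orderEmbOfFin hcard with he
  have hpre : ∀ i : Fin P.card, ∃ s ∈ P, key s = e i := fun i =>
    Finset.mem_image.1 (Finset.orderEmbOfFin_mem _ hcard i)
  choose s hsP hs using hpre
  rcases Nat.eq_zero_or_pos P.card with h0 | hpos
  · rw [Finset.card_eq_zero] at h0
    subst h0
    exact ⟨fun _ => 0, ⟨by simp, rfl, by simp⟩, by simp⟩
  -- The default value makes the polygon close at index `P.card`.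
  set p : ℕ → Plane := fun i => if h : i < P.card then s ⟨i, h⟩ else s ⟨0, hpos⟩ with hp
  have hpi : ∀ i (h : i < P.card), p i = s ⟨i, h⟩ := fun i h => by simp [hp, h]
  refine ⟨p, ⟨fun i hi => ?_, ?_, fun i hi => ?_⟩, fun t => ⟨fun ht => ?_, ?_⟩⟩
  · rw [hpi i hi]; exact hP _ (hsP _)
  · rw [hpi 0 hpos]; simp [hp]
  · rw [hpi i (by omega), hpi _ hi, hs, hs]
    exact e.strictMono (by simp)
  · have : key t ∈ Set.range e := by
      rw [he, Finset.range_orderEmbOfFin]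
      exact Finset.mem_coe.2 (Finset.mem_image_of_mem key ht)
    obtain ⟨i, hi⟩ := this
    exact ⟨i, i.2, by rw [hpi i i.2]; exact hk.inj (hP _ (hsP _)) (hP _ ht) (by rw [hs]; exact hi)⟩
  · rintro ⟨i, hi, rfl⟩
    rw [hpi i hi]; exact hsP _

/-- The quadrangle inequality for `capLoss`, in terms of the order on the boundary. -/
theorem IsBoundaryKey.capLoss_quadrangle {K : Set Plane} {p₀ : Plane} {key : Plane → ℝ}
    (hk : IsBoundaryKey K p₀ key) (hK : IsSpindleConvexDisk K)
    (hdiam : ∀ x ∈ K, ∀ y ∈ K, sqDist x y < 4) {a b c d : Plane} {P : Set Plane}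
    (hp₀ : p₀ ∈ frontier K) (ha : a ∈ frontier K) (hb : b ∈ frontier K) (hc : c ∈ frontier K)
    (hd : d ∈ frontier K) (hab : key a ≤ key b) (hbc : key b < key c)
    (hcd : key c < key d ∨ d = p₀ ∧ key p₀ < key a)
    (hP : ∀ s ∈ P, s ∈ frontier K ∧ (key s ≤ key a ∨ key c < key d ∧ key d ≤ key s))
    (hstuck : ∀ z : Plane, ∃ s ∈ P, ∃ n, IsUnitNormal K n s ∧ 0 ≤ dotp n z) :
    capLoss K a c + capLoss K b d ≤ capLoss K a d + capLoss K b c := by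
  rcases hab.eq_or_lt with hab | hab
  · rw [hk.inj ha hb hab, add_comm]
  -- `d` follows `c` either in the key order or, as the closing vertex `p₀`, after all other points
  -- although its key is least.
  have hthird : ∀ x ∈ frontier K, ∀ y ∈ frontier K, key x < key y → key y ≤ key c →
      x = d ∨ 0 < orient x y d := by
    intro x hx y hy hxy hyc
    rcases hcd with hcd | ⟨rfl, -⟩
    · exact Or.inr (hk.ccw x hx y hy d hd hxy (hyc.trans_lt hcd))
    · rcases (hk.min x hx).eq_or_lt with h | h
      · exact Or.inl (hk.inj hd hx h).symm
      · right
        rw [orient_rotate]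
        exact hk.ccw _ hd _ hx _ hy h hxy
  have had : a ≠ d := by
    rintro rfl
    rcases hcd with hcd | ⟨rfl, h⟩
    · linarith
    · exact lt_irrefl _ h
  have hbd : b ≠ d := by
    rintro rfl
    rcases hcd with hcd | ⟨rfl, h⟩ <;> linarith
  refine _root_.capLoss_quadrangle hK hdiam ha hb hc hd (hk.ccw a ha b hb c hc hab hbc)
    ((hthird a ha b hb hab hbc.le).resolve_left had)
    ((hthird a ha c hc (hab.trans hbc) le_rfl).resolve_left had)
    ((hthird b hb c hc hbc le_rfl).resolve_left hbd) (fun s hs => ?_) hstuck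
  obtain ⟨hsF, h | ⟨hcd', h⟩⟩ := hP s hs
  · refine ⟨hsF, ?_, hk.ccw s hsF b hb c hc (by linarith) hbc,
      hthird s hsF c hc (by linarith) le_rfl⟩
    rcases h.eq_or_lt with h | h
    · exact Or.inl (hk.inj hsF ha h)
    · exact Or.inr (hk.ccw s hsF a ha b hb h hab)
  · refine ⟨hsF, Or.inr ?_, ?_, ?_⟩
    · rw [← orient_rotate]; exact hk.ccw a ha b hb s hsF hab (by linarith)
    · rw [← orient_rotate]; exact hk.ccw b hb c hc s hsF hbc (by linarith)
    · rcases h.eq_or_lt with h | h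
      · exact Or.inl (hk.inj hsF hd h.symm)
      · right
        rw [← orient_rotate]; exact hk.ccw c hc d hd s hsF hcd' h

/-! ### Uncrossing two polygons -/

/-- The sequence `p` with the terms of `q` at the places `u + 1, …, u + 1 + v` put in. -/
def spliceIn {α : Type*} (p q : ℕ → α) (u v i : ℕ) : α :=
  if i ≤ u then p i else if i ≤ u + 1 + v then q i else p (i - 1)

/-- The sequence `q` with the terms at the places `u + 1, …, u + 1 + v` replaced by those of `p` at
the places `u + 1, …, u + v`. -/
def spliceOut {α : Type*} (p q : ℕ → α) (u v i : ℕ) : α :=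
  if i ≤ u then q i else if i ≤ u + v then p i else q (i + 1)

/-- The new polygons have the old sides except at two places, where a side of `p` and a side of `q`
exchange their endpoints. For `v = 0` both exchanges involve the same side of `p`, so the second one
acts on the side from `q u` to `p (u + 1)` that the first has made; hence the two forms `h₂` and
`h₃`. -/
theorem sum_splice_le {α : Type*} (L : α → α → ℝ) (p q : ℕ → α) (u v w : ℕ)
    (h₁ : L (p u) (q (u + 1)) + L (q u) (p (u + 1))
      ≤ L (p u) (p (u + 1)) + L (q u) (q (u + 1)))
    (h₂ : v = 0 → L (q u) (q (u + 2)) + L (q (u + 1)) (p (u + 1))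
      ≤ L (q u) (p (u + 1)) + L (q (u + 1)) (q (u + 2)))
    (h₃ : v ≠ 0 → L (p (u + v)) (q (u + v + 2)) + L (q (u + v + 1)) (p (u + v + 1))
      ≤ L (p (u + v)) (p (u + v + 1)) + L (q (u + v + 1)) (q (u + v + 2))) :
    ∑ i ∈ Finset.range (u + 1 + v + w + 1), L (spliceIn p q u v i) (spliceIn p q u v (i + 1))
      + ∑ i ∈ Finset.range (u + 1 + v + w + 1), L (spliceOut p q u v i) (spliceOut p q u v (i + 1))
      ≤ ∑ i ∈ Finset.range (u + 1 + v + w), L (p i) (p (i + 1))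
        + ∑ i ∈ Finset.range (u + 1 + v + w + 2), L (q i) (q (i + 1)) := by
  have e1 : ∑ i ∈ Finset.range (u + 1 + v + 1 + w),
        L (spliceIn p q u v i) (spliceIn p q u v (i + 1))
      = ∑ i ∈ Finset.range u, L (p i) (p (i + 1)) + L (p u) (q (u + 1))
        + ∑ i ∈ Finset.range v, L (q (u + 1 + i)) (q (u + 1 + i + 1))
        + L (q (u + 1 + v)) (p (u + 1 + v))
        + ∑ i ∈ Finset.range w, L (p (u + 1 + v + i)) (p (u + 1 + v + i + 1)) := by
    rw [Finset.sum_range_add, Finset.sum_range_succ, Finset.sum_range_add, Finset.sum_range_succ]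
    congr 1; congr 1; congr 1; congr 1
    · refine Finset.sum_congr rfl fun i hi => ?_
      rw [Finset.mem_range] at hi
      simp [spliceIn, show i ≤ u by omega, show i + 1 ≤ u by omega]
    · simp [spliceIn]
    · refine Finset.sum_congr rfl fun i hi => ?_
      rw [Finset.mem_range] at hi
      simp only [spliceIn]
      rw [if_neg (by omega), if_pos (by omega), if_neg (by omega), if_pos (by omega)]
    · simp only [spliceIn]
      rw [if_neg (by omega), if_pos (by omega), if_neg (by omega), if_neg (by omega)]
      rfl
    · refine Finset.sum_congr rfl fun i hi => ?_
      simp only [spliceIn]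
      rw [if_neg (by omega), if_neg (by omega), if_neg (by omega), if_neg (by omega)]
      rw [show u + 1 + v + 1 + i - 1 = u + 1 + v + i by omega,
        show u + 1 + v + 1 + i + 1 - 1 = u + 1 + v + i + 1 by omega]
  have e2 : ∑ i ∈ Finset.range (u + 1 + v + w), L (p i) (p (i + 1))
      = ∑ i ∈ Finset.range u, L (p i) (p (i + 1)) + L (p u) (p (u + 1))
        + ∑ i ∈ Finset.range v, L (p (u + 1 + i)) (p (u + 1 + i + 1))
        + ∑ i ∈ Finset.range w, L (p (u + 1 + v + i)) (p (u + 1 + v + i + 1)) := by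
    rw [Finset.sum_range_add, Finset.sum_range_add, Finset.sum_range_succ]
  have e3 : ∑ i ∈ Finset.range (u + 1 + v + 1 + (w + 1)), L (q i) (q (i + 1))
      = ∑ i ∈ Finset.range u, L (q i) (q (i + 1)) + L (q u) (q (u + 1))
        + ∑ i ∈ Finset.range v, L (q (u + 1 + i)) (q (u + 1 + i + 1))
        + L (q (u + 1 + v)) (q (u + 1 + v + 1))
        + ∑ i ∈ Finset.range (w + 1), L (q (u + 1 + v + 1 + i)) (q (u + 1 + v + 1 + i + 1)) := by
    rw [Finset.sum_range_add, Finset.sum_range_succ, Finset.sum_range_add, Finset.sum_range_succ]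
  have e4 : ∑ i ∈ Finset.range (u + 1 + v + (w + 1)),
        L (spliceOut p q u v i) (spliceOut p q u v (i + 1))
      ≤ ∑ i ∈ Finset.range u, L (q i) (q (i + 1))
        + ∑ i ∈ Finset.range v, L (p (u + 1 + i)) (p (u + 1 + i + 1))
        + ∑ i ∈ Finset.range (w + 1), L (q (u + 1 + v + 1 + i)) (q (u + 1 + v + 1 + i + 1))
        + (L (p u) (p (u + 1)) + L (q u) (q (u + 1)) + L (q (u + 1 + v)) (q (u + 1 + v + 1))
          - L (p u) (q (u + 1)) - L (q (u + 1 + v)) (p (u + 1 + v))) := by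
    have t1 : ∑ i ∈ Finset.range u, L (spliceOut p q u v i) (spliceOut p q u v (i + 1))
        = ∑ i ∈ Finset.range u, L (q i) (q (i + 1)) := by
      refine Finset.sum_congr rfl fun i hi => ?_
      rw [Finset.mem_range] at hi
      simp [spliceOut, show i ≤ u by omega, show i + 1 ≤ u by omega]
    have t3 : ∑ i ∈ Finset.range (w + 1),
          L (spliceOut p q u v (u + 1 + v + i)) (spliceOut p q u v (u + 1 + v + i + 1))
        = ∑ i ∈ Finset.range (w + 1), L (q (u + 1 + v + 1 + i)) (q (u + 1 + v + 1 + i + 1)) := by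
      refine Finset.sum_congr rfl fun i hi => ?_
      simp only [spliceOut]
      rw [if_neg (by omega), if_neg (by omega), if_neg (by omega), if_neg (by omega)]
      rw [show u + 1 + v + i + 1 = u + 1 + v + 1 + i by omega]
    rw [Finset.sum_range_add, Finset.sum_range_add, Finset.sum_range_succ, t1, t3]
    rcases v with _ | v
    · have h₂ := h₂ rfl
      have t2 : L (spliceOut p q u 0 u) (spliceOut p q u 0 (u + 1)) = L (q u) (q (u + 2)) := by
        simp [spliceOut]
      rw [t2]
      simp only [Finset.range_zero, Finset.sum_empty, add_zero]
      linarith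
    · have h₃ := h₃ (by omega)
      have t2 : L (spliceOut p q u (v + 1) u) (spliceOut p q u (v + 1) (u + 1))
          = L (q u) (p (u + 1)) := by
        simp [spliceOut]
      have t4 : ∑ i ∈ Finset.range v, L (spliceOut p q u (v + 1) (u + 1 + i))
            (spliceOut p q u (v + 1) (u + 1 + i + 1))
          = ∑ i ∈ Finset.range v, L (p (u + 1 + i)) (p (u + 1 + i + 1)) := by
        refine Finset.sum_congr rfl fun i hi => ?_
        rw [Finset.mem_range] at hi
        simp only [spliceOut]
        rw [if_neg (by omega), if_pos (by omega), if_neg (by omega), if_pos (by omega)]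
      have t5 : L (spliceOut p q u (v + 1) (u + 1 + v)) (spliceOut p q u (v + 1) (u + 1 + v + 1))
          = L (p (u + (v + 1))) (q (u + (v + 1) + 2)) := by
        simp only [spliceOut]
        rw [if_neg (by omega), if_pos (by omega), if_neg (by omega), if_neg (by omega)]
        rw [show u + 1 + v = u + (v + 1) by omega]
      rw [t2, Finset.sum_range_succ _ v, t4, t5,
        Finset.sum_range_succ (fun i => L (p (u + 1 + i)) (p (u + 1 + i + 1))) v,
        show u + 1 + v = u + (v + 1) by omega, show u + 1 + (v + 1) = u + (v + 1) + 1 by omega]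
      linarith
  rw [show u + 1 + v + 1 + w = u + 1 + v + w + 1 by omega] at e1
  rw [show u + 1 + v + 1 + (w + 1) = u + 1 + v + w + 2 by omega] at e3
  rw [show u + 1 + v + (w + 1) = u + 1 + v + w + 1 by omega] at e4
  linarith

/-- Two closed polygons with `m` and `m + 2` vertices can be recombined to two closed polygons with
`m + 1` vertices without increasing the total loss. -/
theorem exists_exchange {K : Set Plane} (hK : IsSpindleConvexDisk K)
    (hdiam : ∀ x ∈ K, ∀ y ∈ K, sqDist x y < 4) {key : Plane → ℝ} {m : ℕ} {p q : ℕ → Plane}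
    (hk : IsBoundaryKey K (p 0) key) (hp : IsKeyedSeq K key m p) (hq : IsKeyedSeq K key (m + 2) q)
    (hm : 2 ≤ m)
    (hstuck : ∀ z : Plane, ∃ i < m, ∃ n, IsUnitNormal K n (p i) ∧ 0 ≤ dotp n z) :
    ∃ p' q', IsKeyedSeq K key (m + 1) p' ∧ IsKeyedSeq K key (m + 1) q' ∧
      ∑ i ∈ Finset.range (m + 1), capLoss K (p' i) (p' (i + 1))
        + ∑ i ∈ Finset.range (m + 1), capLoss K (q' i) (q' (i + 1))
      ≤ ∑ i ∈ Finset.range m, capLoss K (p i) (p (i + 1))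
        + ∑ i ∈ Finset.range (m + 2), capLoss K (q i) (q (i + 1)) := by
  classical
  have hp0 : p 0 ∈ frontier K := hp.mem 0 (by omega)
  -- the first place where `q` is behind `p`, and where it is two steps behind
  have hex₁ : ∃ j, j = m ∨ key (q j) < key (p j) := ⟨m, Or.inl rfl⟩
  have hex₂ : ∃ j, j = m + 1 ∨ 1 ≤ j ∧ key (q j) < key (p (j - 1)) := ⟨m + 1, Or.inl rfl⟩
  -- `p 0` has the least key, so `q` is not behind at the start.
  obtain ⟨u, hu⟩ : ∃ u, Nat.find hex₁ = u + 1 := by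
    refine Nat.exists_eq_succ_of_ne_zero fun h0 => ?_
    rcases h0 ▸ Nat.find_spec hex₁ with h | h
    · omega
    · exact (hk.min _ (hq.mem 0 (by omega))).not_gt h
  have hu1 : u + 1 = m ∨ key (q (u + 1)) < key (p (u + 1)) := hu ▸ Nat.find_spec hex₁
  have hum : u + 1 ≤ m := hu ▸ Nat.find_min' hex₁ (Or.inl rfl)
  have hu2 : ∀ j ≤ u, key (p j) ≤ key (q j) := fun j hj => by
    have := Nat.find_min hex₁ (m := j) (by omega)
    push Not at this
    exact this.2
  -- Up to place `u`, `q j` is not before `p j`, so `q (j + 1)` is strictly after it.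
  have hlt₂ : u + 1 < Nat.find hex₂ := by
    by_contra hcon
    rcases Nat.find_spec hex₂ with h | ⟨h1, h2⟩
    · omega
    · have h3 := hu2 (Nat.find hex₂ - 1) (by omega)
      have h4 := hq.lt (i := Nat.find hex₂ - 1) (j := Nat.find hex₂) (by omega) (by omega)
      linarith
  obtain ⟨v, hv⟩ : ∃ v, Nat.find hex₂ = u + v + 2 := ⟨Nat.find hex₂ - (u + 2), by omega⟩
  have hv1 : u + v + 2 = m + 1 ∨ key (q (u + v + 2)) < key (p (u + v + 1)) := by
    have := hv ▸ Nat.find_spec hex₂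
    exact this.imp_right And.right
  have hvm : u + v + 2 ≤ m + 1 := hv ▸ Nat.find_min' hex₂ (Or.inl rfl)
  have hv2 : key (p (u + v)) ≤ key (q (u + v + 1)) := by
    have := Nat.find_min hex₂ (m := u + v + 1) (by omega)
    push Not at this
    exact this.2 (by omega)
  obtain ⟨w, hw⟩ : ∃ w, m = u + 1 + v + w := ⟨m - (u + 1 + v), by omega⟩
  have hF : ∀ i ≤ m, p i ∈ frontier K := fun i hi => by
    rcases hi.eq_or_lt with rfl | hi
    · rw [hp.closed]; exact hp0
    · exact hp.mem i hi
  -- All exchanges take place between `p i` and `p (i + 1)`, with `p (i + 1)` as the fourth point.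
  -- So every vertex of the stuck polygon `p` lies outside the quadruple.
  have monge : ∀ i b c, i < m → key (p i) ≤ key b → key b < key c →
      (i + 1 = m ∨ key c < key (p (i + 1))) → b ∈ frontier K → c ∈ frontier K → ∀ a ∈ frontier K,
      key (p i) ≤ key a → key a ≤ key b → (key (p 0) < key a ∨ i + 1 < m) →
      capLoss K a c + capLoss K b (p (i + 1)) ≤ capLoss K a (p (i + 1)) + capLoss K b c := by
    intro i b c hi hib hbc hc hbF hcF a haF hia hab ha0
    refine hk.capLoss_quadrangle hK hdiam (P := {s | ∃ j < m, s = p j}) hp0 haF hbF hcF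
      (hF _ (by omega)) hab hbc ?_ ?_ ?_
    · rcases (show i + 1 = m ∨ i + 1 < m by omega) with h | h
      · right
        rw [h, hp.closed]
        exact ⟨rfl, ha0.resolve_right (by omega)⟩
      · exact Or.inl (hc.resolve_left (by omega))
    · rintro _ ⟨j, hj, rfl⟩
      refine ⟨hp.mem j hj, ?_⟩
      rcases le_or_gt j i with hji | hji
      · exact Or.inl ((hp.le hji hi).trans hia)
      · exact Or.inr ⟨hc.resolve_left (by omega), hp.le hji hj⟩
    · intro z
      obtain ⟨j, hj, n, hn⟩ := hstuck z
      exact ⟨p j, ⟨j, hj, rfl⟩, n, hn⟩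
  have hpos : ∀ i < m, key (p 0) < key (p i) ∨ i + 1 < m := fun i hi => by
    rcases Nat.eq_zero_or_pos i with rfl | h
    · exact Or.inr (by omega)
    · exact Or.inl (hp.lt h hi)
  refine ⟨spliceIn p q u v, spliceOut p q u v, ⟨?_, ?_, ?_⟩, ⟨?_, ?_, ?_⟩, ?_⟩
  · intro i hi
    unfold spliceIn
    split_ifs with h1 h2
    · exact hp.mem i (by omega)
    · exact hq.mem i (by omega)
    · exact hp.mem _ (by omega)
  · unfold spliceIn
    rw [if_neg (by omega), if_neg (by omega), if_pos (by omega)]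
    exact hp.closed
  · intro i hi
    unfold spliceIn
    rcases (show i < u ∨ i = u ∨ u < i ∧ i < u + 1 + v ∨ i = u + v + 1 ∨ u + v + 1 < i by omega) with
      h | rfl | h | rfl | h
    · rw [if_pos h.le, if_pos (by omega)]
      exact hp.lt (by omega) (by omega)
    · rw [if_pos le_rfl, if_neg (by omega), if_pos (by omega)]
      exact (hu2 i le_rfl).trans_lt (hq.lt (by omega) (by omega))
    · rw [if_neg (by omega), if_pos (by omega), if_neg (by omega), if_pos (by omega)]
      exact hq.lt (by omega) (by omega)
    · rw [if_neg (by omega), if_pos (by omega), if_neg (by omega), if_neg (by omega)]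
      exact (hq.lt (by omega) (by omega)).trans (hv1.resolve_left (by omega))
    · rw [if_neg (by omega), if_neg (by omega), if_neg (by omega), if_neg (by omega)]
      exact hp.lt (by omega) (by omega)
  · intro i hi
    unfold spliceOut
    split_ifs with h1 h2
    · exact hq.mem i (by omega)
    · exact hp.mem i (by omega)
    · exact hq.mem _ (by omega)
  · unfold spliceOut
    rw [if_neg (by omega), if_neg (by omega), if_pos (by omega)]
    exact hq.closed
  · intro i hi
    unfold spliceOut
    rcases (show i < u ∨ i = u ∨ u < i by omega) with h | rfl | h
    · rw [if_pos h.le, if_pos (by omega)]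
      exact hq.lt (by omega) (by omega)
    · rw [if_pos le_rfl, if_neg (by omega)]
      split_ifs with hv0
      · exact (hq.lt (by omega) (by omega)).trans (hu1.resolve_left (by omega))
      · exact hq.lt (by omega) (by omega)
    · rcases (show i < u + v ∨ i = u + v ∨ u + v < i by omega) with h' | rfl | h'
      · rw [if_neg (by omega), if_pos (by omega), if_neg (by omega), if_pos (by omega)]
        exact hp.lt (by omega) (by omega)
      · rw [if_neg (by omega), if_pos (by omega), if_neg (by omega), if_neg (by omega)]
        exact hv2.trans_lt (hq.lt (by omega) (by omega))
      · rw [if_neg (by omega), if_neg (by omega), if_neg (by omega), if_neg (by omega)]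
        exact hq.lt (by omega) (by omega)
  · have hqu := hu2 u le_rfl
    have h₁ := monge u (q u) (q (u + 1)) (by omega) hqu (hq.lt (by omega) (by omega)) hu1
      (hq.mem _ (by omega)) (hq.mem _ (by omega)) (p u) (hp.mem _ (by omega)) le_rfl hqu
      (hpos u (by omega))
    have h₂ : v = 0 → capLoss K (q u) (q (u + 2)) + capLoss K (q (u + 1)) (p (u + 1))
        ≤ capLoss K (q u) (p (u + 1)) + capLoss K (q (u + 1)) (q (u + 2)) := by
      rintro rfl
      have h3 := hq.lt (i := u) (j := u + 1) (by omega) (by omega)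
      exact monge u (q (u + 1)) (q (u + 2)) (by omega) (hqu.trans h3.le)
        (hq.lt (by omega) (by omega)) (hv1.imp_left (by omega))
        (hq.mem _ (by omega)) (hq.mem _ (by omega)) (q u) (hq.mem _ (by omega)) hqu h3.le
        ((hpos u (by omega)).imp_left fun h => h.trans_le hqu)
    have h₃ : capLoss K (p (u + v)) (q (u + v + 2)) + capLoss K (q (u + v + 1)) (p (u + v + 1))
        ≤ capLoss K (p (u + v)) (p (u + v + 1)) + capLoss K (q (u + v + 1)) (q (u + v + 2)) :=
      monge (u + v) (q (u + v + 1)) (q (u + v + 2)) (by omega) hv2 (hq.lt (by omega) (by omega))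
        (hv1.imp_left (by omega)) (hq.mem _ (by omega)) (hq.mem _ (by omega)) (p (u + v))
        (hp.mem _ (by omega)) le_rfl hv2 (hpos _ (by omega))
    have := sum_splice_le (capLoss K) p q u v w h₁ h₂ fun _ => h₃
    rwa [← hw] at this

/-! ### Conclusion -/

open MeasureTheory in
/-- A disk polygon in `K` has at most the area of the unit hull of a boundary set of `K` that admits
no direction into the interior of `K`. -/
theorem exists_stuck_of_diskPolygon {K : Set Plane} (hK : IsSpindleConvexDisk K)
    (hdiam : ∀ x ∈ K, ∀ y ∈ K, sqDist x y < 4) {m : ℕ} (hm : 2 ≤ m) {c : Fin m → Plane}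
    (hc : diskPolygon c ⊆ K) :
    ∃ P : Finset Plane, P.card = m ∧ (∀ s ∈ P, s ∈ frontier K) ∧
      volume.real (diskPolygon c) ≤ volume.real (unitHull (P : Set Plane)) ∧
      ∀ z : Plane, ∃ s ∈ P, ∃ n, IsUnitNormal K n s ∧ 0 ≤ dotp n z := by
  classical
  have hfin : ∀ S : Finset Plane, (∀ s ∈ S, s ∈ K) → volume (unitHull (S : Set Plane)) ≠ ⊤ :=
    fun S hS => ((measure_mono (unitHull_subset hK hS)).trans_lt hK.isCompact.measure_lt_top).ne
  have hS : ∃ S : Finset Plane, S.card ≤ m ∧ (∀ s ∈ S, s ∈ K) ∧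
      diskPolygon c ⊆ unitHull (S : Set Plane) := by
    rcases (diskPolygon c).eq_empty_or_nonempty with h | h
    · exact ⟨∅, by simp, by simp, by simp [h]⟩
    -- With a single center, `K` would contain a whole unit disk and two points at distance 2.
    have hne : ∃ i j, c i ≠ c j := by
      by_contra hcon
      push Not at hcon
      set o := c ⟨0, by omega⟩ with ho
      have hball : ∀ x : Plane, sqDist x o ≤ 1 → x ∈ K := fun x hx =>
        hc (mem_diskPolygon_iff.2 fun i => by rw [hcon i ⟨0, by omega⟩]; exact hx)
      have h1 := hball !₂[o 0 + 1, o 1] (by simp [sqDist])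
      have h2 := hball !₂[o 0 - 1, o 1] (by simp [sqDist])
      have := hdiam _ h1 _ h2
      simp [sqDist] at this
      norm_num at this
    obtain ⟨p, hp, hsub⟩ := exists_points_unitHull hne h
    refine ⟨Finset.univ.image p, Finset.card_image_le.trans (by simp), fun s hs => ?_, ?_⟩
    · obtain ⟨i, -, rfl⟩ := Finset.mem_image.1 hs
      exact hc (hp i)
    · simpa using hsub
  obtain ⟨S, hSm, hSK, hsub⟩ := hS
  -- Two distinct points are needed to bound the enlargement.
  obtain ⟨T, hTm, hTK, x, hx, y, hy, hxy, hST⟩ : ∃ T : Finset Plane, T.card ≤ m ∧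
      (∀ s ∈ T, s ∈ K) ∧ ∃ x ∈ T, ∃ y ∈ T, x ≠ y ∧ S ⊆ T := by
    rcases le_or_gt S.card 1 with h | h
    · obtain ⟨T, hST, hTK, hT⟩ := (infinite_frontier hK).mono hK.frontier_subset
        |>.exists_superset_ncard_eq (s := (S : Set Plane)) hSK S.finite_toSet (k := 2)
        (by rw [Set.ncard_coe_finset]; omega)
      obtain ⟨x, y, hxy, rfl⟩ := Set.ncard_eq_two.1 hT
      refine ⟨{x, y}, by rw [Finset.card_pair hxy]; exact hm, fun s hs => hTK (by simpa using hs),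
        x, by simp, y, by simp, hxy, fun s hs => by simpa using hST (Finset.mem_coe.2 hs)⟩
    · obtain ⟨x, hx, y, hy, hxy⟩ := Finset.one_lt_card.1 h
      exact ⟨S, hSm, hSK, x, hx, y, hy, hxy, subset_rfl⟩
  obtain ⟨P, hPm, hPF, hvol, hstuck⟩ := exists_stuck_boundary_set hK T hTK hx hy hxy hTm
  refine ⟨P, hPm, hPF, le_trans ?_ hvol, hstuck⟩
  refine ENNReal.toReal_mono (hfin T hTK) (measure_mono (hsub.trans ?_))
  exact unitHull_subset_unitHull fun o ho s hs => ho s (hST hs)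

open MeasureTheory in
/-- The unit hull of the vertices of an inscribed polygon loses at least the caps beyond the arcs. -/
theorem IsInscribedSeq.volume_unitHull_le {K : Set Plane} {m : ℕ} {p : ℕ → Plane}
    (h : IsInscribedSeq K m p) (hK : IsSpindleConvexDisk K)
    (hdiam : ∀ x ∈ K, ∀ y ∈ K, sqDist x y < 4) (hm : 3 ≤ m) {S : Set Plane}
    (hS : ∀ s ∈ S, ∃ i < m, p i = s) :
    volume.real (unitHull S)
      ≤ volume.real K - ∑ i ∈ Finset.range m, capLoss K (p i) (p (i + 1)) := by
  have hSK : S ⊆ K := fun s hs => by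
    obtain ⟨i, hi, rfl⟩ := hS s hs
    exact hK.frontier_subset (h.mem i hi)
  refine h.volume_le hK hdiam hm (unitHull_subset hK hSK) fun x hx i hi => hx _ fun s hs => ?_
  obtain ⟨j, hj, rfl⟩ := hS s hs
  have hi0 := h.mem i hi
  have hi1 := h.mem_of_le hm (show i + 1 ≤ m from hi)
  exact sqDist_arcCenter_le hK hi0 hi1 (h.side_ne hm hi)
    (hdiam _ (hK.frontier_subset hi0) _ (hK.frontier_subset hi1)).le
    (hK.frontier_subset (h.mem j hj)) (h.side_nonneg hi hj)

open MeasureTheory in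
theorem IsInscribedSeq.le_maxInscribedArea {K : Set Plane} {m : ℕ} {p : ℕ → Plane}
    (h : IsInscribedSeq K m p) (hK : IsSpindleConvexDisk K)
    (hdiam : ∀ x ∈ K, ∀ y ∈ K, sqDist x y < 4) (hm : 3 ≤ m) :
    volume.real K - ∑ i ∈ Finset.range m, capLoss K (p i) (p (i + 1)) ≤ maxInscribedArea m K := by
  obtain ⟨c, hc, hvol⟩ := h.exists_isInscribedDiskPolygon hK hdiam hm
  exact hvol.trans (le_csSup (bddAbove_inscribedAreas m hK.isCompact) ⟨c, hc, rfl⟩)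

/-- The boundary order starts at a vertex of the stuck m-point set, so that `p 0` has the least key,
as `exists_exchange` requires. -/
theorem add_le_two_mul_maxInscribedArea {K : Set Plane} (hK : IsSpindleConvexDisk K)
    (hdiam : ∀ x ∈ K, ∀ y ∈ K, sqDist x y < 4) {m : ℕ} (hm : 3 ≤ m) {a b : ℝ}
    (ha : a ∈ inscribedAreas m K) (hb : b ∈ inscribedAreas (m + 2) K) :
    a + b ≤ 2 * maxInscribedArea (m + 1) K := by
  obtain ⟨c, hc, rfl⟩ := ha
  obtain ⟨d, hd, rfl⟩ := hb
  obtain ⟨P, rfl, hPF, hPvol, hstuck⟩ := exists_stuck_of_diskPolygon hK hdiam (by omega) hc.1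
  obtain ⟨Q, hQm, hQF, hQvol, -⟩ := exists_stuck_of_diskPolygon hK hdiam (by omega) hd.1
  obtain ⟨p₀, hp₀⟩ : P.Nonempty := Finset.card_pos.1 (by omega)
  obtain ⟨key, hk⟩ := exists_isBoundaryKey hK (hPF p₀ hp₀)
  obtain ⟨p, hp, hpP⟩ := exists_isKeyedSeq hk hPF
  obtain ⟨q, hq, hqQ⟩ := exists_isKeyedSeq hk hQF
  rw [hQm] at hq hqQ
  have hp0 : p 0 = p₀ := by
    obtain ⟨i, hi, rfl⟩ := (hpP p₀).1 hp₀
    exact hk.inj (hp.mem 0 (by omega)) (hp.mem i hi)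
      (le_antisymm (hp.le (Nat.zero_le i) hi) (hk.min _ (hp.mem 0 (by omega))))
  subst hp0
  obtain ⟨p', q', hp', hq', hsum⟩ := exists_exchange hK hdiam hk hp hq (by omega) fun z => by
    obtain ⟨s, hs, n, hn⟩ := hstuck z
    obtain ⟨i, hi, rfl⟩ := (hpP s).1 hs
    exact ⟨i, hi, n, hn⟩
  have h1 := (hp.isInscribedSeq hk).volume_unitHull_le hK hdiam hm (S := P) fun s hs => (hpP s).1 hs
  have h2 := (hq.isInscribedSeq hk).volume_unitHull_le hK hdiam (by omega) (S := Q)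
    fun s hs => (hqQ s).1 hs
  have h3 := (hp'.isInscribedSeq hk).le_maxInscribedArea hK hdiam (by omega)
  have h4 := (hq'.isInscribedSeq hk).le_maxInscribedArea hK hdiam (by omega)
  rw [MeasureTheory.measureReal_def] at hPvol hQvol
  linarith

/-- The area of an inscribed disk polygon is at most the area of `K`. -/
theorem maxInscribedArea_le {n : ℕ} (hn : 2 ≤ n) {K : Set Plane} (hK : IsSpindleConvexDisk K) :
    maxInscribedArea n K ≤ MeasureTheory.volume.real K := by
  refine csSup_le (inscribedAreas_nonempty hn hK) ?_
  rintro _ ⟨c, hc, rfl⟩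
  exact ENNReal.toReal_mono hK.isCompact.measure_lt_top.ne (MeasureTheory.measure_mono hc.1)

/-- With all centers equal to `o`, the disk-polygon is the disk itself and has no vertices. -/
theorem le_maxInscribedArea_closedBall {n : ℕ} (hn : n ≠ 0) (o : Plane) :
    MeasureTheory.volume.real (Metric.closedBall o 1)
      ≤ maxInscribedArea n (Metric.closedBall o 1) := by
  have : NeZero n := ⟨hn⟩
  have e : diskPolygon (fun _ : Fin n => o) = Metric.closedBall o 1 := Set.iInter_const _
  refine le_csSup (bddAbove_inscribedAreas n (isCompact_closedBall o 1))
    ⟨fun _ => o, ⟨e.subset, ?_⟩, by rw [e]; rfl⟩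
  rintro x ⟨-, i, j, hij, -⟩
  exact absurd rfl hij

theorem theorem1 (n : ℕ) (hn : 4 ≤ n) (K : Set Plane) (hK : IsSpindleConvexDisk K) :
    maxInscribedArea (n - 1) K + maxInscribedArea (n + 1) K ≤ 2 * maxInscribedArea n K := by
  obtain ⟨m, rfl⟩ : ∃ m, n = m + 1 := ⟨n - 1, by omega⟩
  rw [Nat.add_sub_cancel]
  -- The unit disk has chords of length 2, excluded in the quadrangle argument; there `n` disks
  -- already attain the full area.
  rcases eq_closedBall_or_sqDist_lt hK with ⟨o, rfl⟩ | hdiam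
  · have h1 := maxInscribedArea_le (n := m) (by omega) hK
    have h2 := maxInscribedArea_le (n := m + 1 + 1) (by omega) hK
    have h3 := le_maxInscribedArea_closedBall (n := m + 1) (by omega) o
    linarith
  · rw [← le_sub_iff_add_le]
    refine csSup_le (inscribedAreas_nonempty (by omega) hK) fun a ha => ?_
    rw [le_sub_comm]
    refine csSup_le (inscribedAreas_nonempty (by omega) hK) fun b hb => ?_
    have := add_le_two_mul_maxInscribedArea hK hdiam (by omega) ha hb
    linarith
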